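/- For an integer $q>1$ let $\phi$ be Euler's function, $\phi^*(q)$ the number of primitive Dirichlet characters modulo $q$, $d(q)$ the number of divisors of $q$, $\mu$ the Möbius function, $\gamma$ Euler's constant. For a Dirichlet character $\psi$ modulo $m$ with $m\mid q$ let $\tau(\psi)=\sum_{a=1}^{m}\psi(a)e^{2\pi i a/m}$ and let $$L_q(s,\psi)=L(s,\psi)\prod_{p\mid q}\left(1-\frac{\psi(p)}{p^{s}}\right),$$ where $L(s,\psi)$ is the analytically continued Dirichlet $L$-function ($\zeta(s)$ if $m=1$). Put $$S(q)=\sum_{\substack{\chi \bmod q\ \text{primitive}\\ \chi(-1)=1}}|L(1/2,\chi)|^2,$$ $$A(q)=\frac{\phi^*(q)}{2}\,\frac{\phi(q)}{q}\left(\log\frac{q}{2\pi}+2\gamma+\frac{\Gamma'}{\Gamma}(1/2)-\frac{\pi}{2}+2\sum_{p\mid q}\frac{\log p}{p-1}\right),$$ $$B(q)=2\,\frac{\phi(q)}{q^{1/2}}\sum_{\substack{cd=q\\ (c,d)=1}}\frac{\mu^2(c)}{\phi(c)}\,\frac{1}{\phi(\min\{c,d\})}\sum_{\substack{\psi \bmod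 \min\{c,d\}\\ \psi(-1)=1}}\tau(\overline{\psi})\,\overline{\psi}(\max\{c,d\})\,L_q(1/2,\psi)^2,$$ where the inner sum is over all even characters $\psi$ modulo $\min\{c,d\}$, primitive or not. Then, for every $\epsilon>0$, every integer $q>1$ and every real $D$, $$S(q)=A(q)+B(q)+O_\epsilon\left(\frac1q\sum_{\substack{d\mid q\\ d\le D}}\phi(d)d^{3/2}+\sqrt q\sum_{\substack{d\mid q\\ d>D}}\frac{\phi(d)}{d^{3/2}}+q^{\epsilon}+q^{\epsilon-1}D^2\right),$$ with an implied constant that depends only on $\epsilon$. In particular (taking $D=\sqrt q$), for every integer $q>1$, $$S(q)=A(q)+B(q)+O\left(q^{1/4}d(q)\right)$$ with an absolute implied constant. -/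

import Mathlib

open Classical in
/-- `∑* |L(1/2, χ)|²`, the sum over the primitive characters `χ` modulo `q` with `χ(-1) = 1`. -/
noncomputable def evenPrimitiveMeanSquare (q : ℕ) [NeZero q] : ℝ :=
  ∑ χ : DirichletCharacter ℂ q with χ.IsPrimitive ∧ χ.Even, ‖χ.LFunction (1 / 2)‖ ^ 2

/-- `φ*(q)`, the number of primitive characters modulo `q`. -/
noncomputable def numPrimitive (q : ℕ) : ℕ :=
  Nat.card {χ : DirichletCharacter ℂ q // χ.IsPrimitive}

/-- `L_q(s, ψ)`: the (analytically continued) `L`-function of `ψ` without the Euler factors at the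
primes dividing `q`. -/
noncomputable def coprimeLFunction (q : ℕ) {m : ℕ} [NeZero m] (ψ : DirichletCharacter ℂ m)
    (s : ℂ) : ℂ :=
  ψ.LFunction s * ∏ p ∈ q.primeFactors, (1 - ψ (p : ZMod m) * (p : ℂ) ^ (-s))

/-- For a character `ψ` of modulus `m` dividing `q`, `L_q(s, ψ)` is the `L`-function of the
character modulo `q` induced by `ψ`. -/
theorem coprimeLFunction_eq_changeLevel {q m : ℕ} [NeZero q] [NeZero m] (h : m ∣ q)
    (ψ : DirichletCharacter ℂ m) {s : ℂ} (hs : s ≠ 1) :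
    coprimeLFunction q ψ s = (DirichletCharacter.changeLevel h ψ).LFunction s :=
  (DirichletCharacter.LFunction_changeLevel h ψ (Or.inr hs)).symm

/-- `τ(ψ) = ∑_{a mod m} ψ(a) e(a / m)`, where `e(x) = exp(2πix)`. -/
noncomputable def tau {m : ℕ} [NeZero m] (ψ : DirichletCharacter ℂ m) : ℂ :=
  gaussSum ψ ZMod.stdAddChar

open Classical in
/-- `∑ᵉ τ(ψ̄) ψ̄(M) L_q(1/2, ψ)²`, the sum over all even characters `ψ` modulo `m`, for `m ≥ 1`.
The inverse character `ψ⁻¹` is the complex conjugate of `ψ`. -/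
noncomputable def evenTwistedSum (q m M : ℕ) : ℂ :=
  if h : m = 0 then 0
  else
    haveI : NeZero m := ⟨h⟩
    ∑ ψ : DirichletCharacter ℂ m with ψ.Even,
      tau ψ⁻¹ * ψ⁻¹ (M : ZMod m) * coprimeLFunction q ψ (1 / 2) ^ 2

/-- The main term. -/
noncomputable def mainTerm (q : ℕ) : ℝ :=
  (numPrimitive q : ℝ) / 2 * ((Nat.totient q : ℝ) / q) *
    (Real.log (q / (2 * Real.pi)) + 2 * Real.eulerMascheroniConstant
      + logDeriv Real.Gamma (1 / 2) - Real.pi / 2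
      + 2 * ∑ p ∈ q.primeFactors, Real.log p / ((p : ℝ) - 1))

/-- The secondary term, a sum over the factorisations `q = c d` with `(c, d) = 1`. -/
noncomputable def secondaryTerm (q : ℕ) : ℂ :=
  2 * (Nat.totient q : ℂ) / (Real.sqrt q : ℂ) *
    ∑ x ∈ q.divisorsAntidiagonal with Nat.Coprime x.1 x.2,
      ((ArithmeticFunction.moebius x.1 : ℤ) : ℂ) ^ 2 / (Nat.totient x.1 : ℂ) *
        (1 / (Nat.totient (min x.1 x.2) : ℂ)) *
        evenTwistedSum q (min x.1 x.2) (max x.1 x.2)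

open Classical in
/-- The expression inside the `O`-symbol, with parameters `D` and `ε`. -/
noncomputable def errorBound (ε : ℝ) (q : ℕ) (D : ℝ) : ℝ :=
  1 / (q : ℝ) * ∑ d ∈ q.divisors with ((d : ℕ) : ℝ) ≤ D,
      (Nat.totient d : ℝ) * (d : ℝ) ^ (3 / 2 : ℝ)
    + Real.sqrt q * ∑ d ∈ q.divisors with D < ((d : ℕ) : ℝ),
      (Nat.totient d : ℝ) / (d : ℝ) ^ (3 / 2 : ℝ)
    + (q : ℝ) ^ ε + (q : ℝ) ^ (ε - 1) * D ^ 2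

/-! Write `e(x) = exp(2πix)`. For an even primitive `χ` the functional equation at `1/2` reads
`τ(χ̄) L(1/2, χ) = √q · conj L(1/2, χ)`. Hence `√q S(q) = T(1/2)`, where `T(w) = ∑ τ(χ̄) L(w, χ)²`
runs over even primitive characters (`sqrt_mul_evenPrimitiveMeanSquare`). In this form no absolute
values remain. Since `τ(χ) τ(χ̄) = q`, the root numbers drop out of the functional equation of `T`,
which is `T(1 - s) = q^(2s-1) γ(s)² T(s)` (`evenPrimitiveTwist_one_sub`). A kernel `K` with `γ(1/2 +
s)² K(-s) = K(s)` and `K(0) = 1` makes `K(s) T(1/2 + s) q^s` even, so `π T(1/2)` is the integral,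
with respect to `Im s`, of `T(1/2 + s) q^s K(s) / s` over the line `Re s = 3/4`
(`integral_evenPrimitiveTwist`).

Möbius inversion over conductors detects primitivity. The Gauss sum of the character modulo `q = cd`
induced by `ψ` modulo `d` vanishes unless `(c, d) = 1`, and is then `μ(c) ψ(c) τ(ψ)`. So `T` splits
over coprime factorisations. By orthogonality the weights `τ(ψ̄)` turn the `(c, d)` part into the
Dirichlet series with coefficients `e(± n₁ n₂ c̄ / d)`, for `n₁ n₂` prime to `q`
(`twistedSquare_eq_tsum`).

If `c > d`, the line is moved to `Re s = -1/2 - η`. The double zero of `K` at `1/2` cancels the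
double pole of the trivial character, and the pole at `s = 0` gives the `(c, d)` part of `B(q)`.

If `c < d`, reciprocity `e(n c̄ / d) = e(-n d̄ / c) e(n / q)` first replaces the modulus `d` by the
smaller `c`, and `e(n / q)` is written as `1 + (e(n / q) - 1)`. The summand `1` gives the `(c, d)`
part of `B(q)` as before. The Mellin transform of the weight times `e(x) - 1` has no pole at `0` and
no zero forced at `1/2`, so there the residue of the double pole appears. Summed over the two signs,
it is the `(c, d)` part of `A(q)`. The missing parts with `c > d` are `O(log q)` each and are added
for free; the complete sum is `A(q)` because `q φ*(q) = ∑ μ(c) φ(d)²` (`mul_numPrimitive`).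

On the left line both factors `L(w, ψ)` are opened by the functional equation. The average over `ψ`
becomes a sum of `e((m u + n v + b u v) / k)` over units `u, v`. Its inner sum is a Ramanujan sum,
so the whole is at most `k d(k)` (`norm_sum_units_bilinear_le`). With `k = min(c, d)` and `φ(d) k ≤
q`, every factorisation contributes `O(q^(1/2+ε))` to `T(1/2)`. The total error is thus `O(q^ε)`,
which is smaller than both error terms of the theorem. -/

open Complex MeasureTheory Filter Topology Set
open scoped ZMod

/-! ### Moving vertical lines of integration through pole-free strips -/

/-- The integral over a vertical line does not change when the line is moved through a strip in
which the integrand decays exponentially. -/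
theorem integral_vertical_eq_of_decay {g : ℂ → ℂ} {a b K : ℝ} (hab : a ≤ b)
    (hd : ∀ z : ℂ, a ≤ z.re → z.re ≤ b → DifferentiableAt ℂ g z)
    (hg : ∀ z : ℂ, a ≤ z.re → z.re ≤ b → ‖g z‖ ≤ K * Real.exp (-|z.im|))
    (ha : Integrable fun t : ℝ => g (a + t * I)) (hb : Integrable fun t : ℝ => g (b + t * I)) :
    ∫ t : ℝ, g (a + t * I) = ∫ t : ℝ, g (b + t * I) := by
  have hT : Tendsto (fun n : ℕ => (n : ℝ)) atTop atTop := tendsto_natCast_atTop_atTop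
  have hT' : Tendsto (fun n : ℕ => -(n : ℝ)) atTop atBot := tendsto_neg_atTop_atBot.comp hT
  have h1 := intervalIntegral_tendsto_integral ha hT' hT
  have h2 := intervalIntegral_tendsto_integral hb hT' hT
  have key : ∀ n : ℕ, ‖(∫ y in (-(n : ℝ))..n, g (b + y * I)) - ∫ y in (-(n : ℝ))..n, g (a + y * I)‖
      ≤ 2 * (K * Real.exp (-(n : ℝ)) * |b - a|) := by
    intro n
    have h := Complex.integral_boundary_rect_eq_zero_of_differentiableOn g
      ((a : ℂ) + (-(n : ℝ) : ℝ) * I) (b + (n : ℝ) * I) (by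
        intro z hz
        rw [Complex.mem_reProdIm] at hz
        simp only [add_re, ofReal_re, mul_re, I_re, mul_zero, ofReal_im, I_im, mul_one, sub_self,
          add_zero, uIcc_of_le hab, mem_Icc] at hz
        exact (hd z hz.1.1 hz.1.2).differentiableWithinAt)
    simp only [add_re, ofReal_re, mul_re, I_re, mul_zero, ofReal_im, I_im, mul_one, sub_self,
          add_zero, add_im, mul_im, zero_add, smul_eq_mul] at h
    have hor : ∀ c : ℝ, |c| = n → ‖∫ x in a..b, g (x + c * I)‖ ≤ K * Real.exp (-(n : ℝ)) * |b - a| := by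
      intro c hc
      apply intervalIntegral.norm_integral_le_of_norm_le_const
      intro x hx
      rw [uIoc_of_le hab] at hx
      have := hg (x + c * I) (by simpa using hx.1.le) (by simpa using hx.2)
      simpa [hc] using this
    have e1 := hor (-(n : ℝ)) (by simp)
    have e2 := hor n (by simp)
    have h' : (∫ y in (-(n : ℝ))..n, g (b + y * I)) - ∫ y in (-(n : ℝ))..n, g (a + y * I)
        = I * ((∫ x in a..b, g (x + (-(n : ℝ) : ℝ) * I)) - ∫ x in a..b, g (x + (n : ℝ) * I)) := by
      have hI : I * I = -1 := I_mul_I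
      linear_combination (-I) * h +
        ((∫ y in (-(n : ℝ))..n, g (b + y * I)) - ∫ y in (-(n : ℝ))..n, g (a + y * I)) * hI
    rw [h', norm_mul, norm_I, one_mul]
    calc _ ≤ _ := norm_sub_le _ _
      _ ≤ _ := by linarith
  have hlim : Tendsto (fun n : ℕ => 2 * (K * Real.exp (-(n : ℝ)) * |b - a|)) atTop (𝓝 0) := by
    have : Tendsto (fun n : ℕ => Real.exp (-(n : ℝ))) atTop (𝓝 0) :=
      Real.tendsto_exp_atBot.comp hT'
    simpa using ((this.const_mul K).mul_const |b - a|).const_mul 2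
  have h3 := squeeze_zero_norm key hlim
  have h4 := h2.sub h1
  have := tendsto_nhds_unique h3 h4
  exact (sub_eq_zero.mp this.symm).symm

theorem norm_exp_mul_sq (ν : ℝ) (z : ℂ) :
    ‖cexp (ν * z ^ 2)‖ = Real.exp (ν * (z.re ^ 2 - z.im ^ 2)) := by
  rw [Complex.norm_exp]
  congr 1
  simp [pow_two]

/-- The integral over a vertical line does not change when the line is moved through a strip in
which the integrand is holomorphic of at most exponential growth. -/
theorem integral_vertical_eq {g : ℂ → ℂ} {a b C : ℝ} (hab : a ≤ b)
    (hd : ∀ z : ℂ, a ≤ z.re → z.re ≤ b → DifferentiableAt ℂ g z)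
    (hg : ∀ z : ℂ, a ≤ z.re → z.re ≤ b → ‖g z‖ ≤ C * Real.exp (C * |z.im|))
    (ha : Integrable fun t : ℝ => g (a + t * I)) (hb : Integrable fun t : ℝ => g (b + t * I)) :
    ∫ t : ℝ, g (a + t * I) = ∫ t : ℝ, g (b + t * I) := by
  set M := a ^ 2 + b ^ 2 with hM
  have hre : ∀ x : ℝ, a ≤ x → x ≤ b → x ^ 2 ≤ M := by
    intro x h1 h2
    rcases le_total 0 x with h | h <;> nlinarith [sq_nonneg a, sq_nonneg b]
  have hC : 0 ≤ C := by
    have := (norm_nonneg _).trans (hg a (by simp) (by simpa using hab))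
    simpa using this
  have hbd : ∀ ν : ℝ, 0 ≤ ν → ν ≤ 1 → ∀ z : ℂ, a ≤ z.re → z.re ≤ b →
      ‖cexp (ν * z ^ 2)‖ ≤ Real.exp M := by
    intro ν h0 h1 z hz1 hz2
    rw [norm_exp_mul_sq]
    apply Real.exp_le_exp.mpr
    nlinarith [hre z.re hz1 hz2, sq_nonneg z.im, sq_nonneg z.re, sq_nonneg a, sq_nonneg b]
  have hint : ∀ ν : ℝ, 0 ≤ ν → ν ≤ 1 → ∀ x : ℝ, a ≤ x → x ≤ b →
      Integrable (fun t : ℝ => g (x + t * I)) →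
      Integrable (fun t : ℝ => g (x + t * I) * cexp (ν * (x + t * I) ^ 2)) := by
    intro ν h0 h1 x hx1 hx2 hi
    refine hi.mul_bdd (c := Real.exp M) (Continuous.aestronglyMeasurable (by fun_prop)) ?_
    exact Eventually.of_forall fun t => hbd ν h0 h1 _ (by simpa using hx1) (by simpa using hx2)
  -- The integrand is damped by `exp (ν z²)` with `ν = 1 / (n + 1)`. Its modulus `exp (ν (x² - t²))`
  -- beats every exponential in `|t|`, and it is bounded uniformly in `ν ≤ 1`, so that dominated
  -- convergence removes it as `n → ∞`.
  have step : ∀ n : ℕ, ∫ t : ℝ, g (a + t * I) * cexp (((1 / ((n : ℝ) + 1) : ℝ) : ℂ) * (a + t * I) ^ 2)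
      = ∫ t : ℝ, g (b + t * I) * cexp (((1 / ((n : ℝ) + 1) : ℝ) : ℂ) * (b + t * I) ^ 2) := by
    intro n
    set ν : ℝ := 1 / ((n : ℝ) + 1) with hν
    have hν0 : 0 < ν := by positivity
    have hν1 : ν ≤ 1 := by
      rw [hν, div_le_one (by positivity)]; linarith [(Nat.cast_nonneg n : (0 : ℝ) ≤ n)]
    refine integral_vertical_eq_of_decay (g := fun z => g z * cexp (ν * z ^ 2))
      (K := C * Real.exp (M + (C + 1) ^ 2 / (4 * ν))) hab ?_ ?_
      (hint ν hν0.le hν1 a le_rfl hab ha) (hint ν hν0.le hν1 b hab le_rfl hb)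
    · intro z h1 h2
      exact (hd z h1 h2).mul (by fun_prop)
    · intro z h1 h2
      rw [norm_mul, norm_exp_mul_sq]
      calc _ ≤ C * Real.exp (C * |z.im|) * Real.exp (ν * (z.re ^ 2 - z.im ^ 2)) := by
            gcongr; exact hg z h1 h2
        _ = C * Real.exp (C * |z.im| + ν * (z.re ^ 2 - z.im ^ 2)) := by rw [mul_assoc, ← Real.exp_add]
        _ ≤ C * Real.exp (M + (C + 1) ^ 2 / (4 * ν) - |z.im|) := by
            gcongr
            have e1 : ν * z.re ^ 2 ≤ M := by
              nlinarith [hre z.re h1 h2, sq_nonneg z.re, sq_nonneg a, sq_nonneg b]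
            -- Completing the square. The `1` in `C + 1` is the decay `exp (-|t|)` asked for by the
            -- damped case.
            have e2 : (C + 1) * |z.im| ≤ (C + 1) ^ 2 / (4 * ν) + ν * |z.im| ^ 2 := by
              have : (C + 1) ^ 2 / (4 * ν) + ν * |z.im| ^ 2 - (C + 1) * |z.im|
                = (C + 1 - 2 * ν * |z.im|) ^ 2 / (4 * ν) := by field_simp; ring
              have h3 : 0 ≤ (C + 1 - 2 * ν * |z.im|) ^ 2 / (4 * ν) := by positivity
              linarith
            rw [sq_abs] at e2
            linarith
        _ = _ := by rw [sub_eq_add_neg, Real.exp_add]; ring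
  have lim : ∀ x : ℝ, a ≤ x → x ≤ b → Integrable (fun t : ℝ => g (x + t * I)) →
      Tendsto (fun n : ℕ => ∫ t : ℝ, g (x + t * I) *
        cexp (((1 / ((n : ℝ) + 1) : ℝ) : ℂ) * (x + t * I) ^ 2)) atTop (𝓝 (∫ t : ℝ, g (x + t * I))) := by
    intro x hx1 hx2 hi
    refine tendsto_integral_of_dominated_convergence
      (fun t => ‖g (x + t * I)‖ * Real.exp M) ?_ (hi.norm.mul_const _) ?_ ?_
    · intro n
      exact hi.aestronglyMeasurable.mul (Continuous.aestronglyMeasurable (by fun_prop))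
    · intro n
      refine Eventually.of_forall fun t => ?_
      rw [norm_mul]
      gcongr
      refine hbd _ (by positivity) ?_ _ (by simpa using hx1) (by simpa using hx2)
      rw [div_le_one (by positivity)]; linarith [(Nat.cast_nonneg n : (0 : ℝ) ≤ n)]
    · refine Eventually.of_forall fun t => ?_
      have h1 : Tendsto (fun n : ℕ => ((1 / ((n : ℝ) + 1) : ℝ) : ℂ)) atTop (𝓝 0) := by
        have := (continuous_ofReal.tendsto 0).comp (tendsto_one_div_add_atTop_nhds_zero_nat (𝕜 := ℝ))
        simpa [Function.comp_def] using this
      have h2 := ((h1.mul_const (((x : ℂ) + t * I) ^ 2)).cexp).const_mul (g (x + t * I))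
      simpa using h2
  have h1 := lim a le_rfl hab ha
  have h2 := lim b hab le_rfl hb
  simp_rw [step] at h1
  exact tendsto_nhds_unique h1 h2

/-! ### Functions of exponential growth on a strip -/

/-- At most exponential growth in the imaginary direction, uniformly on a vertical strip. -/
def ExpGrowth (f : ℂ → ℂ) (a b : ℝ) : Prop :=
  ∃ C : ℝ, 0 ≤ C ∧ ∀ z : ℂ, a ≤ z.re → z.re ≤ b → ‖f z‖ ≤ C * Real.exp (C * |z.im|)

namespace ExpGrowth

variable {f g : ℂ → ℂ} {a b : ℝ}

theorem add (hf : ExpGrowth f a b) (hg : ExpGrowth g a b) : ExpGrowth (fun z => f z + g z) a b := by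
  obtain ⟨C, h0, hC⟩ := hf
  obtain ⟨D, h1, hD⟩ := hg
  refine ⟨C + D, by positivity, fun z hz1 hz2 => (norm_add_le _ _).trans ?_⟩
  have e1 : Real.exp (C * |z.im|) ≤ Real.exp ((C + D) * |z.im|) := by gcongr; linarith
  have e2 : Real.exp (D * |z.im|) ≤ Real.exp ((C + D) * |z.im|) := by gcongr; linarith
  calc _ ≤ C * Real.exp ((C + D) * |z.im|) + D * Real.exp ((C + D) * |z.im|) :=
        add_le_add ((hC z hz1 hz2).trans (by gcongr)) ((hD z hz1 hz2).trans (by gcongr))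
    _ = _ := by ring

theorem mul (hf : ExpGrowth f a b) (hg : ExpGrowth g a b) : ExpGrowth (fun z => f z * g z) a b := by
  obtain ⟨C, h0, hC⟩ := hf
  obtain ⟨D, h1, hD⟩ := hg
  -- One constant must serve both as prefactor, where `C * D` is needed, and as exponent, where `C +
  -- D` is needed.
  refine ⟨C * D + (C + D), by positivity, fun z hz1 hz2 => ?_⟩
  rw [norm_mul]
  calc _ ≤ (C * Real.exp (C * |z.im|)) * (D * Real.exp (D * |z.im|)) := by
        gcongr
        · exact hC z hz1 hz2
        · exact hD z hz1 hz2
    _ = (C * D) * Real.exp ((C + D) * |z.im|) := by rw [add_mul, Real.exp_add]; ring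
    _ ≤ _ := mul_le_mul (by linarith)
        (Real.exp_le_exp.mpr (mul_le_mul_of_nonneg_right (by nlinarith [mul_nonneg h0 h1])
          (abs_nonneg _))) (Real.exp_pos _).le (by positivity)

theorem const (c : ℂ) : ExpGrowth (fun _ => c) a b :=
  ⟨‖c‖, norm_nonneg _, fun z _ _ => le_mul_of_one_le_right (norm_nonneg _)
    (Real.one_le_exp (by positivity))⟩

theorem sum {ι : Type*} (s : Finset ι) {F : ι → ℂ → ℂ} (h : ∀ i ∈ s, ExpGrowth (F i) a b) :
    ExpGrowth (fun z => ∑ i ∈ s, F i z) a b := by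
  classical
  induction s using Finset.induction_on with
  | empty => simpa using const 0
  | insert i s hi ih =>
    simp_rw [Finset.sum_insert hi]
    exact (h i (by simp)).add (ih fun j hj => h j (by simp [hj]))

theorem neg (hf : ExpGrowth f a b) : ExpGrowth (fun z => -f z) a b := by
  obtain ⟨C, h0, hC⟩ := hf
  exact ⟨C, h0, fun z h1 h2 => by simpa using hC z h1 h2⟩

theorem sub (hf : ExpGrowth f a b) (hg : ExpGrowth g a b) : ExpGrowth (fun z => f z - g z) a b := by
  simpa [sub_eq_add_neg] using hf.add hg.neg

theorem pow (hf : ExpGrowth f a b) (n : ℕ) : ExpGrowth (fun z => f z ^ n) a b := by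
  induction n with
  | zero => simpa using const 1
  | succ n ih => simpa [pow_succ] using ih.mul hf

theorem of_bounded {K : ℝ} (h : ∀ z : ℂ, a ≤ z.re → z.re ≤ b → ‖f z‖ ≤ K) : ExpGrowth f a b :=
  ⟨|K|, abs_nonneg _, fun z h1 h2 => (h z h1 h2).trans ((le_abs_self K).trans
    (le_mul_of_one_le_right (abs_nonneg _) (Real.one_le_exp (by positivity))))⟩

theorem congr (hf : ExpGrowth f a b) (h : ∀ z : ℂ, a ≤ z.re → z.re ≤ b → g z = f z) :
    ExpGrowth g a b := by
  obtain ⟨C, h0, hC⟩ := hf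
  exact ⟨C, h0, fun z h1 h2 => by rw [h z h1 h2]; exact hC z h1 h2⟩

theorem mono {a' b' : ℝ} (hf : ExpGrowth f a b) (ha : a ≤ a') (hb : b' ≤ b) : ExpGrowth f a' b' := by
  obtain ⟨C, h0, hC⟩ := hf
  exact ⟨C, h0, fun z h1 h2 => hC z (ha.trans h1) (h2.trans hb)⟩

theorem comp_add_const (hf : ExpGrowth f a b) (c : ℝ) :
    ExpGrowth (fun z => f (z + c)) (a - c) (b - c) := by
  obtain ⟨C, h0, hC⟩ := hf
  refine ⟨C, h0, fun z h1 h2 => ?_⟩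
  have := hC (z + c) (by simp; linarith) (by simp; linarith)
  simpa using this

theorem comp_const_sub (hf : ExpGrowth f a b) (c : ℝ) :
    ExpGrowth (fun z => f (c - z)) (c - b) (c - a) := by
  obtain ⟨C, h0, hC⟩ := hf
  refine ⟨C, h0, fun z h1 h2 => ?_⟩
  have := hC (c - z) (by simp; linarith) (by simp; linarith)
  simpa using this

/-- On a strip it suffices to control a continuous function away from the real axis. -/
theorem of_one_le_abs_im (hc : ∀ z : ℂ, a ≤ z.re → z.re ≤ b → ContinuousAt f z)
    (hf : ∃ C : ℝ, 0 ≤ C ∧ ∀ z : ℂ, a ≤ z.re → z.re ≤ b → 1 ≤ |z.im| →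
      ‖f z‖ ≤ C * Real.exp (C * |z.im|)) : ExpGrowth f a b := by
  obtain ⟨C, h0, hC⟩ := hf
  have hK : IsCompact (Icc a b ×ℂ Icc (-1 : ℝ) 1) := isCompact_Icc.reProdIm isCompact_Icc
  obtain ⟨D, hD⟩ := hK.exists_bound_of_continuousOn (f := f) fun z hz => by
    rw [Complex.mem_reProdIm] at hz
    exact (hc z hz.1.1 hz.1.2).continuousWithinAt
  refine ⟨C + |D|, by positivity, fun z h1 h2 => ?_⟩
  rcases le_total 1 |z.im| with h | h
  · refine (hC z h1 h2 h).trans ?_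
    gcongr <;> linarith [abs_nonneg D]
  · have := hD z (by rw [Complex.mem_reProdIm]; exact ⟨⟨h1, h2⟩, abs_le.mp h⟩)
    calc ‖f z‖ ≤ C + |D| := this.trans ((le_abs_self D).trans (by linarith))
      _ ≤ _ := le_mul_of_one_le_right (by positivity) (Real.one_le_exp (by positivity))

/-- At distance at least one from the real axis the denominator `z - p` has modulus at least one, so
division costs nothing. Near the axis continuity and compactness suffice. -/
theorem dslope {p : ℝ}
    (hd' : ∀ z : ℂ, a ≤ z.re → z.re ≤ b → DifferentiableAt ℂ (dslope f p) z)
    (hf : ExpGrowth f a b) : ExpGrowth (dslope f p) a b := by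
  have h2 := hf.sub (const (f p))
  obtain ⟨C, h0, hC⟩ := h2
  refine of_one_le_abs_im (fun z h1 h2 => (hd' z h1 h2).continuousAt) ⟨C, h0, fun z h1 h2 h3 => ?_⟩
  have hz : 1 ≤ ‖z - p‖ := h3.trans (by simpa using Complex.abs_im_le_norm (z - p))
  have hne : z ≠ p := by
    rintro rfl; simp at hz; linarith
  rw [dslope_of_ne _ hne, slope_def_field, norm_div]
  exact (div_le_self (norm_nonneg _) hz).trans (hC z h1 h2)

end ExpGrowth

theorem differentiableAt_dslope_strip {f : ℂ → ℂ} {a b p : ℝ} (ha : a < p) (hb : p < b)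
    (hd : ∀ z : ℂ, a ≤ z.re → z.re ≤ b → DifferentiableAt ℂ f z) {z : ℂ} (h1 : a ≤ z.re)
    (h2 : z.re ≤ b) : DifferentiableAt ℂ (dslope f p) z := by
  by_cases hz : z = p
  · have hs : {z : ℂ | a < z.re ∧ z.re < b} ∈ 𝓝 (p : ℂ) := by
      apply IsOpen.mem_nhds
      · exact (isOpen_lt continuous_const continuous_re).inter (isOpen_lt continuous_re continuous_const)
      · simpa using ⟨ha, hb⟩
    have := (Complex.differentiableOn_dslope (f := f) hs).mpr
      (fun w hw => (hd w hw.1.le hw.2.le).differentiableWithinAt)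
    rw [hz]
    exact this.differentiableAt hs
  · exact (differentiableAt_dslope_of_ne hz).mpr (hd z h1 h2)

/-! ### Explicit integrals over vertical lines, and crossing simple and double poles -/

theorem vertical_ne_zero {σ : ℝ} (hσ : σ ≠ 0) (t : ℝ) : (σ : ℂ) + t * I ≠ 0 := fun h => by
  have := congrArg Complex.re h
  simp at this
  exact hσ this

theorem abs_le_norm_vertical (σ t : ℝ) : |σ| ≤ ‖(σ : ℂ) + t * I‖ := by
  simpa using Complex.abs_re_le_norm ((σ : ℂ) + t * I)

theorem normSq_vertical (σ t : ℝ) : ‖(σ : ℂ) + t * I‖ ^ 2 = σ ^ 2 + t ^ 2 := by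
  rw [← Complex.normSq_eq_norm_sq, Complex.normSq_apply]; simp; ring

theorem integrable_inv_vertical_sq {σ : ℝ} (hσ : σ ≠ 0) :
    Integrable fun t : ℝ => (((σ : ℂ) + t * I) ^ 2)⁻¹ := by
  have h : Integrable fun t : ℝ => (σ ^ 2)⁻¹ * (1 + (t * σ⁻¹) ^ 2)⁻¹ :=
    (integrable_inv_one_add_sq.comp_mul_right' (inv_ne_zero hσ)).const_mul _
  refine h.mono' (Continuous.aestronglyMeasurable ?_) (Eventually.of_forall fun t => ?_)
  · exact Continuous.inv₀ (by fun_prop) fun t => pow_ne_zero _ (vertical_ne_zero hσ t)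
  · rw [norm_inv, norm_pow, normSq_vertical, ← mul_inv]
    apply le_of_eq
    congr 1
    field_simp

theorem integral_inv_vertical_sq {σ : ℝ} (hσ : σ ≠ 0) :
    ∫ t : ℝ, (((σ : ℂ) + t * I) ^ 2)⁻¹ = 0 := by
  have hder : ∀ t : ℝ, HasDerivAt (fun t : ℝ => I * ((σ : ℂ) + t * I)⁻¹)
      ((((σ : ℂ) + t * I) ^ 2)⁻¹) t := by
    intro t
    have h1 : HasDerivAt (fun t : ℝ => (σ : ℂ) + t * I) I t := by
      simpa using ((hasDerivAt_id t).ofReal_comp.mul_const I).const_add (σ : ℂ)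
    refine ((h1.fun_inv (vertical_ne_zero hσ t)).const_mul I).congr_deriv ?_
    rw [mul_div_assoc', mul_neg, I_mul_I, neg_neg, one_div]
  have hlim : ∀ l : Filter ℝ, Tendsto (fun t : ℝ => |t|) l atTop →
      Tendsto (fun t : ℝ => I * ((σ : ℂ) + t * I)⁻¹) l (𝓝 0) := by
    intro l hl
    rw [tendsto_zero_iff_norm_tendsto_zero]
    refine squeeze_zero' (Eventually.of_forall fun _ => norm_nonneg _) ?_ hl.inv_tendsto_atTop
    filter_upwards [hl.eventually_gt_atTop 0] with t ht
    rw [norm_mul, norm_I, one_mul, norm_inv]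
    have : |t| ≤ ‖(σ : ℂ) + t * I‖ := by
      simpa using Complex.abs_im_le_norm ((σ : ℂ) + t * I)
    exact inv_anti₀ ht this
  have := integral_of_hasDerivAt_of_tendsto hder (integrable_inv_vertical_sq hσ)
    (hlim _ tendsto_abs_atBot_atTop) (hlim _ tendsto_abs_atTop_atTop)
  simpa using this

theorem integral_univ_div_sq_add_sq {c : ℝ} (hc : c ≠ 0) :
    Integrable (fun t : ℝ => c / (c ^ 2 + t ^ 2)) ∧
      ∫ t : ℝ, c / (c ^ 2 + t ^ 2) = Real.pi * SignType.sign c := by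
  have e : (fun t : ℝ => c / (c ^ 2 + t ^ 2)) = fun t => c⁻¹ * (1 + (t * c⁻¹) ^ 2)⁻¹ := by
    ext t
    field_simp
  rw [e]
  refine ⟨(integrable_inv_one_add_sq.comp_mul_right' (inv_ne_zero hc)).const_mul _, ?_⟩
  rw [integral_const_mul, Measure.integral_comp_mul_right (fun x : ℝ => (1 + x ^ 2)⁻¹),
    integral_univ_inv_one_add_sq, inv_inv, smul_eq_mul]
  rcases lt_or_gt_of_ne hc with h | h
  · rw [abs_of_neg h, sign_neg h]; field_simp; simp
  · rw [abs_of_pos h, sign_pos h]; field_simp; simp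

theorem integrable_vertical_kernel {σ A : ℝ} (hσ : σ ≠ 0) (hA : σ + A ≠ 0) :
    Integrable fun t : ℝ => (A : ℂ) / (((σ : ℂ) + t * I) * (σ + t * I + A)) := by
  have e : ∀ t : ℝ, (σ : ℂ) + t * I + A = ((σ + A : ℝ) : ℂ) + t * I := fun t => by push_cast; ring
  have h1 := (integrable_inv_vertical_sq hσ).norm.add (integrable_inv_vertical_sq hA).norm
  refine (h1.const_mul |A|).mono' (Continuous.aestronglyMeasurable ?_) (Eventually.of_forall fun t => ?_)
  · refine Continuous.div (by fun_prop) (by fun_prop) fun t => mul_ne_zero (vertical_ne_zero hσ t) ?_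
    rw [e]; exact vertical_ne_zero hA t
  · rw [e, norm_div, norm_mul, norm_real, Real.norm_eq_abs, div_eq_mul_inv, mul_inv]
    simp only [Pi.add_apply, norm_inv, norm_pow]
    gcongr
    rw [← inv_pow, ← inv_pow]
    nlinarith [sq_nonneg (‖(σ : ℂ) + t * I‖⁻¹ - ‖((σ + A : ℝ) : ℂ) + t * I‖⁻¹),
      sq_nonneg (‖(σ : ℂ) + t * I‖⁻¹), sq_nonneg (‖((σ + A : ℝ) : ℂ) + t * I‖⁻¹)]

/-- The integrand is `1 / s - 1 / (s + A)`, neither part being integrable alone. Pairing `t` with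
`-t` leaves a difference of Poisson kernels `c / (c² + t²)`, each of integral `π sign c`. -/
theorem integral_vertical_kernel {σ A : ℝ} (hσ : σ ≠ 0) (hA : σ + A ≠ 0) :
    ∫ t : ℝ, (A : ℂ) / (((σ : ℂ) + t * I) * (σ + t * I + A)) =
      Real.pi * ((SignType.sign σ : ℝ) - (SignType.sign (σ + A) : ℝ)) := by
  set f : ℝ → ℂ := fun t => (A : ℂ) / (((σ : ℂ) + t * I) * (σ + t * I + A)) with hf
  have hi : Integrable f := integrable_vertical_kernel hσ hA
  have h1 : ∫ t, f (-t) = ∫ t, f t := integral_neg_eq_self f volume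
  have h2 : ∫ t, (f t + f (-t)) = 2 * ∫ t, f t := by
    rw [integral_add hi hi.comp_neg, h1]; ring
  have h3 : (fun t => f t + f (-t)) = fun t : ℝ =>
      ((2 * (σ / (σ ^ 2 + t ^ 2) - (σ + A) / ((σ + A) ^ 2 + t ^ 2)) : ℝ) : ℂ) := by
    ext t
    have n1 := vertical_ne_zero hσ t
    have n2 := vertical_ne_zero hσ (-t)
    have n3 := vertical_ne_zero hA t
    have n4 := vertical_ne_zero hA (-t)
    have n5 : (σ : ℂ) ^ 2 + t ^ 2 ≠ 0 := by
      have : σ ^ 2 + t ^ 2 ≠ 0 := by positivity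
      exact_mod_cast this
    have n6 : ((σ : ℂ) + A) ^ 2 + t ^ 2 ≠ 0 := by
      have : (σ + A) ^ 2 + t ^ 2 ≠ 0 := by positivity
      exact_mod_cast this
    simp only [hf]
    push_cast at *
    simp only [neg_mul, ← sub_eq_add_neg] at *
    have n3' : (σ : ℂ) + t * I + A ≠ 0 := by convert n3 using 1; ring
    have n4' : (σ : ℂ) - t * I + A ≠ 0 := by convert n4 using 1; ring
    have k1 : (A : ℂ) / ((σ + t * I) * (σ + t * I + A)) = (σ + t * I)⁻¹ - (σ + t * I + A)⁻¹ := by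
      field_simp; ring
    have k2 : (A : ℂ) / ((σ - t * I) * (σ - t * I + A)) = (σ - t * I)⁻¹ - (σ - t * I + A)⁻¹ := by
      field_simp; ring
    have k3 : (σ + t * I : ℂ)⁻¹ + (σ - t * I)⁻¹ = 2 * (σ / (σ ^ 2 + t ^ 2)) := by
      have : (σ : ℂ) ^ 2 + t ^ 2 = (σ + t * I) * (σ - t * I) := by
        linear_combination (t : ℂ) ^ 2 * I_sq
      rw [this]; field_simp; ring
    have k4 : (σ + t * I + A : ℂ)⁻¹ + (σ - t * I + A)⁻¹ = 2 * ((σ + A) / ((σ + A) ^ 2 + t ^ 2)) := by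
      have : ((σ : ℂ) + A) ^ 2 + t ^ 2 = (σ + t * I + A) * (σ - t * I + A) := by
        linear_combination (t : ℂ) ^ 2 * I_sq
      rw [this]; field_simp; ring
    rw [k1, k2]
    linear_combination k3 - k4
  rw [h3, integral_complex_ofReal, integral_const_mul,
    integral_sub (integral_univ_div_sq_add_sq hσ).1 (integral_univ_div_sq_add_sq hA).1,
    (integral_univ_div_sq_add_sq hσ).2, (integral_univ_div_sq_add_sq hA).2] at h2
  have : ∫ t, f t = (∫ t, f t) := rfl
  push_cast at h2 ⊢
  linear_combination (-1 / 2 : ℂ) * h2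

/-- Moving a vertical line of integration across a simple pole at the origin. -/
theorem integral_vertical_simple_pole {E : ℂ → ℂ} {a b : ℝ} (ha : a < 0) (hb : 0 < b)
    (hd : ∀ z : ℂ, a ≤ z.re → z.re ≤ b → DifferentiableAt ℂ E z) (hE : ExpGrowth E a b)
    (hia : Integrable fun t : ℝ => E (a + t * I) / (a + t * I))
    (hib : Integrable fun t : ℝ => E (b + t * I) / (b + t * I)) :
    (∫ t : ℝ, E (b + t * I) / (b + t * I)) - ∫ t : ℝ, E (a + t * I) / (a + t * I)
      = 2 * Real.pi * E 0 := by
  -- The residue is carried by the model `E 0 * A / (z (z + A))`, which is `O(|z|⁻²)` and hence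
  -- integrable, unlike `1 / z`. With `A = 1 - a` its second pole lies at distance one to the left
  -- of the strip. What remains, `H z / z` with `H 0 = 0`, is holomorphic.
  set A : ℝ := 1 - a with hA
  have hAne : ∀ z : ℂ, a ≤ z.re → z + A ≠ 0 := fun z hz h => by
    have := congrArg Complex.re h
    simp [hA] at this
    linarith
  have hA0 : (A : ℂ) ≠ 0 := by
    have : A ≠ 0 := by rw [hA]; linarith
    exact_mod_cast this
  set H : ℂ → ℂ := fun z => E z - E 0 * (A / (z + A)) with hH
  have hH0 : H 0 = 0 := by simp [hH, hA0]
  have hHd : ∀ z : ℂ, a ≤ z.re → z.re ≤ b → DifferentiableAt ℂ H z := fun z h1 h2 =>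
    (hd z h1 h2).sub ((differentiableAt_const _).mul ((differentiableAt_const _).div (by fun_prop) (hAne z h1)))
  have hHg : ExpGrowth H a b := by
    refine hE.sub ((ExpGrowth.const _).mul (ExpGrowth.of_bounded (K := A) fun z h1 h2 => ?_))
    have : 1 ≤ ‖z + A‖ := by
      refine le_trans ?_ (Complex.re_le_norm _)
      simp [hA]; linarith
    rw [norm_div, norm_real, Real.norm_of_nonneg (by rw [hA]; linarith)]
    exact div_le_self (by rw [hA]; linarith) this
  have hHd' : ∀ z : ℂ, a ≤ z.re → z.re ≤ b → DifferentiableAt ℂ (dslope H (0 : ℝ)) z :=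
    fun z h1 h2 => differentiableAt_dslope_strip ha hb hHd h1 h2
  obtain ⟨C, -, hC⟩ := hHg.dslope (p := 0) hHd'
  have hval : ∀ σ : ℝ, a ≤ σ → σ ≠ 0 → ∀ t : ℝ, dslope H (0 : ℝ) (σ + t * I) =
      E (σ + t * I) / (σ + t * I) - E 0 * (A / ((σ + t * I) * (σ + t * I + A))) := by
    intro σ h1 h2 t
    have h3 := vertical_ne_zero h2 t
    rw [dslope_of_ne _ (by simpa using h3), slope_def_field, ofReal_zero, hH0]
    have h4 := hAne (σ + t * I) (by simpa using h1)
    simp only [hH]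
    field_simp
    ring
  have hk : ∀ σ : ℝ, a ≤ σ → σ ≠ 0 → σ + A ≠ 0 := fun σ h1 h2 => by rw [hA]; linarith
  have hint : ∀ σ : ℝ, a ≤ σ → σ ≠ 0 → Integrable (fun t : ℝ => E (σ + t * I) / (σ + t * I)) →
      Integrable (fun t : ℝ => dslope H (0 : ℝ) (σ + t * I)) := by
    intro σ h1 h2 h3
    simp_rw [hval σ h1 h2]
    exact h3.sub ((integrable_vertical_kernel h2 (hk σ h1 h2)).const_mul _)
  have hI : ∀ σ : ℝ, a ≤ σ → σ ≠ 0 → Integrable (fun t : ℝ => E (σ + t * I) / (σ + t * I)) →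
      ∫ t : ℝ, dslope H (0 : ℝ) (σ + t * I) = (∫ t : ℝ, E (σ + t * I) / (σ + t * I)) -
        E 0 * (Real.pi * ((SignType.sign σ : ℝ) - (SignType.sign (σ + A) : ℝ))) := by
    intro σ h1 h2 h3
    simp_rw [hval σ h1 h2]
    rw [integral_sub h3 ((integrable_vertical_kernel h2 (hk σ h1 h2)).const_mul _),
      integral_const_mul, integral_vertical_kernel h2 (hk σ h1 h2)]
  have main := integral_vertical_eq (ha.trans hb).le hHd' hC (hint a le_rfl ha.ne hia)
    (hint b (ha.trans hb).le hb.ne' hib)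
  rw [hI a le_rfl ha.ne hia, hI b (ha.trans hb).le hb.ne' hib, sign_neg ha, sign_pos hb,
    sign_pos (show 0 < a + A by rw [hA]; linarith), sign_pos (show 0 < b + A by rw [hA]; linarith)] at main
  simp at main
  linear_combination -main

/-- Moving a vertical line of integration across a double pole on the real axis. -/
theorem integral_vertical_double_pole {F : ℂ → ℂ} {a b p : ℝ} (ha : a < p) (hb : p < b)
    (hd : ∀ z : ℂ, a ≤ z.re → z.re ≤ b → DifferentiableAt ℂ F z) (hF : ExpGrowth F a b)
    (hia : Integrable fun t : ℝ => F (a + t * I) / (a + t * I - p) ^ 2)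
    (hib : Integrable fun t : ℝ => F (b + t * I) / (b + t * I - p) ^ 2) :
    (∫ t : ℝ, F (b + t * I) / (b + t * I - p) ^ 2) - ∫ t : ℝ, F (a + t * I) / (a + t * I - p) ^ 2
      = 2 * Real.pi * deriv F p := by
  have hd' : ∀ z : ℂ, a ≤ z.re → z.re ≤ b → DifferentiableAt ℂ (dslope F p) z :=
    fun z h1 h2 => differentiableAt_dslope_strip ha hb hd h1 h2
  have hg := (hF.dslope hd').comp_add_const p
  -- `F z / (z - p)²` is `F p / (z - p)²` plus `dslope F p z / (z - p)`. The first is an exact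
  -- derivative and integrates to zero over every line; the second has a simple pole with residue
  -- `deriv F p`.
  set E : ℂ → ℂ := fun z => dslope F p (z + p) with hE
  have hval : ∀ σ : ℝ, σ ≠ p → ∀ t : ℝ, E ((σ - p : ℝ) + t * I) / ((σ - p : ℝ) + t * I) =
      F (σ + t * I) / (σ + t * I - p) ^ 2 - F p * ((((σ - p : ℝ) : ℂ) + t * I) ^ 2)⁻¹ := by
    intro σ h2 t
    have h3 := vertical_ne_zero (sub_ne_zero.mpr h2) t
    have h4 : ((σ - p : ℝ) : ℂ) + t * I + p = σ + t * I := by push_cast; ring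
    have h6 : (σ : ℂ) + t * I - p = ((σ - p : ℝ) : ℂ) + t * I := by push_cast; ring
    have h5 : (σ : ℂ) + t * I ≠ p := by
      intro h; rw [← h6, h, sub_self] at h3; exact h3 rfl
    simp only [hE]
    rw [h4, dslope_of_ne _ h5, slope_def_field, h6]
    field_simp
  have hint : ∀ σ : ℝ, σ ≠ p → Integrable (fun t : ℝ => F (σ + t * I) / (σ + t * I - p) ^ 2) →
      Integrable (fun t : ℝ => E ((σ - p : ℝ) + t * I) / ((σ - p : ℝ) + t * I)) := by
    intro σ h1 h2
    simp_rw [hval σ h1]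
    exact h2.sub ((integrable_inv_vertical_sq (sub_ne_zero.mpr h1)).const_mul _)
  have hI : ∀ σ : ℝ, σ ≠ p → Integrable (fun t : ℝ => F (σ + t * I) / (σ + t * I - p) ^ 2) →
      ∫ t : ℝ, E ((σ - p : ℝ) + t * I) / ((σ - p : ℝ) + t * I) =
        ∫ t : ℝ, F (σ + t * I) / (σ + t * I - p) ^ 2 := by
    intro σ h1 h2
    simp_rw [hval σ h1]
    rw [integral_sub h2 ((integrable_inv_vertical_sq (sub_ne_zero.mpr h1)).const_mul _),
      integral_const_mul, integral_inv_vertical_sq (sub_ne_zero.mpr h1)]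
    simp
  have main := integral_vertical_simple_pole (E := E) (sub_neg.mpr ha) (sub_pos.mpr hb)
    (fun z h1 h2 => by
      have := hd' (z + p) (by simp; linarith) (by simp; linarith)
      exact this.comp z (by fun_prop)) hg (hint a ha.ne hia) (hint b hb.ne' hib)
  rw [hI a ha.ne hia, hI b hb.ne' hib] at main
  rw [main, hE]
  simp [dslope_same]

/-! ### Growth of the Gamma function and of L-functions in vertical strips -/

theorem Complex.norm_Gamma_le {z : ℂ} (hz : 0 < z.re) : ‖Complex.Gamma z‖ ≤ Real.Gamma z.re := by
  rw [Complex.Gamma_eq_integral hz, Real.Gamma_eq_integral hz, Complex.GammaIntegral]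
  refine (norm_integral_le_integral_norm _).trans (le_of_eq ?_)
  refine setIntegral_congr_fun measurableSet_Ioi fun x hx => ?_
  simp only [norm_mul, norm_real, Real.norm_eq_abs, abs_of_pos (Real.exp_pos _)]
  rw [norm_cpow_eq_rpow_re_of_pos hx]
  simp

theorem Complex.norm_sin_le_exp (z : ℂ) : ‖Complex.sin z‖ ≤ Real.exp |z.im| := by
  rw [Complex.sin]
  have h1 : ‖cexp (-z * I)‖ ≤ Real.exp |z.im| := by
    rw [Complex.norm_exp]; simpa using le_abs_self _
  have h2 : ‖cexp (z * I)‖ ≤ Real.exp |z.im| := by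
    rw [Complex.norm_exp]; simpa using neg_le_abs _
  rw [norm_div, norm_mul, norm_I, Complex.norm_two, mul_one, div_le_iff₀ two_pos]
  calc _ ≤ _ := norm_sub_le _ _
    _ ≤ _ := by linarith

theorem Complex.norm_cos_le_exp (z : ℂ) : ‖Complex.cos z‖ ≤ Real.exp |z.im| := by
  rw [← Complex.sin_add_pi_div_two]
  simpa using Complex.norm_sin_le_exp (z + Real.pi / 2)

/-- By reflection `1 / Γ(z) = Γ(1 - z) sin(πz) / π`. The factor `Γ(1 - z)` is bounded because `1 -
z` stays in a strip of positive real part, which is the reason for `b < 1`. -/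
theorem ExpGrowth.inv_Gamma {a b : ℝ} (hb : b < 1) :
    ExpGrowth (fun z => (Complex.Gamma z)⁻¹) a b := by
  rcases lt_or_ge b a with h | hab
  · exact ⟨0, le_rfl, fun z h1 h2 => absurd (h1.trans h2) (not_le.mpr h)⟩
  obtain ⟨K, hK⟩ := (isCompact_Icc (a := 1 - b) (b := 1 - a)).exists_bound_of_continuousOn
    (f := Real.Gamma) fun x hx =>
      (Real.differentiableAt_Gamma fun m h => by
        have := hx.1; have : (0 : ℝ) ≤ m := m.cast_nonneg; linarith).continuousAt.continuousWithinAt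
  have hK0 : 0 ≤ K := (norm_nonneg _).trans (hK (1 - b) ⟨le_rfl, by linarith⟩)
  have hg : ExpGrowth (fun z => Complex.Gamma (1 - z)) a b :=
    ExpGrowth.of_bounded (K := K) fun z h1 h2 => by
      have h : (1 - z).re = 1 - z.re := by simp
      refine (Complex.norm_Gamma_le (by rw [h]; linarith)).trans ?_
      rw [h]
      exact (le_abs_self _).trans (hK _ ⟨by linarith, by linarith⟩)
  have hs : ExpGrowth (fun z => Complex.sin (Real.pi * z)) a b := by
    refine ⟨Real.pi, Real.pi_pos.le, fun z _ _ => (Complex.norm_sin_le_exp _).trans ?_⟩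
    have : |((Real.pi : ℂ) * z).im| = Real.pi * |z.im| := by simp [abs_mul, abs_of_pos Real.pi_pos]
    rw [this]
    exact le_mul_of_one_le_left (Real.exp_pos _).le (by linarith [Real.pi_gt_three])
  refine ((hg.mul hs).mul (ExpGrowth.const (1 / Real.pi))).congr fun z h1 h2 => ?_
  have hG : Complex.Gamma (1 - z) ≠ 0 := Complex.Gamma_ne_zero_of_re_pos (by simp; linarith)
  have hr := Complex.Gamma_mul_Gamma_one_sub z
  have hpi : (Real.pi : ℂ) ≠ 0 := by exact_mod_cast Real.pi_ne_zero
  -- At a pole `Gamma z = 0` is a default value. Its inverse `0` is nevertheless the value of the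
  -- entire function `1 / Γ`, since the sine vanishes there.
  by_cases h0 : Complex.Gamma z = 0
  · rw [h0, zero_mul, eq_comm, div_eq_zero_iff] at hr
    rw [h0, hr.resolve_left hpi]; simp
  · have hs0 : Complex.sin (Real.pi * z) ≠ 0 := by
      intro h
      rw [h, div_zero] at hr
      exact mul_ne_zero h0 hG hr
    rw [eq_div_iff hs0] at hr
    field_simp
    rw [mul_comm z]
    linear_combination -hr

theorem ExpGrowth.const_cpow {c : ℝ} (hc : 0 < c) {u v a b : ℝ} :
    ExpGrowth (fun z => (c : ℂ) ^ ((u : ℂ) * z + v)) a b := by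
  refine ExpGrowth.of_bounded (K := Real.exp (|Real.log c| * (|u| * (|a| + |b|) + |v|))) ?_
  intro z h1 h2
  rw [norm_cpow_eq_rpow_re_of_pos hc, Real.rpow_def_of_pos hc]
  apply Real.exp_le_exp.mpr
  refine (le_abs_self _).trans ?_
  rw [abs_mul]
  gcongr
  have : ((u : ℂ) * z + v).re = u * z.re + v := by simp
  rw [this]
  refine (abs_add_le _ _).trans ?_
  rw [abs_mul]
  gcongr
  rcases abs_cases z.re with h | h <;> rcases abs_cases a with h' | h' <;>
    rcases abs_cases b with h'' | h'' <;> linarith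

theorem ExpGrowth.id {a b : ℝ} : ExpGrowth (fun z => z) a b := by
  refine ⟨|a| + |b| + 1, by positivity, fun z h1 h2 => ?_⟩
  have h3 : |z.re| ≤ |a| + |b| := by
    rcases abs_cases z.re with h | h <;> rcases abs_cases a with h' | h' <;>
      rcases abs_cases b with h'' | h'' <;> linarith
  have h4 : |z.im| ≤ Real.exp |z.im| := by linarith [Real.add_one_le_exp |z.im|]
  have h5 : 1 ≤ Real.exp |z.im| := Real.one_le_exp (abs_nonneg _)
  have h6 : Real.exp |z.im| ≤ Real.exp ((|a| + |b| + 1) * |z.im|) :=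
    Real.exp_le_exp.mpr (le_mul_of_one_le_left (abs_nonneg _) (by linarith [abs_nonneg a, abs_nonneg b]))
  calc ‖z‖ ≤ |z.re| + |z.im| := Complex.norm_le_abs_re_add_abs_im z
    _ ≤ (|a| + |b| + 1) * Real.exp |z.im| := by nlinarith [abs_nonneg a, abs_nonneg b]
    _ ≤ _ := by gcongr

/-- `Λ₀` is a Mellin transform converging absolutely for every `s`, and `|x ^ (s - 1)| ≤ x ^ (a - 1)
+ x ^ (b - 1)` throughout the strip. -/
theorem WeakFEPair.norm_Λ₀_le (P : WeakFEPair ℂ) (a b : ℝ) :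
    ∃ K : ℝ, ∀ s : ℂ, a ≤ s.re → s.re ≤ b → ‖P.Λ₀ s‖ ≤ K := by
  have hconv : ∀ s : ℂ, MellinConvergent P.f_modif s := fun s =>
    (P.isStrongFEPair_toStrongFEPair.hasMellin s).1
  have hb : ∀ x ∈ Ioi (0 : ℝ), ∀ s : ℂ, a ≤ s.re → s.re ≤ b →
      ‖(x : ℂ) ^ (s - 1) • P.f_modif x‖ ≤
        ‖(x : ℂ) ^ ((a : ℂ) - 1) • P.f_modif x‖ + ‖(x : ℂ) ^ ((b : ℂ) - 1) • P.f_modif x‖ := by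
    intro x hx s h1 h2
    have hx : 0 < x := hx
    simp only [norm_smul, norm_cpow_eq_rpow_re_of_pos hx, ← add_mul]
    gcongr
    simp only [sub_re, ofReal_re, one_re]
    rcases le_total 1 x with h | h
    · have := Real.rpow_le_rpow_of_exponent_le h (show s.re - 1 ≤ b - 1 by linarith)
      linarith [Real.rpow_nonneg hx.le (a - 1)]
    · have := Real.rpow_le_rpow_of_exponent_ge hx h (show a - 1 ≤ s.re - 1 by linarith)
      linarith [Real.rpow_nonneg hx.le (b - 1)]
  refine ⟨∫ x in Ioi (0 : ℝ), ‖(x : ℂ) ^ ((a : ℂ) - 1) • P.f_modif x‖ +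
    ‖(x : ℂ) ^ ((b : ℂ) - 1) • P.f_modif x‖, fun s h1 h2 => ?_⟩
  rw [WeakFEPair.Λ₀, mellin]
  refine (norm_integral_le_integral_norm _).trans ?_
  refine setIntegral_mono_on (hconv s).norm ((hconv a).norm.add (hconv b).norm) measurableSet_Ioi ?_
  exact fun x hx => hb x hx s h1 h2

/-- The part of the plane at distance at least one from the real axis. -/
def farFromReal : Set ℂ := {z : ℂ | 1 ≤ |z.im|}

theorem norm_inv_le_one_of_mem_farFromReal {z : ℂ} (hz : z ∈ farFromReal) : ‖z‖⁻¹ ≤ 1 :=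
  inv_le_one_of_one_le₀ (le_trans hz (Complex.abs_im_le_norm z))

theorem ExpGrowth.inv_Gammaℝ {a b : ℝ} (hb : b < 2) : ExpGrowth (fun s => (Gammaℝ s)⁻¹) a b := by
  obtain ⟨C, h0, hC⟩ := ExpGrowth.inv_Gamma (a := a / 2) (b := b / 2) (by linarith)
  have h1 : ExpGrowth (fun s => (Complex.Gamma (s / 2))⁻¹) a b := by
    refine ⟨C, h0, fun z h1 h2 => (hC (z / 2) (by simp; linarith) (by simp; linarith)).trans ?_⟩
    have : |(z / 2).im| = |z.im| / 2 := by simp [abs_div]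
    rw [this]
    gcongr
    linarith [abs_nonneg z.im]
  refine ((ExpGrowth.const_cpow Real.pi_pos (u := 1 / 2) (v := 0)).mul h1).congr fun z _ _ => ?_
  rw [Gammaℝ_def, mul_inv, ← cpow_neg]
  congr 2
  push_cast; ring

/-- Away from the real axis the completed function is the bounded `Λ₀` part minus polar terms of
modulus at most one. Only the division by `Gammaℝ` produces growth. The indicator avoids the poles.
-/
theorem ExpGrowth.indicator_hurwitzZetaEven (a : UnitAddCircle) {b c : ℝ} (hc : c < 2) :
    ExpGrowth (farFromReal.indicator (HurwitzZeta.hurwitzZetaEven a)) b c := by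
  obtain ⟨K, hK⟩ := (HurwitzZeta.hurwitzEvenFEPair a).norm_Λ₀_le (b / 2) (c / 2)
  have h : ExpGrowth (farFromReal.indicator (HurwitzZeta.completedHurwitzZetaEven a)) b c := by
    refine ExpGrowth.of_bounded (K := |K| + 2) fun z h1 h2 => ?_
    by_cases hz : z ∈ farFromReal
    · rw [indicator_of_mem hz, HurwitzZeta.completedHurwitzZetaEven_eq,
        HurwitzZeta.completedHurwitzZetaEven₀]
      have e1 : ‖(HurwitzZeta.hurwitzEvenFEPair a).Λ₀ (z / 2) / 2‖ ≤ |K| := by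
        rw [norm_div, Complex.norm_two]
        have := hK (z / 2) (by simp; linarith) (by simp; linarith)
        linarith [le_abs_self K, norm_nonneg ((HurwitzZeta.hurwitzEvenFEPair a).Λ₀ (z / 2))]
      have e2 : ‖(if a = 0 then (1 : ℂ) else 0) / z‖ ≤ 1 := by
        rw [div_eq_mul_inv, norm_mul, norm_inv]
        refine mul_le_one₀ ?_ (by positivity) (norm_inv_le_one_of_mem_farFromReal hz)
        split_ifs <;> simp
      have e3 : ‖1 / (1 - z)‖ ≤ 1 := by
        rw [one_div, norm_inv]
        exact norm_inv_le_one_of_mem_farFromReal (by simpa [farFromReal] using hz)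
      calc _ ≤ _ := norm_sub_le _ _
        _ ≤ (|K| + 1) + 1 := add_le_add ((norm_sub_le _ _).trans (add_le_add e1 e2)) e3
        _ = _ := by ring
    · rw [indicator_of_notMem hz]; simp; positivity
  refine (h.mul (ExpGrowth.inv_Gammaℝ hc)).congr fun z _ _ => ?_
  by_cases hz : z ∈ farFromReal
  · rw [indicator_of_mem hz, indicator_of_mem hz,
      HurwitzZeta.hurwitzZetaEven_def_of_ne_or_ne (Or.inr ?_), div_eq_mul_inv]
    rintro rfl
    simp [farFromReal] at hz
    linarith
  · rw [indicator_of_notMem hz, indicator_of_notMem hz, zero_mul]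

/-- The completed function is entire and bounded on strips. The bound on `1 / Gammaℝ` used directly
at `s + 1` would only reach `re s < 1`, so `Gammaℝ (s + 1)` is rewritten through `Gammaℝ (s - 1)`.
The resulting factor `1 / (s - 1)` is harmless away from the real axis. -/
theorem ExpGrowth.indicator_hurwitzZetaOdd (a : UnitAddCircle) {b c : ℝ} (hc : c < 2) :
    ExpGrowth (farFromReal.indicator (HurwitzZeta.hurwitzZetaOdd a)) b c := by
  obtain ⟨K, hK⟩ := (HurwitzZeta.hurwitzOddFEPair a).norm_Λ₀_le ((b + 1) / 2) ((c + 1) / 2)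
  have h : ExpGrowth (HurwitzZeta.completedHurwitzZetaOdd a) b c := by
    refine ExpGrowth.of_bounded (K := |K|) fun z h1 h2 => ?_
    have e : (HurwitzZeta.hurwitzOddFEPair a).Λ ((z + 1) / 2) =
        (HurwitzZeta.hurwitzOddFEPair a).Λ₀ ((z + 1) / 2) := by
      rw [WeakFEPair.Λ, (HurwitzZeta.isStrong_hurwitzOddFEPair a).hf₀,
        (HurwitzZeta.isStrong_hurwitzOddFEPair a).hg₀]
      simp
    rw [HurwitzZeta.completedHurwitzZetaOdd, e, norm_div, Complex.norm_two]
    have := hK ((z + 1) / 2) (by simp; linarith) (by simp; linarith)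
    linarith [le_abs_self K, norm_nonneg ((HurwitzZeta.hurwitzOddFEPair a).Λ₀ ((z + 1) / 2))]
  have hG : ExpGrowth (fun s => (Gammaℝ (s - 1))⁻¹) b c := by
    have := (ExpGrowth.inv_Gammaℝ (a := b - 1) (b := c - 1) (by linarith)).comp_add_const (-1)
    simpa [sub_eq_add_neg] using this
  have hG' : ExpGrowth (fun s => farFromReal.indicator (fun s => (s - 1)⁻¹) s) b c := by
    refine ExpGrowth.of_bounded (K := 1) fun z h1 h2 => ?_
    by_cases hz : z ∈ farFromReal
    · rw [indicator_of_mem hz, norm_inv]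
      exact norm_inv_le_one_of_mem_farFromReal (by simpa [farFromReal] using hz)
    · rw [indicator_of_notMem hz]; simp
  refine ((h.mul hG).mul (hG'.mul (ExpGrowth.const (2 * Real.pi)))).congr fun z _ _ => ?_
  by_cases hz : z ∈ farFromReal
  · rw [indicator_of_mem hz, indicator_of_mem hz, HurwitzZeta.hurwitzZetaOdd]
    have hz1 : z - 1 ≠ 0 := by
      intro h
      have := congrArg Complex.im h
      simp at this
      simp [farFromReal, this] at hz
      linarith
    have h2 := Gammaℝ_add_two hz1
    rw [show z - 1 + 2 = z + 1 by ring] at h2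
    rw [h2]
    field_simp
  · rw [indicator_of_notMem hz, indicator_of_notMem hz]; simp

theorem ExpGrowth.indicator_LFunction {N : ℕ} [NeZero N] (Φ : ZMod N → ℂ) {b c : ℝ} (hc : c < 2) :
    ExpGrowth (farFromReal.indicator (ZMod.LFunction Φ)) b c := by
  have hN : (0 : ℝ) < N := Nat.cast_pos.mpr (NeZero.pos N)
  have h := (ExpGrowth.const_cpow hN (u := -1) (v := 0) (a := b) (b := c)).mul
    (ExpGrowth.sum Finset.univ fun (j : ZMod N) _ => (ExpGrowth.const (Φ j)).mul
      ((ExpGrowth.indicator_hurwitzZetaEven (ZMod.toAddCircle j) hc).add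
      (ExpGrowth.indicator_hurwitzZetaOdd (ZMod.toAddCircle j) hc)))
  refine h.congr fun z _ _ => ?_
  by_cases hz : z ∈ farFromReal
  · simp only [indicator_of_mem hz, ZMod.LFunction, HurwitzZeta.hurwitzZeta]
    simp
  · simp [indicator_of_notMem hz]

/-- `(s - 1) L(s, χ)`, as an entire function. -/
noncomputable def DirichletCharacter.LFunctionHat {N : ℕ} [NeZero N] (χ : DirichletCharacter ℂ N) :
    ℂ → ℂ :=
  open Classical in
  Function.update (fun s => (s - 1) * χ.LFunction s) 1
    (if χ = 1 then ∏ p ∈ N.primeFactors, (1 - (p : ℂ)⁻¹) else 0)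

namespace DirichletCharacter

variable {N : ℕ} [NeZero N] (χ : DirichletCharacter ℂ N)

theorem LFunctionHat_of_ne_one {s : ℂ} (hs : s ≠ 1) :
    χ.LFunctionHat s = (s - 1) * χ.LFunction s := Function.update_of_ne hs ..

theorem LFunctionHat_eq_of_ne_one (hχ : χ ≠ 1) (s : ℂ) :
    χ.LFunctionHat s = (s - 1) * χ.LFunction s := by
  by_cases hs : s = 1
  · rw [hs, LFunctionHat, Function.update_self, if_neg hχ]; simp
  · exact χ.LFunctionHat_of_ne_one hs

theorem LFunctionHat_one_eq :
    (1 : DirichletCharacter ℂ N).LFunctionHat = LFunctionTrivChar₁ N := by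
  rw [LFunctionHat, if_pos rfl]

theorem differentiable_LFunctionHat : Differentiable ℂ χ.LFunctionHat := by
  by_cases hχ : χ = 1
  · rw [hχ, LFunctionHat_one_eq]
    exact differentiable_LFunctionTrivChar₁ N
  · have : χ.LFunctionHat = fun s => (s - 1) * χ.LFunction s :=
      funext (χ.LFunctionHat_eq_of_ne_one hχ)
    rw [this]
    exact (differentiable_id.sub_const 1).mul (differentiable_LFunction hχ)

theorem expGrowth_LFunctionHat {b c : ℝ} (hc : c < 2) : ExpGrowth χ.LFunctionHat b c := by
  obtain ⟨C, h0, hC⟩ := (ExpGrowth.id.sub (ExpGrowth.const 1)).mul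
    (ExpGrowth.indicator_LFunction (b := b) χ hc)
  refine ExpGrowth.of_one_le_abs_im (fun z _ _ => (χ.differentiable_LFunctionHat z).continuousAt)
    ⟨C, h0, fun z h1 h2 h3 => ?_⟩
  have hz : z ≠ 1 := by
    rintro rfl
    simp at h3
    linarith
  have := hC z h1 h2
  simp only [indicator_of_mem (show z ∈ farFromReal from h3)] at this
  rwa [χ.LFunctionHat_of_ne_one hz]

end DirichletCharacter

/-! ### Divisor bound -/

/-- The divisor bound `d(n) ≪ n ^ ε`. -/
theorem exists_card_divisors_le {ε : ℝ} (hε : 0 < ε) :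
    ∃ C : ℝ, 1 ≤ C ∧ ∀ n : ℕ, n ≠ 0 → (n.divisors.card : ℝ) ≤ C * (n : ℝ) ^ ε := by
  -- By Bernoulli `p ^ (aε) ≥ 1 + a ε log 2`, and `K` times this exceeds `a + 1`. Primes with `p ^ ε
  -- ≥ 2` need no constant, since `a + 1 ≤ 2 ^ a`. Hence only the primes below `P` cost a factor
  -- `K`.
  set K : ℝ := 1 + 1 / (ε * Real.log 2) with hK
  have hlog : 0 < Real.log 2 := Real.log_pos (by norm_num)
  have hK1 : 1 ≤ K := by rw [hK]; linarith [show 0 < 1 / (ε * Real.log 2) by positivity]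
  obtain ⟨P, hP⟩ := exists_nat_gt ((2 : ℝ) ^ (1 / ε))
  refine ⟨K ^ P, one_le_pow₀ hK1, fun n hn => ?_⟩
  have local_bound : ∀ p ∈ n.primeFactors, ((n.factorization p + 1 : ℕ) : ℝ) ≤
      (if p < P then K else 1) * ((p ^ n.factorization p : ℕ) : ℝ) ^ ε := by
    intro p hp
    set a := n.factorization p
    have hp2 : (2 : ℝ) ≤ p := by exact_mod_cast (Nat.prime_of_mem_primeFactors hp).two_le
    have e1 : ((p ^ a : ℕ) : ℝ) ^ ε = ((p : ℝ) ^ ε) ^ a := by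
      push_cast
      rw [← Real.rpow_natCast, ← Real.rpow_natCast, ← Real.rpow_mul (by linarith),
        ← Real.rpow_mul (by linarith), mul_comm]
    rw [e1]
    split_ifs with h
    · have h1 : 1 + a * (ε * Real.log 2) ≤ ((p : ℝ) ^ ε) ^ a := by
        have h2 : 1 + ε * Real.log 2 ≤ (p : ℝ) ^ ε := by
          calc 1 + ε * Real.log 2 ≤ Real.exp (ε * Real.log 2) := by
                linarith [Real.add_one_le_exp (ε * Real.log 2)]
            _ = (2 : ℝ) ^ ε := by rw [Real.rpow_def_of_pos two_pos, mul_comm]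
            _ ≤ _ := Real.rpow_le_rpow two_pos.le hp2 hε.le
        calc _ ≤ (1 + ε * Real.log 2) ^ a :=
              one_add_mul_le_pow (by linarith [mul_pos hε hlog]) a
          _ ≤ _ := by gcongr
      push_cast
      have h3 : 0 < 1 / (ε * Real.log 2) := by positivity
      have h4 : (1 / (ε * Real.log 2)) * (a * (ε * Real.log 2)) = a := by field_simp
      calc (a : ℝ) + 1 ≤ K * (1 + a * (ε * Real.log 2)) := by
            rw [hK]
            nlinarith [mul_nonneg (Nat.cast_nonneg (α := ℝ) a) (mul_pos hε hlog).le]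
        _ ≤ _ := by gcongr
    · have h2 : (2 : ℝ) ≤ (p : ℝ) ^ ε := by
        have h3 : (2 : ℝ) ^ (1 / ε) ≤ p := hP.le.trans (by exact_mod_cast not_lt.mp h)
        calc (2 : ℝ) = ((2 : ℝ) ^ (1 / ε)) ^ ε := by
              rw [← Real.rpow_mul two_pos.le, one_div_mul_cancel hε.ne', Real.rpow_one]
          _ ≤ _ := Real.rpow_le_rpow (by positivity) h3 hε.le
      rw [one_mul]
      calc ((a + 1 : ℕ) : ℝ) ≤ (2 : ℝ) ^ a := by exact_mod_cast Nat.lt_two_pow_self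
        _ ≤ _ := by gcongr
  rw [Nat.card_divisors hn]
  push_cast
  calc ∏ p ∈ n.primeFactors, ((n.factorization p : ℝ) + 1)
      ≤ ∏ p ∈ n.primeFactors, ((if p < P then K else 1) * ((p ^ n.factorization p : ℕ) : ℝ) ^ ε) := by
        refine Finset.prod_le_prod (fun p _ => by positivity) fun p hp => ?_
        have := local_bound p hp
        push_cast at this ⊢
        exact this
    _ = (∏ p ∈ n.primeFactors, (if p < P then K else 1)) * (n : ℝ) ^ ε := by
        rw [Finset.prod_mul_distrib, Real.finsetProd_rpow _ _ (fun i _ => by positivity)]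
        congr 2
        rw [← Nat.cast_prod]
        congr 1
        exact Nat.prod_factorization_pow_eq_self hn
    _ ≤ _ := by
        gcongr
        rw [Finset.prod_ite, Finset.prod_const, Finset.prod_const_one, mul_one]
        refine pow_le_pow_right₀ hK1 ?_
        calc _ ≤ (Finset.range P).card := Finset.card_le_card fun x hx => by
              simpa using (Finset.mem_filter.mp hx).2
          _ = P := Finset.card_range P

theorem two_pow_card_primeFactors_le {n : ℕ} (hn : n ≠ 0) :
    2 ^ n.primeFactors.card ≤ n.divisors.card := by
  rw [Nat.card_divisors hn, ← Finset.prod_const]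
  refine Finset.prod_le_prod' fun p hp => ?_
  have := (Nat.prime_of_mem_primeFactors hp).factorization_pos_of_dvd hn
    (Nat.dvd_of_mem_primeFactors hp)
  omega

/-! ### Ramanujan sums and a bilinear exponential sum -/

theorem sum_range_filter_dvd {M : Type*} [AddCommMonoid M] {e k : ℕ} (he : e ≠ 0) (h : e ∣ k)
    (g : ℕ → M) : ∑ v ∈ Finset.range k with e ∣ v, g v = ∑ v ∈ Finset.range (k / e), g (e * v) := by
  obtain ⟨f, rfl⟩ := h
  rw [Nat.mul_div_cancel_left _ (Nat.pos_of_ne_zero he)]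
  symm
  refine Finset.sum_nbij (fun v => e * v) ?_ ?_ ?_ fun _ _ => rfl
  · intro v hv
    simp only [Finset.mem_range, Finset.mem_filter] at hv ⊢
    exact ⟨Nat.mul_lt_mul_of_pos_left hv (Nat.pos_of_ne_zero he), dvd_mul_right _ _⟩
  · intro v _ w _ h
    exact Nat.eq_of_mul_eq_mul_left (Nat.pos_of_ne_zero he) h
  · intro w hw
    simp only [Finset.coe_filter, Finset.mem_range, mem_ofPred_eq] at hw
    obtain ⟨hw, v, rfl⟩ := hw
    exact ⟨v, by simpa using Nat.lt_of_mul_lt_mul_left hw, rfl⟩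

theorem ZMod.sum_eq_sum_range {M : Type*} [AddCommMonoid M] (k : ℕ) [NeZero k] (f : ZMod k → M) :
    ∑ a : ZMod k, f a = ∑ v ∈ Finset.range k, f (v : ZMod k) := by
  symm
  refine Finset.sum_nbij (fun v => (v : ZMod k)) (by simp) ?_ ?_ (by simp)
  · intro v hv w hw h
    simp only [Finset.coe_range, mem_Iio] at hv hw
    have := congrArg ZMod.val h
    simpa [ZMod.val_natCast, Nat.mod_eq_of_lt hv, Nat.mod_eq_of_lt hw] using this
  · intro a _
    exact ⟨a.val, by simpa using ZMod.val_lt a, by simp⟩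

theorem sum_divisors_filter_moebius (v k : ℕ) [NeZero k] :
    ∑ e ∈ k.divisors with e ∣ v, (ArithmeticFunction.moebius e : ℤ) =
      if Nat.Coprime v k then 1 else 0 := by
  have h1 : {e ∈ k.divisors | e ∣ v} = (Nat.gcd v k).divisors := by
    ext e
    have hk := NeZero.ne k
    simp only [Finset.mem_filter, Nat.mem_divisors, Nat.dvd_gcd_iff, ne_eq, Nat.gcd_eq_zero_iff]
    tauto
  rw [h1, ← ArithmeticFunction.coe_mul_zeta_apply, ArithmeticFunction.moebius_mul_coe_zeta,
    ArithmeticFunction.one_apply]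

/-- Ramanujan's formula for the sum of an additive character over the units. -/
theorem sum_units_stdAddChar (k : ℕ) [NeZero k] (x : ZMod k) [DecidablePred (IsUnit (M := ZMod k))] :
    ∑ a : ZMod k, (if IsUnit a then (ZMod.stdAddChar (a * x) : ℂ) else 0) =
      ∑ e ∈ k.divisors, ((ArithmeticFunction.moebius e : ℤ) : ℂ) *
        if (e : ZMod k) * x = 0 then ((k / e : ℕ) : ℂ) else 0 := by
  rw [ZMod.sum_eq_sum_range]
  have h1 : ∀ v : ℕ, (if IsUnit (v : ZMod k) then (ZMod.stdAddChar ((v : ZMod k) * x) : ℂ) else 0) =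
      ∑ e ∈ k.divisors, if e ∣ v then
        ((ArithmeticFunction.moebius e : ℤ) : ℂ) * ZMod.stdAddChar ((v : ZMod k) * x) else 0 := by
    intro v
    rw [← Finset.sum_filter, ← Finset.sum_mul, ← Int.cast_sum, sum_divisors_filter_moebius]
    by_cases h : IsUnit (v : ZMod k)
    · rw [if_pos h, if_pos ((ZMod.isUnit_iff_coprime v k).mp h)]; simp
    · rw [if_neg h, if_neg fun h' => h ((ZMod.isUnit_iff_coprime v k).mpr h')]; simp
  simp_rw [h1]
  rw [Finset.sum_comm]
  refine Finset.sum_congr rfl fun e he => ?_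
  have hek := Nat.dvd_of_mem_divisors he
  have he0 : e ≠ 0 := fun h => NeZero.ne k (by simpa [h] using hek)
  rw [← Finset.sum_filter, ← Finset.mul_sum, sum_range_filter_dvd he0 hek]
  congr 1
  set ζ : ℂ := ZMod.stdAddChar ((e : ZMod k) * x) with hζ
  have h2 : ∀ v : ℕ, (ZMod.stdAddChar (((e * v : ℕ) : ZMod k) * x) : ℂ) = ζ ^ v := by
    intro v
    rw [hζ, ← AddChar.map_nsmul_eq_pow]
    congr 1
    rw [nsmul_eq_mul]; push_cast; ring
  simp_rw [h2]
  split_ifs with h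
  · simp [hζ, h]
  · have hζ1 : ζ ≠ 1 := by
      intro h'
      apply h
      apply ZMod.injective_stdAddChar
      rw [← hζ, h', AddChar.map_zero_eq_one]
    have hk : ζ ^ (k / e) = 1 := by
      rw [← h2, Nat.mul_div_cancel' hek]
      simp
    rw [geom_sum_eq hζ1, hk]
    simp

theorem sum_units_stdAddChar_unit (k : ℕ) [NeZero k] {x : ZMod k} (hx : IsUnit x)
    [DecidablePred (IsUnit (M := ZMod k))] :
    ∑ a : ZMod k, (if IsUnit a then (ZMod.stdAddChar (a * x) : ℂ) else 0) =
      ((ArithmeticFunction.moebius k : ℤ) : ℂ) := by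
  rw [sum_units_stdAddChar, Finset.sum_eq_single k]
  · simp [Nat.div_self (NeZero.pos k)]
  · intro e he hek
    rw [if_neg, mul_zero]
    intro h
    rw [hx.mul_left_eq_zero, ZMod.natCast_eq_zero_iff] at h
    exact hek (Nat.dvd_antisymm (Nat.dvd_of_mem_divisors he) h)
  · intro h
    exact absurd (Nat.mem_divisors_self k (NeZero.ne k)) h

/-- In Ramanujan's formula the divisor `e` contributes at most `k / e` at each of the `e` solutions
of `e x = 0`, that is `k` in total. The saving comes from averaging: single Ramanujan sums can be as
large as `φ(k)`. -/
theorem sum_norm_sum_units_stdAddChar_le (k : ℕ) [NeZero k]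
    [DecidablePred (IsUnit (M := ZMod k))] :
    ∑ x : ZMod k, ‖∑ a : ZMod k, (if IsUnit a then (ZMod.stdAddChar (a * x) : ℂ) else 0)‖ ≤
      k * (k.divisors.card : ℝ) := by
  calc _ ≤ ∑ x : ZMod k, ∑ e ∈ k.divisors, (if (e : ZMod k) * x = 0 then ((k / e : ℕ) : ℝ) else 0) := by
        refine Finset.sum_le_sum fun x _ => ?_
        rw [sum_units_stdAddChar]
        refine (norm_sum_le _ _).trans (Finset.sum_le_sum fun e _ => ?_)
        rw [norm_mul]
        have h1 : ‖((ArithmeticFunction.moebius e : ℤ) : ℂ)‖ ≤ 1 := by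
          rw [Complex.norm_intCast]
          exact_mod_cast ArithmeticFunction.abs_moebius_le_one
        split_ifs
        · rw [Complex.norm_natCast]
          exact mul_le_of_le_one_left (by positivity) h1
        · simp
    _ = ∑ e ∈ k.divisors, (k : ℝ) := by
        rw [Finset.sum_comm]
        refine Finset.sum_congr rfl fun e he => ?_
        have hek := Nat.dvd_of_mem_divisors he
        obtain ⟨f, hf⟩ := hek
        have he0 : e ≠ 0 := fun h => NeZero.ne k (by simp [hf, h])
        have hf0 : f ≠ 0 := fun h => NeZero.ne k (by simp [hf, h])
        rw [ZMod.sum_eq_sum_range]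
        have h1 : ∀ v : ℕ, (e : ZMod k) * (v : ZMod k) = 0 ↔ f ∣ v := by
          intro v
          rw [← Nat.cast_mul, ZMod.natCast_eq_zero_iff, hf]
          exact Nat.mul_dvd_mul_iff_left (Nat.pos_of_ne_zero he0)
        simp_rw [h1]
        rw [← Finset.sum_filter, sum_range_filter_dvd hf0 (by rw [hf]; exact dvd_mul_left _ _)]
        rw [Finset.sum_const, Finset.card_range, nsmul_eq_mul, ← Nat.cast_mul]
        congr 1
        rw [hf, Nat.mul_div_cancel _ (Nat.pos_of_ne_zero hf0),
          Nat.mul_div_cancel_left _ (Nat.pos_of_ne_zero he0)]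
    _ = _ := by rw [Finset.sum_const, nsmul_eq_mul, mul_comm]

/-- Kloosterman-type sums with the bilinear phase `b u v`. -/
theorem norm_sum_units_bilinear_le (k : ℕ) [NeZero k] [DecidablePred (IsUnit (M := ZMod k))]
    {b : ZMod k} (hb : IsUnit b) (m n : ZMod k) :
    ‖∑ u : ZMod k, ∑ v : ZMod k, (if IsUnit u ∧ IsUnit v then
      (ZMod.stdAddChar (u * m + v * n + b * u * v) : ℂ) else 0)‖ ≤ k * (k.divisors.card : ℝ) := by
  refine le_trans ?_ (sum_norm_sum_units_stdAddChar_le k)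
  have e : ∀ u : ZMod k, ∑ v : ZMod k, (if IsUnit u ∧ IsUnit v then
      (ZMod.stdAddChar (u * m + v * n + b * u * v) : ℂ) else 0) =
      if IsUnit u then ZMod.stdAddChar (u * m) * ∑ v : ZMod k, (if IsUnit v then
        (ZMod.stdAddChar (v * (n + b * u)) : ℂ) else 0) else 0 := by
    intro u
    by_cases hu : IsUnit u
    · rw [if_pos hu, Finset.mul_sum]
      refine Finset.sum_congr rfl fun v _ => ?_
      simp only [hu, true_and, mul_ite, mul_zero]
      rw [← AddChar.map_add_eq_mul]
      congr 2; ring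
    · simp [hu]
  simp_rw [e]
  refine (norm_sum_le _ _).trans ?_
  calc _ ≤ ∑ u : ZMod k, ‖∑ v : ZMod k, (if IsUnit v then
        (ZMod.stdAddChar (v * (n + b * u)) : ℂ) else 0)‖ := by
        refine Finset.sum_le_sum fun u _ => ?_
        split_ifs
        · rw [norm_mul, AddChar.norm_apply, one_mul]
        · simp
    _ = _ := by
      -- The inner sum is a Ramanujan sum at `n + b u`. After dropping the restriction to units `u`,
      -- this argument runs through all residues exactly once, so the `L¹` bound applies.
      have hbij : Function.Bijective fun u : ZMod k => n + b * u := by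
        obtain ⟨c, rfl⟩ := hb
        exact (((Units.mulLeft c).trans (Equiv.addLeft n))).bijective
      exact hbij.sum_comp fun x => ‖∑ v : ZMod k, (if IsUnit v then
        (ZMod.stdAddChar (v * x) : ℂ) else 0)‖

/-- Gauss sums are the multiplicative Fourier coefficients of the additive character on the units,
and orthogonality inverts the transform. This is how the weights `τ(ψ̄)` convert character averages
into exponential sums. -/
theorem sum_tau_inv_mul (k : ℕ) [NeZero k] [DecidablePred (IsUnit (M := ZMod k))] (b : ZMod k) :
    ∑ ψ : DirichletCharacter ℂ k, tau ψ⁻¹ * ψ b =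
      if IsUnit b then (k.totient : ℂ) * ZMod.stdAddChar b else 0 := by
  by_cases hb : IsUnit b
  · rw [if_pos hb]
    simp only [tau, gaussSum, Finset.sum_mul]
    rw [Finset.sum_comm]
    have : ∀ a : ZMod k, ∑ ψ : DirichletCharacter ℂ k, ψ⁻¹ a * ZMod.stdAddChar a * ψ b =
        if a = b then (k.totient : ℂ) * ZMod.stdAddChar b else 0 := by
      intro a
      by_cases ha : IsUnit a
      · have h := DirichletCharacter.sum_char_inv_mul_char_eq ℂ ha b
        have h2 : ∀ ψ : DirichletCharacter ℂ k, ψ⁻¹ a * ZMod.stdAddChar a * ψ b =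
            (ψ a⁻¹ * ψ b) * ZMod.stdAddChar a := by
          intro ψ
          obtain ⟨u, rfl⟩ := ha
          rw [MulChar.inv_apply, Ring.inverse_unit, ZMod.inv_coe_unit]
          ring
        simp_rw [h2]
        rw [← Finset.sum_mul, h]
        split_ifs with hab
        · rw [hab]
        · simp
      · have h2 : ∀ ψ : DirichletCharacter ℂ k, ψ⁻¹ a = 0 := fun ψ => MulChar.map_nonunit _ ha
        rw [if_neg (by rintro rfl; exact ha hb)]
        simp [h2]
    simp_rw [this]
    simp
  · rw [if_neg hb]
    exact Finset.sum_eq_zero fun ψ _ => by rw [MulChar.map_nonunit _ hb, mul_zero]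

/-! ### Averages of squared L-functions to the left of the critical strip -/

/-- Reflection gives `|Γ(1 + it)|² = πt / sinh(πt)` exactly. With `u = π|t|` the claim reduces to
`(1 + 2u) e^(-u) ≤ e^u`. The exponential is the one lost in the asymmetric functional equation. -/
theorem norm_Gamma_one_add_mul_I_sq_le (t : ℝ) :
    Real.exp (Real.pi * |t|) * ‖Complex.Gamma (1 + t * I)‖ ^ 2 ≤ 1 + 2 * (Real.pi * |t|) := by
  wlog h : 0 ≤ t generalizing t
  · have := this (-t) (by linarith)
    rw [abs_neg] at this
    convert this using 3
    rw [← Complex.norm_conj, ← Complex.Gamma_conj]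
    congr 2
    simp
  rcases h.eq_or_lt with rfl | ht
  · simp
  rw [abs_of_pos ht]
  set u := Real.pi * t with hu
  have hu0 : 0 < u := by positivity
  have hsinh : 0 < Real.sinh u := Real.sinh_pos_iff.mpr hu0
  have h1 : ‖Complex.Gamma (1 + t * I)‖ ^ 2 = u / Real.sinh u := by
    have hti : (t : ℂ) * I ≠ 0 := mul_ne_zero (by exact_mod_cast ht.ne') I_ne_zero
    have e1 : Complex.Gamma (1 + t * I) * (starRingEnd ℂ) (Complex.Gamma (1 + t * I)) =
        ((u / Real.sinh u : ℝ) : ℂ) := by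
      rw [← Complex.Gamma_conj]
      have e2 : (starRingEnd ℂ) (1 + (t : ℂ) * I) = 1 - t * I := by simp [sub_eq_add_neg]
      have e3 := Complex.Gamma_mul_Gamma_one_sub ((t : ℂ) * I)
      have e4 : Complex.sin (Real.pi * (t * I)) = Real.sinh u * I := by
        rw [← mul_assoc, Complex.sin_mul_I, hu]; push_cast; rfl
      rw [e2, add_comm (1 : ℂ), Complex.Gamma_add_one _ hti, mul_assoc, e3, e4]
      have : ((Real.sinh u : ℝ) : ℂ) ≠ 0 := by exact_mod_cast hsinh.ne'
      rw [ofReal_div]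
      field_simp
      rw [hu]; push_cast; ring
    rw [Complex.mul_conj, Complex.normSq_eq_norm_sq] at e1
    exact_mod_cast e1
  rw [h1, mul_div_assoc', div_le_iff₀ hsinh, Real.sinh_eq]
  have h2 : 1 + 2 * u ≤ Real.exp u * Real.exp u := by
    rw [← Real.exp_add]
    linarith [Real.add_one_le_exp (u + u)]
  have h3 : (1 + 2 * u) * Real.exp (-u) ≤ Real.exp u := by
    rw [Real.exp_neg, ← div_eq_mul_inv, div_le_iff₀ (Real.exp_pos u)]
    exact h2
  linarith

theorem norm_betaIntegral_le (u v : ℂ) :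
    ‖Complex.betaIntegral u v‖ ≤ ‖Complex.betaIntegral u.re v.re‖ := by
  have hn : ∀ x ∈ Ioo (0 : ℝ) 1, ‖(x : ℂ) ^ (u - 1) * (1 - (x : ℂ)) ^ (v - 1)‖ =
      x ^ (u.re - 1) * (1 - x) ^ (v.re - 1) := by
    intro x hx
    have h1 : (1 : ℂ) - x = ((1 - x : ℝ) : ℂ) := by push_cast; ring
    rw [h1, norm_mul, norm_cpow_eq_rpow_re_of_pos hx.1,
      norm_cpow_eq_rpow_re_of_pos (sub_pos.mpr hx.2)]
    simp
  have hr : ∀ x ∈ Ioo (0 : ℝ) 1, (x : ℂ) ^ ((u.re : ℂ) - 1) * (1 - (x : ℂ)) ^ ((v.re : ℂ) - 1) =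
      ((x ^ (u.re - 1) * (1 - x) ^ (v.re - 1) : ℝ) : ℂ) := by
    intro x hx
    rw [ofReal_mul, ofReal_cpow hx.1.le, ofReal_cpow (sub_pos.mpr hx.2).le]
    push_cast; rfl
  have e1 : Complex.betaIntegral u.re v.re =
      ((∫ x in Ioo (0 : ℝ) 1, x ^ (u.re - 1) * (1 - x) ^ (v.re - 1) : ℝ) : ℂ) := by
    rw [Complex.betaIntegral, intervalIntegral.integral_of_le zero_le_one,
      integral_Ioc_eq_integral_Ioo, ← integral_complex_ofReal]
    exact setIntegral_congr_fun measurableSet_Ioo hr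
  rw [e1, norm_real]
  refine le_trans ?_ (le_abs_self _)
  rw [Complex.betaIntegral, intervalIntegral.integral_of_le zero_le_one,
    integral_Ioc_eq_integral_Ioo]
  refine (norm_integral_le_integral_norm _).trans (le_of_eq ?_)
  exact setIntegral_congr_fun measurableSet_Ioo hn

/-- With `u = 1 + η + it`, `Γ(u) Γ(1 - η) = Γ(2 + it) B(u, 1 - η)`, and the beta integral is largest
at `t = 0`, where it is `Γ(1 + η) Γ(1 - η)`. This carries the exact decay known on integral
abscissae to `re = 1 + η` without Stirling's formula. -/
theorem norm_Gamma_le_mul_norm_Gamma_two {η : ℝ} (h0 : 0 < η) (h1 : η < 1) (t : ℝ) :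
    ‖Complex.Gamma ((1 + η : ℝ) + t * I)‖ ≤ Real.Gamma (1 + η) * ‖Complex.Gamma (2 + t * I)‖ := by
  set u : ℂ := (1 + η : ℝ) + t * I with hu
  set v : ℂ := ((1 - η : ℝ) : ℂ) with hv
  have hur : u.re = 1 + η := by simp [hu]
  have hvr : v.re = 1 - η := by simp [hv]
  have hu0 : 0 < u.re := by rw [hur]; linarith
  have hv0 : 0 < v.re := by rw [hvr]; linarith
  have e1 := Complex.Gamma_mul_Gamma_eq_betaIntegral hu0 hv0
  have e2 := Complex.Gamma_mul_Gamma_eq_betaIntegral (s := (u.re : ℂ)) (t := (v.re : ℂ)) hu0 hv0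
  have hsum : u + v = 2 + t * I := by rw [hu, hv]; push_cast; ring
  have hsum2 : (u.re : ℂ) + (v.re : ℂ) = 2 := by rw [hur, hvr]; push_cast; ring
  have hG2 : Complex.Gamma 2 = 1 := by
    rw [show (2 : ℂ) = ((1 : ℕ) : ℂ) + 1 by norm_num, Complex.Gamma_nat_eq_factorial]
    simp
  rw [hsum] at e1
  rw [hsum2, hG2, one_mul, Complex.Gamma_ofReal, Complex.Gamma_ofReal, hur, hvr] at e2
  have hb := norm_betaIntegral_le u v
  rw [hur, hvr, ← e2, norm_mul, norm_real, norm_real] at hb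
  have hp : 0 < Real.Gamma (1 - η) := Real.Gamma_pos_of_pos (by linarith)
  have hp' : 0 < Real.Gamma (1 + η) := Real.Gamma_pos_of_pos (by linarith)
  rw [Real.norm_of_nonneg hp.le, Real.norm_of_nonneg hp'.le] at hb
  have e3 := congrArg norm e1
  rw [norm_mul, norm_mul, hv, Complex.Gamma_ofReal, norm_real, Real.norm_of_nonneg hp.le] at e3
  refine le_of_mul_le_mul_right ?_ hp
  rw [e3]
  calc _ ≤ ‖Complex.Gamma (2 + t * I)‖ * (Real.Gamma (1 + η) * Real.Gamma (1 - η)) := by gcongr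
    _ = _ := by ring

theorem exp_mul_norm_Gamma_sq_le {η : ℝ} (h0 : 0 < η) (h1 : η < 1) (t : ℝ) :
    Real.exp (Real.pi * |t|) * ‖Complex.Gamma ((1 + η : ℝ) + t * I)‖ ^ 2 ≤
      Real.Gamma (1 + η) ^ 2 * (7 * (1 + |t|) ^ 3) := by
  have e1 : ‖Complex.Gamma (2 + t * I)‖ ≤ (1 + |t|) * ‖Complex.Gamma (1 + t * I)‖ := by
    have hne : (1 : ℂ) + t * I ≠ 0 := fun h => by
      have := congrArg Complex.re h
      simp at this
    rw [show (2 : ℂ) + t * I = (1 + t * I) + 1 by ring, Complex.Gamma_add_one _ hne, norm_mul]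
    gcongr
    refine (norm_add_le _ _).trans ?_
    simp
  have e2 := norm_Gamma_one_add_mul_I_sq_le t
  have e3 := norm_Gamma_le_mul_norm_Gamma_two h0 h1 t
  have hG : 0 < Real.Gamma (1 + η) := Real.Gamma_pos_of_pos (by linarith)
  calc _ ≤ Real.exp (Real.pi * |t|) *
        (Real.Gamma (1 + η) * ((1 + |t|) * ‖Complex.Gamma (1 + t * I)‖)) ^ 2 := by
        gcongr
        exact e3.trans (by gcongr)
    _ = Real.Gamma (1 + η) ^ 2 * ((1 + |t|) ^ 2 *
        (Real.exp (Real.pi * |t|) * ‖Complex.Gamma (1 + t * I)‖ ^ 2)) := by ring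
    _ ≤ Real.Gamma (1 + η) ^ 2 * ((1 + |t|) ^ 2 * (7 * (1 + |t|))) := by
        refine mul_le_mul_of_nonneg_left (mul_le_mul_of_nonneg_left (e2.trans ?_) (by positivity))
          (by positivity)
        -- The constant `7` is an upper bound for `2π`.
        have := Real.pi_lt_d2
        nlinarith [abs_nonneg t]
    _ = _ := by ring

/-- The residue classes partition the integers, so the partial zeta functions together are dominated
by one zeta value. The bound is uniform in `N`. -/
theorem sum_norm_LFunction_single_le (N : ℕ) [NeZero N] {s : ℂ} (hs : 1 < s.re) :
    ∑ j : ZMod N, ‖ZMod.LFunction (Pi.single j 1) s‖ ≤ ∑' n : ℕ, 1 / (n : ℝ) ^ s.re := by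
  have hsum : Summable fun n : ℕ => 1 / (n : ℝ) ^ s.re := Real.summable_one_div_nat_rpow.mpr hs
  have hterm : ∀ (j : ZMod N) (n : ℕ),
      ‖LSeries.term (fun n => (Pi.single j 1 : ZMod N → ℂ) n) s n‖ ≤
        if (n : ZMod N) = j then 1 / (n : ℝ) ^ s.re else 0 := by
    intro j n
    rw [LSeries.norm_term_eq]
    split_ifs with h1 h2 h2
    · positivity
    · rfl
    · rw [h2]; simp
    · simp [h2]
  have hsum' : ∀ j : ZMod N, Summable fun n : ℕ => if (n : ZMod N) = j then 1 / (n : ℝ) ^ s.re else 0 := by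
    intro j
    refine Summable.of_nonneg_of_le (fun n => ?_) (fun n => ?_) hsum
    · split_ifs <;> positivity
    · split_ifs
      · rfl
      · positivity
  calc _ ≤ ∑ j : ZMod N, ∑' n : ℕ, (if (n : ZMod N) = j then 1 / (n : ℝ) ^ s.re else 0) := by
        refine Finset.sum_le_sum fun j _ => ?_
        rw [ZMod.LFunction_eq_LSeries _ hs, LSeries]
        exact tsum_of_norm_bounded (hsum' j).hasSum (hterm j)
    _ = _ := by
        rw [← Summable.tsum_finsetSum fun j _ => hsum' j]
        congr 1
        ext n
        simp

theorem ZMod.LFunction_eq_sum_single {N : ℕ} [NeZero N] (Φ : ZMod N → ℂ) (s : ℂ) :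
    ZMod.LFunction Φ s = ∑ j : ZMod N, Φ j * ZMod.LFunction (Pi.single j 1) s := by
  simp only [ZMod.LFunction, Finset.mul_sum]
  refine Finset.sum_congr rfl fun j _ => ?_
  rw [Finset.sum_eq_single j]
  · simp; ring
  · intro i _ hi
    simp [hi]
  · simp

/-- After both Fourier transforms are opened, the average over `ψ` replaces `τ(ψ̄) ψ(b u v)` by
`φ(k)` times the additive character at `b u v`, which leaves the bilinear sum. -/
theorem norm_sum_tau_mul_dft_mul_dft_le (k : ℕ) [NeZero k] {b : ZMod k} (hb : IsUnit b)
    (i j : ZMod k) :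
    ‖∑ ψ : DirichletCharacter ℂ k, tau ψ⁻¹ * ψ b * (𝓕 ψ i * 𝓕 ψ j)‖ ≤
      k.totient * (k * (k.divisors.card : ℝ)) := by
  classical
  have h1 : ∑ ψ : DirichletCharacter ℂ k, tau ψ⁻¹ * ψ b * (𝓕 ψ i * 𝓕 ψ j) =
      (k.totient : ℂ) * ∑ u : ZMod k, ∑ v : ZMod k, (if IsUnit u ∧ IsUnit v then
      (ZMod.stdAddChar (u * (-i) + v * (-j) + b * u * v) : ℂ) else 0) := by
    simp_rw [ZMod.dft_apply, Finset.sum_mul_sum, Finset.mul_sum]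
    rw [Finset.sum_comm]
    refine Finset.sum_congr rfl fun u _ => ?_
    rw [Finset.sum_comm]
    refine Finset.sum_congr rfl fun v _ => ?_
    have h2 := sum_tau_inv_mul k (b * u * v)
    have h3 : IsUnit (b * u * v) ↔ IsUnit u ∧ IsUnit v := by
      simp [IsUnit.mul_iff, hb]
    have h4 : ∀ ψ : DirichletCharacter ℂ k, tau ψ⁻¹ * ψ b *
        ((ZMod.stdAddChar (-(u * i)) : ℂ) • ψ u * (ZMod.stdAddChar (-(v * j)) : ℂ) • ψ v) =
        (ZMod.stdAddChar (-(u * i)) : ℂ) * (ZMod.stdAddChar (-(v * j)) : ℂ) *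
          (tau ψ⁻¹ * ψ (b * u * v)) := by
      intro ψ
      simp only [map_mul, smul_eq_mul]
      ring
    simp_rw [h4]
    rw [← Finset.mul_sum, h2]
    simp only [h3]
    split_ifs
    · rw [AddChar.map_add_eq_mul, AddChar.map_add_eq_mul, mul_neg, mul_neg]
      ring
    · simp
  rw [h1, norm_mul, Complex.norm_natCast]
  gcongr
  exact norm_sum_units_bilinear_le k hb _ _

/-- The point is that the coefficients `c` do not depend on `ψ`. The functional equation is linear
in the Fourier transform of `ψ`, so averages over `ψ` can be taken inside the sum, at the price of
the `ℓ¹` norm of `c`. -/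
theorem dirichletLFunction_one_sub_eq_sum_dft {k : ℕ} [NeZero k] {s : ℂ} (hs : 1 < s.re) :
    ∃ c : ZMod k → ℂ, (∀ ψ : DirichletCharacter ℂ k, ψ.LFunction (1 - s) = ∑ j, 𝓕 ψ j * c j) ∧
      ∑ j, ‖c j‖ ≤ (k : ℝ) ^ (s.re - 1) * (‖Complex.Gamma s‖ * Real.exp (Real.pi * |s.im| / 2)) *
        (2 * ∑' n : ℕ, 1 / (n : ℝ) ^ s.re) := by
  set K : ℂ := (k : ℂ) ^ (s - 1) * (2 * Real.pi) ^ (-s) * Complex.Gamma s with hK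
  set E₁ := cexp (Real.pi * I * s / 2) with hE₁
  set E₂ := cexp (-Real.pi * I * s / 2) with hE₂
  set lam : ZMod k → ℂ := fun j => ZMod.LFunction (Pi.single j 1) s with hlam
  have hk0 : (0 : ℝ) < k := Nat.cast_pos.mpr (NeZero.pos k)
  refine ⟨fun j => K * (E₁ * lam j + E₂ * lam (-j)), fun ψ => ?_, ?_⟩
  · have h1 := ZMod.LFunction_one_sub (fun j => ψ j) (s := s) (fun n h => by
      rw [h] at hs; simp at hs; linarith [(Nat.cast_nonneg n : (0 : ℝ) ≤ n)]) (Or.inr (by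
        rintro rfl; simp at hs))
    refine h1.trans ?_
    rw [ZMod.dft_comp_neg, ZMod.LFunction_eq_sum_single, ZMod.LFunction_eq_sum_single (fun k_1 => _)]
    have h2 : ∑ j : ZMod k, 𝓕 (fun j => ψ j) (-j) * ZMod.LFunction (Pi.single j 1) s =
        ∑ j : ZMod k, 𝓕 (fun j => ψ j) j * lam (-j) := by
      rw [← Equiv.sum_comp (Equiv.neg (ZMod k))]
      simp [hlam]
    rw [h2, Finset.mul_sum, Finset.mul_sum, ← Finset.sum_add_distrib, Finset.mul_sum]
    refine Finset.sum_congr rfl fun j _ => ?_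
    simp only [hlam]
    ring
  · have hexp : ∀ E : ℂ, (E = E₁ ∨ E = E₂) → ‖E‖ ≤ Real.exp (Real.pi * |s.im| / 2) := by
      have h1 : (Real.pi * I * s / 2 : ℂ).re = -(Real.pi * s.im / 2) := by
        rw [show (Real.pi * I * s / 2 : ℂ) = ((Real.pi / 2 : ℝ) : ℂ) * (I * s) by push_cast; ring,
          re_ofReal_mul]
        simp; ring
      have h2 : (-Real.pi * I * s / 2 : ℂ).re = Real.pi * s.im / 2 := by
        rw [show (-Real.pi * I * s / 2 : ℂ) = ((-(Real.pi / 2) : ℝ) : ℂ) * (I * s) by push_cast; ring,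
          re_ofReal_mul]
        simp; ring
      have h3 := mul_le_mul_of_nonneg_left (le_abs_self s.im) Real.pi_pos.le
      have h4 := mul_le_mul_of_nonneg_left (neg_le_abs s.im) Real.pi_pos.le
      rintro E (rfl | rfl)
      · rw [hE₁, Complex.norm_exp, h1]
        exact Real.exp_le_exp.mpr (by linarith)
      · rw [hE₂, Complex.norm_exp, h2]
        exact Real.exp_le_exp.mpr (by linarith)
    have hKn : ‖K‖ ≤ (k : ℝ) ^ (s.re - 1) * ‖Complex.Gamma s‖ := by
      rw [hK, norm_mul, norm_mul]
      have h1 : ‖(k : ℂ) ^ (s - 1)‖ = (k : ℝ) ^ (s.re - 1) := by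
        have := norm_cpow_eq_rpow_re_of_pos hk0 (s - 1)
        simpa using this
      have h2 : ‖(2 * Real.pi : ℂ) ^ (-s)‖ ≤ 1 := by
        have h3 := norm_cpow_eq_rpow_re_of_pos Real.two_pi_pos (-s)
        push_cast at h3
        rw [h3]
        exact Real.rpow_le_one_of_one_le_of_nonpos (by linarith [Real.pi_gt_three]) (by simp; linarith)
      rw [h1]
      gcongr
      exact mul_le_of_le_one_right (by positivity) h2
    set X := Real.exp (Real.pi * |s.im| / 2) with hX
    have hZ := sum_norm_LFunction_single_le k hs
    calc ∑ j, ‖K * (E₁ * lam j + E₂ * lam (-j))‖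
        ≤ ∑ j, ‖K‖ * (X * ‖lam j‖ + X * ‖lam (-j)‖) := by
          refine Finset.sum_le_sum fun j _ => ?_
          rw [norm_mul]
          gcongr
          refine (norm_add_le _ _).trans ?_
          rw [norm_mul, norm_mul]
          gcongr
          · exact hexp _ (Or.inl rfl)
          · exact hexp _ (Or.inr rfl)
      _ = ‖K‖ * (X * (2 * ∑ j, ‖lam j‖)) := by
          rw [← Finset.mul_sum, Finset.sum_add_distrib, ← Finset.mul_sum, ← Finset.mul_sum]
          have : ∑ j, ‖lam (-j)‖ = ∑ j, ‖lam j‖ :=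
            Equiv.sum_comp (Equiv.neg (ZMod k)) fun j => ‖lam j‖
          rw [this]; ring
      _ ≤ ((k : ℝ) ^ (s.re - 1) * ‖Complex.Gamma s‖) * (X * (2 * ∑' n : ℕ, 1 / (n : ℝ) ^ s.re)) := by
          gcongr
      _ = _ := by ring

/-- Averages of `L(w, ψ)²` to the left of the critical strip, from the functional equation. -/
theorem norm_sum_tau_mul_LFunction_sq_le {η : ℝ} (h0 : 0 < η) (h1 : η < 1) :
    ∃ C : ℝ, 0 ≤ C ∧ ∀ (k : ℕ) [NeZero k] (b : ZMod k) (t : ℝ),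
      ‖∑ ψ : DirichletCharacter ℂ k, tau ψ⁻¹ * ψ b * ψ.LFunction (-η + t * I) ^ 2‖ ≤
        C * (k.totient * ((k : ℝ) ^ (1 + 2 * η) * (k.divisors.card : ℝ)) * (1 + |t|) ^ 3) := by
  set Z : ℝ := ∑' n : ℕ, 1 / (n : ℝ) ^ (1 + η) with hZ
  refine ⟨4 * Z ^ 2 * Real.Gamma (1 + η) ^ 2 * 7, by positivity, fun k _ b t => ?_⟩
  have hk0 : (0 : ℝ) < k := Nat.cast_pos.mpr (NeZero.pos k)
  by_cases hb : IsUnit b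
  swap
  · have : ∀ ψ : DirichletCharacter ℂ k, ψ b = 0 := fun ψ => MulChar.map_nonunit _ hb
    simp only [this]
    simp only [mul_zero, zero_mul, Finset.sum_const_zero, norm_zero]
    positivity
  set s : ℂ := (1 + η : ℝ) + (-t : ℝ) * I with hs
  have hsr : s.re = 1 + η := by simp [hs]
  have hsi : s.im = -t := by simp [hs]
  obtain ⟨c, hc1, hc2⟩ := dirichletLFunction_one_sub_eq_sum_dft (k := k) (s := s) (by rw [hsr]; linarith)
  have hw : 1 - s = -η + t * I := by rw [hs]; push_cast; ring
  rw [hw] at hc1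
  rw [hsr, hsi, abs_neg] at hc2
  have e1 : ∑ ψ : DirichletCharacter ℂ k, tau ψ⁻¹ * ψ b * ψ.LFunction (-η + t * I) ^ 2 =
      ∑ i, ∑ j, c i * c j * ∑ ψ : DirichletCharacter ℂ k, tau ψ⁻¹ * ψ b * (𝓕 ψ i * 𝓕 ψ j) := by
    simp_rw [hc1, pow_two, Finset.sum_mul_sum, Finset.mul_sum]
    rw [Finset.sum_comm]
    refine Finset.sum_congr rfl fun i _ => ?_
    rw [Finset.sum_comm]
    refine Finset.sum_congr rfl fun j _ => ?_
    refine Finset.sum_congr rfl fun ψ _ => ?_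
    ring
  rw [e1]
  have hG := exp_mul_norm_Gamma_sq_le h0 h1 (-t)
  rw [abs_neg] at hG
  have hexp : Real.exp (Real.pi * |t|) = Real.exp (Real.pi * |t| / 2) ^ 2 := by
    rw [← Real.exp_nat_mul]; congr 1; push_cast; ring
  set X := Real.exp (Real.pi * |t| / 2)
  calc _ ≤ ∑ i, ∑ j, ‖c i‖ * ‖c j‖ * (k.totient * (k * (k.divisors.card : ℝ))) := by
        refine (norm_sum_le _ _).trans (Finset.sum_le_sum fun i _ => ?_)
        refine (norm_sum_le _ _).trans (Finset.sum_le_sum fun j _ => ?_)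
        rw [norm_mul, norm_mul]
        gcongr
        exact norm_sum_tau_mul_dft_mul_dft_le k hb i j
    _ = (∑ j, ‖c j‖) ^ 2 * (k.totient * (k * (k.divisors.card : ℝ))) := by
        rw [pow_two, Finset.sum_mul_sum, Finset.sum_mul]
        exact Finset.sum_congr rfl fun i _ => by rw [Finset.sum_mul]
    _ ≤ ((k : ℝ) ^ (1 + η - 1) * (‖Complex.Gamma s‖ * X) * (2 * Z)) ^ 2 *
        (k.totient * (k * (k.divisors.card : ℝ))) := by gcongr
    _ = (4 * Z ^ 2) * (X ^ 2 * ‖Complex.Gamma s‖ ^ 2) * (((k : ℝ) ^ (1 + η - 1)) ^ 2 *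
        (k.totient * (k * (k.divisors.card : ℝ)))) := by ring
    _ ≤ (4 * Z ^ 2) * (Real.Gamma (1 + η) ^ 2 * (7 * (1 + |t|) ^ 3)) *
        (((k : ℝ) ^ (1 + η - 1)) ^ 2 * (k.totient * (k * (k.divisors.card : ℝ)))) := by
        rw [hexp] at hG
        gcongr
    _ = _ := by
        have : ((k : ℝ) ^ (1 + η - 1)) ^ 2 * k = (k : ℝ) ^ (1 + 2 * η) := by
          rw [← Real.rpow_natCast, ← Real.rpow_mul hk0.le]
          nth_rewrite 2 [← Real.rpow_one (k : ℝ)]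
          rw [← Real.rpow_add hk0]
          congr 1; push_cast; ring
        rw [← this]; ring

/-- `1 / φ(k) ∑ τ(ψ̄) ψ(b) L_q(w, ψ)²`, over the characters `ψ` modulo `k`. -/
noncomputable def twistedSquare {q k : ℕ} [NeZero q] [NeZero k] (h : k ∣ q) (b : ZMod k) (w : ℂ) : ℂ :=
  1 / (k.totient : ℂ) * ∑ ψ : DirichletCharacter ℂ k,
    tau ψ⁻¹ * ψ b * (DirichletCharacter.changeLevel h ψ).LFunction w ^ 2

/-- The Euler factors at `p ∣ q` are expanded over subsets of the prime factors. Each subset costs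
at most `q ^ η` and multiplies `b` by a product of primes, which the average over `ψ` tolerates even
if the result is not a unit. There are at most `d(q)²` pairs of subsets. -/
theorem norm_twistedSquare_le {η : ℝ} (h0 : 0 < η) (h1 : η < 1) :
    ∃ C : ℝ, 0 ≤ C ∧ ∀ (q k : ℕ) [NeZero q] [NeZero k] (h : k ∣ q) (b : ZMod k) (t : ℝ),
      ‖twistedSquare h b (-η + t * I)‖ ≤
        C * ((k : ℝ) ^ (1 + 2 * η) * (k.divisors.card : ℝ) * ((q : ℝ) ^ (2 * η) *
          (q.divisors.card : ℝ) ^ 2) * (1 + |t|) ^ 3) := by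
  obtain ⟨C, hC0, hC⟩ := norm_sum_tau_mul_LFunction_sq_le h0 h1
  refine ⟨C, hC0, fun q k _ _ h b t => ?_⟩
  set w : ℂ := -η + t * I with hw
  have hwr : w.re = -η := by simp [hw]
  have hw1 : w ≠ 1 := by
    intro h'
    rw [h'] at hwr
    simp at hwr
    linarith
  have hq0 : (0 : ℝ) < q := Nat.cast_pos.mpr (NeZero.pos q)
  have hphi : (0 : ℝ) < k.totient := Nat.cast_pos.mpr (Nat.totient_pos.mpr (NeZero.pos k))
  set P := q.primeFactors with hP
  set c : Finset ℕ → ℂ := fun T => ∏ p ∈ T, (-(p : ℂ) ^ (-w)) with hc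
  have hcn : ∀ T ∈ P.powerset, ‖c T‖ ≤ (q : ℝ) ^ η := by
    intro T hT
    rw [Finset.mem_powerset] at hT
    have hpos : ∀ p ∈ T, (0 : ℝ) < p := fun p hp =>
      Nat.cast_pos.mpr (Nat.prime_of_mem_primeFactors (hT hp)).pos
    rw [hc, norm_prod]
    calc ∏ p ∈ T, ‖-(p : ℂ) ^ (-w)‖ = ∏ p ∈ T, (p : ℝ) ^ η := by
          refine Finset.prod_congr rfl fun p hp => ?_
          rw [norm_neg]
          have := norm_cpow_eq_rpow_re_of_pos (hpos p hp) (-w)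
          simpa [hwr] using this
      _ = (∏ p ∈ T, (p : ℝ)) ^ η := Real.finsetProd_rpow _ _ (fun p hp => (hpos p hp).le) _
      _ ≤ _ := by
          refine Real.rpow_le_rpow (Finset.prod_nonneg fun p hp => (hpos p hp).le) ?_ h0.le
          have : ∏ p ∈ T, p ≤ q := by
            refine Nat.le_of_dvd (NeZero.pos q) ?_
            exact (Finset.prod_dvd_prod_of_subset _ _ _ hT).trans (Nat.prod_primeFactors_dvd q)
          rw [← Nat.cast_prod]
          exact_mod_cast this
  have hexpand : ∀ ψ : DirichletCharacter ℂ k, (DirichletCharacter.changeLevel h ψ).LFunction w =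
      ∑ T ∈ P.powerset, c T * ψ ((∏ p ∈ T, p : ℕ) : ZMod k) * ψ.LFunction w := by
    intro ψ
    rw [← coprimeLFunction_eq_changeLevel h ψ hw1, coprimeLFunction]
    have h2 : ∀ p : ℕ, 1 - ψ (p : ZMod k) * (p : ℂ) ^ (-w) = (-(p : ℂ) ^ (-w) * ψ (p : ZMod k)) + 1 :=
      fun p => by ring
    simp_rw [h2]
    rw [Finset.prod_add, Finset.mul_sum]
    refine Finset.sum_congr rfl fun T _ => ?_
    rw [Finset.prod_const_one, mul_one, Finset.prod_mul_distrib]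
    push_cast
    rw [map_prod]
    ring
  have e1 : twistedSquare h b w = 1 / (k.totient : ℂ) * ∑ T ∈ P.powerset, ∑ T' ∈ P.powerset,
      c T * c T' * ∑ ψ : DirichletCharacter ℂ k, tau ψ⁻¹ *
        ψ (b * ((∏ p ∈ T, p : ℕ) : ZMod k) * ((∏ p ∈ T', p : ℕ) : ZMod k)) * ψ.LFunction w ^ 2 := by
    rw [twistedSquare]
    congr 1
    simp_rw [hexpand]
    simp_rw [pow_two (Finset.sum _ _), Finset.sum_mul_sum, Finset.mul_sum]
    rw [Finset.sum_comm]
    refine Finset.sum_congr rfl fun T _ => ?_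
    rw [Finset.sum_comm]
    refine Finset.sum_congr rfl fun T' _ => ?_
    refine Finset.sum_congr rfl fun ψ _ => ?_
    rw [map_mul, map_mul]
    ring
  rw [e1, norm_mul, norm_div, norm_one, Complex.norm_natCast]
  set X : ℝ := C * (k.totient * ((k : ℝ) ^ (1 + 2 * η) * (k.divisors.card : ℝ)) * (1 + |t|) ^ 3)
  have hcard : ((P.powerset.card : ℝ)) ≤ q.divisors.card := by
    rw [Finset.card_powerset]
    exact_mod_cast two_pow_card_primeFactors_le (NeZero.ne q)
  calc _ ≤ 1 / (k.totient : ℝ) * ∑ T ∈ P.powerset, ∑ T' ∈ P.powerset,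
        ((q : ℝ) ^ η * (q : ℝ) ^ η * X) := by
        gcongr
        refine (norm_sum_le _ _).trans (Finset.sum_le_sum fun T hT => ?_)
        refine (norm_sum_le _ _).trans (Finset.sum_le_sum fun T' hT' => ?_)
        rw [norm_mul, norm_mul]
        gcongr
        · exact hcn T hT
        · exact hcn T' hT'
        · exact hC k _ t
    _ = 1 / (k.totient : ℝ) * ((P.powerset.card : ℝ) ^ 2 * ((q : ℝ) ^ (2 * η) * X)) := by
        rw [Finset.sum_const, Finset.sum_const, nsmul_eq_mul, nsmul_eq_mul, two_mul η,
          Real.rpow_add hq0]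
        ring
    _ ≤ 1 / (k.totient : ℝ) * ((q.divisors.card : ℝ) ^ 2 * ((q : ℝ) ^ (2 * η) * X)) := by
        gcongr
    _ = _ := by
        simp only [X]
        field_simp

/-! ### Reciprocity, Gauss sums of induced characters, and detection of primitive characters -/

/-- The reciprocity law `e(n d̄ / c) e(n c̄ / d) = e(n / (c d))`. -/
theorem stdAddChar_mul_reciprocity {c d : ℕ} [NeZero c] [NeZero d] [NeZero (c * d)]
    (h : Nat.Coprime c d) (n : ℤ) :
    (ZMod.stdAddChar (n : ZMod (c * d)) : ℂ) = ZMod.stdAddChar ((n : ZMod c) * (d : ZMod c)⁻¹) *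
      ZMod.stdAddChar ((n : ZMod d) * (c : ZMod d)⁻¹) := by
  -- Bézout: `y` inverts `d` modulo `c`, `x` inverts `c` modulo `d`, and `y / c + x / d = 1 / (c
  -- d)`.
  obtain ⟨x, y, hxy⟩ : ∃ x y : ℤ, (c : ℤ) * x + d * y = 1 := by
    refine ⟨Nat.gcdA c d, Nat.gcdB c d, ?_⟩
    rw [← Nat.gcd_eq_gcd_ab, h.gcd_eq_one]; rfl
  have h1 : (d : ZMod c)⁻¹ = (y : ZMod c) := by
    apply ZMod.inv_eq_of_mul_eq_one
    have := congrArg (Int.cast : ℤ → ZMod c) hxy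
    push_cast at this
    simpa using this
  have h2 : (c : ZMod d)⁻¹ = (x : ZMod d) := by
    apply ZMod.inv_eq_of_mul_eq_one
    have := congrArg (Int.cast : ℤ → ZMod d) hxy
    push_cast at this
    simpa using this
  have hc : (c : ℂ) ≠ 0 := Nat.cast_ne_zero.mpr (NeZero.ne c)
  have hd : (d : ℂ) ≠ 0 := Nat.cast_ne_zero.mpr (NeZero.ne d)
  rw [h1, h2, ← Int.cast_mul, ← Int.cast_mul, ZMod.stdAddChar_coe, ZMod.stdAddChar_coe,
    ZMod.stdAddChar_coe, ← Complex.exp_add]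
  congr 1
  have h3 : (c : ℂ) * x + d * y = 1 := by exact_mod_cast hxy
  push_cast
  field_simp
  linear_combination -(n : ℂ) * h3

namespace DirichletCharacter

theorem changeLevel_apply_of_isUnit {d q : ℕ} (h : d ∣ q) (ψ : DirichletCharacter ℂ d) {a : ZMod q}
    (ha : IsUnit a) : changeLevel h ψ a = ψ (ZMod.castHom h (ZMod d) a) := by
  obtain ⟨u, rfl⟩ := ha
  rw [changeLevel_eq_cast_of_dvd]
  rfl

/-- The Chinese remainder theorem and reciprocity factor the sum. Modulo `c` there remains a
Ramanujan sum at a unit, equal to `μ(c)`; modulo `d` a Gauss sum of `ψ` dilated by `c̄`, which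
yields `ψ(c) τ(ψ)`. -/
theorem tau_changeLevel_of_coprime {c d : ℕ} [NeZero c] [NeZero d] [NeZero (c * d)]
    (h : Nat.Coprime c d) (ψ : DirichletCharacter ℂ d) :
    tau (changeLevel (Dvd.intro_left c rfl : d ∣ c * d) ψ) =
      ((ArithmeticFunction.moebius c : ℤ) : ℂ) * (ψ (c : ZMod d) * tau ψ) := by
  classical
  set hd : d ∣ c * d := Dvd.intro_left c rfl
  set hc : c ∣ c * d := Dvd.intro d rfl
  have hcu : IsUnit (c : ZMod d) := (ZMod.isUnit_iff_coprime c d).mpr h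
  have hdu : IsUnit (d : ZMod c)⁻¹ := by
    have hdu : IsUnit (d : ZMod c) := (ZMod.isUnit_iff_coprime d c).mpr h.symm
    obtain ⟨u, hu⟩ := hdu
    rw [← hu, ZMod.inv_coe_unit]
    exact u⁻¹.isUnit
  set e := ZMod.chineseRemainder h
  have he1 : ∀ a, (e a).1 = ZMod.castHom hc (ZMod c) a := fun a =>
    DFunLike.congr_fun (Subsingleton.elim ((RingHom.fst _ _).comp e.toRingHom)
      (ZMod.castHom hc (ZMod c))) a
  have he2 : ∀ a, (e a).2 = ZMod.castHom hd (ZMod d) a := fun a =>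
    DFunLike.congr_fun (Subsingleton.elim ((RingHom.snd _ _).comp e.toRingHom)
      (ZMod.castHom hd (ZMod d))) a
  have hterm : ∀ a : ZMod (c * d), changeLevel hd ψ a * (ZMod.stdAddChar a : ℂ) =
      (fun p : ZMod c × ZMod d => (if IsUnit p.1 then (ZMod.stdAddChar (p.1 * (d : ZMod c)⁻¹) : ℂ) else 0) *
        (ψ p.2 * ZMod.stdAddChar (p.2 * (c : ZMod d)⁻¹))) (e a) := by
    intro a
    have hu : IsUnit a ↔ IsUnit (e a).1 ∧ IsUnit (e a).2 := by
      rw [← Prod.isUnit_iff, isUnit_map_iff]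
    by_cases ha : IsUnit a
    · rw [changeLevel_apply_of_isUnit hd ψ ha]
      simp only [if_pos (hu.mp ha).1]
      obtain ⟨n, rfl⟩ := ZMod.intCast_surjective a
      rw [stdAddChar_mul_reciprocity h n, he1, he2]
      simp only [map_intCast]
      ring
    · rw [MulChar.map_nonunit _ ha, zero_mul]
      simp only
      by_cases h1 : IsUnit (e a).1
      · have h2 : ¬ IsUnit (e a).2 := fun h2 => ha (hu.mpr ⟨h1, h2⟩)
        rw [MulChar.map_nonunit _ h2]; simp
      · rw [if_neg h1]; simp
  rw [tau, gaussSum]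
  simp_rw [hterm]
  refine (Equiv.sum_comp e.toEquiv (fun p : ZMod c × ZMod d =>
    (if IsUnit p.1 then (ZMod.stdAddChar (p.1 * (d : ZMod c)⁻¹) : ℂ) else 0) *
        (ψ p.2 * ZMod.stdAddChar (p.2 * (c : ZMod d)⁻¹)))).trans ?_
  rw [Fintype.sum_prod_type]
  refine (Finset.sum_mul_sum Finset.univ Finset.univ
    (fun x : ZMod c => if IsUnit x then (ZMod.stdAddChar (x * (d : ZMod c)⁻¹) : ℂ) else 0)
    (fun y : ZMod d => ψ y * ZMod.stdAddChar (y * (c : ZMod d)⁻¹))).symm.trans ?_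
  rw [sum_units_stdAddChar_unit c hdu]
  congr 1
  obtain ⟨u, hu⟩ := hcu
  rw [tau, ← gaussSum_mulShift ψ ZMod.stdAddChar u⁻¹, ← mul_assoc, ← hu, ← map_mul]
  simp [gaussSum, AddChar.mulShift_apply, mul_comm]

/-- For a prime `p` dividing `c` and `d`, translation by `z = (c / p) d` preserves units, because
`z` is nilpotent, and preserves the class modulo `d`. So it fixes the induced character, while the
additive character gains the factor `e(1 / p) ≠ 1`. -/
theorem tau_changeLevel_of_not_coprime {c d : ℕ} [NeZero c] [NeZero d] [NeZero (c * d)]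
    (h : ¬ Nat.Coprime c d) (ψ : DirichletCharacter ℂ d) :
    tau (changeLevel (Dvd.intro_left c rfl : d ∣ c * d) ψ) = 0 := by
  set hd : d ∣ c * d := Dvd.intro_left c rfl
  obtain ⟨p, hp, ⟨c', hc'⟩, ⟨d', hd'⟩⟩ := Nat.Prime.not_coprime_iff_dvd.mp h
  set z : ZMod (c * d) := ((c' * d : ℕ) : ZMod (c * d)) with hz
  have hz2 : z * z = 0 := by
    rw [hz, ← Nat.cast_mul, ZMod.natCast_eq_zero_iff]
    exact ⟨c' * d', by rw [hc', hd']; ring⟩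
  have hnil : IsNilpotent z := ⟨2, by rw [pow_two, hz2]⟩
  have hnil' : IsNilpotent (-z) := ⟨2, by rw [pow_two, neg_mul_neg, hz2]⟩
  have hcast : ZMod.castHom hd (ZMod d) z = 0 := by
    rw [hz, map_natCast]
    simp
  have hshift : ∀ a, changeLevel hd ψ (a + z) = changeLevel hd ψ a := by
    intro a
    by_cases ha : IsUnit a
    · have ha' : IsUnit (a + z) := hnil.isUnit_add_left_of_commute ha (Commute.all _ _)
      rw [changeLevel_apply_of_isUnit hd ψ ha, changeLevel_apply_of_isUnit hd ψ ha', map_add, hcast,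
        add_zero]
    · have ha' : ¬ IsUnit (a + z) := fun hu => ha (by
        simpa using hnil'.isUnit_add_left_of_commute hu (Commute.all _ _))
      rw [MulChar.map_nonunit _ ha, MulChar.map_nonunit _ ha']
  have hz1 : (ZMod.stdAddChar z : ℂ) ≠ 1 := by
    intro h1
    have : z = 0 := ZMod.injective_stdAddChar (by rw [h1, AddChar.map_zero_eq_one])
    rw [hz, ZMod.natCast_eq_zero_iff] at this
    have hc0 : c' ≠ 0 := fun h0 => NeZero.ne c (by rw [hc', h0, mul_zero])
    have h3 := Nat.le_of_dvd (Nat.mul_pos (Nat.pos_of_ne_zero hc0) (NeZero.pos d)) this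
    rw [hc'] at h3
    have h4 : 0 < c' * d := Nat.mul_pos (Nat.pos_of_ne_zero hc0) (NeZero.pos d)
    nlinarith [hp.two_le]
  have key : tau (changeLevel hd ψ) = ZMod.stdAddChar z * tau (changeLevel hd ψ) := by
    conv_lhs => rw [tau, gaussSum, ← Equiv.sum_comp (Equiv.addRight z)]
    rw [tau, gaussSum, Finset.mul_sum]
    refine Finset.sum_congr rfl fun a _ => ?_
    simp only [Equiv.coe_addRight]
    rw [hshift, AddChar.map_add_eq_mul]
    ring
  have : (1 - (ZMod.stdAddChar z : ℂ)) * tau (changeLevel hd ψ) = 0 := by linear_combination key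
  exact (mul_eq_zero.mp this).resolve_left (sub_ne_zero.mpr (Ne.symm hz1))

open Classical in
theorem sum_filter_conductor_dvd {d q : ℕ} [NeZero d] [NeZero q] (h : d ∣ q)
    (f : DirichletCharacter ℂ q → ℂ) :
    ∑ χ : DirichletCharacter ℂ q with χ.conductor ∣ d, f χ =
      ∑ ψ : DirichletCharacter ℂ d, f (changeLevel h ψ) := by
  symm
  refine Finset.sum_nbij (fun ψ => changeLevel h ψ) ?_ ?_ ?_ fun _ _ => rfl
  · intro ψ _
    simp only [Finset.mem_filter, Finset.mem_univ, true_and]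
    rw [← mem_conductorSet_iff_conductor_dvd _ h]
    exact changeLevel_factorsThrough ψ h
  · exact (changeLevel_injective h).injOn
  · intro χ hχ
    simp only [Finset.coe_filter, Finset.mem_univ, true_and, mem_ofPred_eq] at hχ
    rw [← mem_conductorSet_iff_conductor_dvd _ h] at hχ
    exact ⟨hχ.2.choose, by simp, hχ.2.choose_spec.symm⟩

open Classical in
/-- Detecting primitive characters with the Möbius function. -/
theorem sum_filter_isPrimitive {q : ℕ} [NeZero q] (f : DirichletCharacter ℂ q → ℂ) :
    ∑ χ : DirichletCharacter ℂ q with χ.IsPrimitive, f χ =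
      ∑ x ∈ q.divisorsAntidiagonal, ((ArithmeticFunction.moebius x.1 : ℤ) : ℂ) *
        ∑ χ : DirichletCharacter ℂ q with χ.conductor ∣ x.2, f χ := by
  have key : ∀ χ : DirichletCharacter ℂ q, (if χ.IsPrimitive then (1 : ℂ) else 0) =
      ∑ x ∈ q.divisorsAntidiagonal, ((ArithmeticFunction.moebius x.1 : ℤ) : ℂ) *
        if χ.conductor ∣ x.2 then 1 else 0 := by
    intro χ
    obtain ⟨m, hm⟩ := χ.conductor_dvd_level
    set f := χ.conductor with hf
    have hq0 := NeZero.ne q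
    have hm0 : m ≠ 0 := fun h => NeZero.ne q (by rw [hm, h, mul_zero])
    have hf0 : f ≠ 0 := fun h => NeZero.ne q (by rw [hm, h, zero_mul])
    have : NeZero m := ⟨hm0⟩
    have h1 : (∑ x ∈ q.divisorsAntidiagonal, ((ArithmeticFunction.moebius x.1 : ℤ) : ℂ) *
        if f ∣ x.2 then 1 else 0) = ∑ e ∈ q.divisors, ((ArithmeticFunction.moebius e : ℤ) : ℂ) *
        if f ∣ q / e then 1 else 0 :=
      Nat.sum_divisorsAntidiagonal (fun e e' => ((ArithmeticFunction.moebius e : ℤ) : ℂ) *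
        if f ∣ e' then 1 else 0)
    have h2 : ∀ e ∈ q.divisors, (((ArithmeticFunction.moebius e : ℤ) : ℂ) *
        if f ∣ q / e then 1 else 0) = if e ∣ m then ((ArithmeticFunction.moebius e : ℤ) : ℂ) else 0 := by
      intro e he
      have he' := Nat.dvd_of_mem_divisors he
      have h3 : f ∣ q / e ↔ e ∣ m := by
        rw [Nat.dvd_div_iff_mul_dvd he', hm, mul_comm e f]
        exact Nat.mul_dvd_mul_iff_left (Nat.pos_of_ne_zero hf0)
      simp [h3]
    rw [h1, Finset.sum_congr rfl h2, ← Finset.sum_filter]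
    -- Here `m` is `q` divided by the conductor. The vacuous condition `e ∣ 0` brings the sum into
    -- the form of `sum_divisors_filter_moebius` with `v = 0`, and `0` is coprime to `m` exactly
    -- when `m = 1`.
    have h4 : {e ∈ q.divisors | e ∣ m} = {e ∈ m.divisors | e ∣ 0} := by
      ext e
      simp only [Finset.mem_filter, Nat.mem_divisors, dvd_zero, and_true]
      constructor
      · rintro ⟨-, h⟩; exact ⟨h, hm0⟩
      · rintro ⟨h, -⟩; exact ⟨⟨hm ▸ h.mul_left f, hq0⟩, h⟩
    rw [h4, ← Int.cast_sum, sum_divisors_filter_moebius]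
    have h5 : χ.IsPrimitive ↔ Nat.Coprime 0 m := by
      rw [Nat.coprime_zero_left, isPrimitive_def, ← hf]
      constructor
      · intro h
        rw [h] at hm
        have := NeZero.pos q
        nlinarith
      · intro h; rw [hm, h, mul_one]
    simp [h5]
  rw [Finset.sum_filter]
  have : ∀ χ : DirichletCharacter ℂ q, (if χ.IsPrimitive then f χ else 0) =
      ∑ x ∈ q.divisorsAntidiagonal, ((ArithmeticFunction.moebius x.1 : ℤ) : ℂ) *
        if χ.conductor ∣ x.2 then f χ else 0 := by
    intro χ
    have := congrArg (· * f χ) (key χ)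
    simp only [Finset.sum_mul, ite_mul, one_mul, zero_mul, mul_assoc] at this
    exact this
  simp_rw [this]
  rw [Finset.sum_comm]
  refine Finset.sum_congr rfl fun x _ => ?_
  rw [← Finset.mul_sum, Finset.sum_filter]

open Classical in
/-- Primitive characters weighted by Gauss sums, in terms of characters of coprime moduli. -/
theorem sum_filter_isPrimitive_tau {q : ℕ} [NeZero q] (f : DirichletCharacter ℂ q → ℂ) :
    ∑ χ : DirichletCharacter ℂ q with χ.IsPrimitive, tau χ⁻¹ * f χ =
      ∑ x ∈ q.divisorsAntidiagonal with Nat.Coprime x.1 x.2,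
        ((ArithmeticFunction.moebius x.1 : ℤ) : ℂ) *
        ∑ χ : DirichletCharacter ℂ q with χ.conductor ∣ x.2, tau χ⁻¹ * f χ := by
  rw [sum_filter_isPrimitive, Finset.sum_filter]
  refine Finset.sum_congr rfl fun x hx => ?_
  split_ifs with h
  · rfl
  · obtain ⟨hx1, hx2⟩ := Nat.mem_divisorsAntidiagonal.mp hx
    obtain ⟨c, d⟩ := x
    simp only at hx1 h ⊢
    subst hx1
    have : NeZero c := ⟨left_ne_zero_of_mul hx2⟩
    have : NeZero d := ⟨right_ne_zero_of_mul hx2⟩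
    rw [sum_filter_conductor_dvd (Dvd.intro_left c rfl)]
    rw [Finset.sum_eq_zero, mul_zero]
    intro ψ _
    rw [← map_inv, tau_changeLevel_of_not_coprime h, zero_mul]

open Classical in
theorem sum_filter_conductor_dvd_tau {c d : ℕ} [NeZero c] [NeZero d] [NeZero (c * d)]
    (h : Nat.Coprime c d) (f : DirichletCharacter ℂ (c * d) → ℂ) :
    ∑ χ : DirichletCharacter ℂ (c * d) with χ.conductor ∣ d, tau χ⁻¹ * f χ =
      ((ArithmeticFunction.moebius c : ℤ) : ℂ) * ∑ ψ : DirichletCharacter ℂ d,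
        tau ψ⁻¹ * ψ (c : ZMod d)⁻¹ * f (changeLevel (Dvd.intro_left c rfl : d ∣ c * d) ψ) := by
  rw [sum_filter_conductor_dvd (Dvd.intro_left c rfl), Finset.mul_sum]
  refine Finset.sum_congr rfl fun ψ _ => ?_
  obtain ⟨u, hu⟩ : IsUnit (c : ZMod d) := (ZMod.isUnit_iff_coprime c d).mpr h
  rw [← map_inv, tau_changeLevel_of_coprime h, ← hu, MulChar.inv_apply, Ring.inverse_unit,
    ZMod.inv_coe_unit]
  ring

/-- The Fourier transform of a primitive `χ` is `τ(χ) χ̄(-·)`. Transforming once more and comparing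
with Fourier inversion at `1` gives the product. -/
theorem IsPrimitive.tau_mul_tau_inv {q : ℕ} [NeZero q] {χ : DirichletCharacter ℂ q}
    (hχ : χ.IsPrimitive) : tau χ * tau χ⁻¹ = q * χ (-1) := by
  have h1 := congrFun (ZMod.dft_dft (fun j => χ j)) 1
  have h2 : 𝓕 (fun j => χ j) = fun j => tau χ * χ⁻¹ (-j) := by
    ext j
    have := hχ.fourierTransform_eq_inv_mul_gaussSum j
    rw [this, tau]; ring
  have hχ' : χ⁻¹.IsPrimitive := by
    rw [isPrimitive_def, conductor_inv]
    exact hχ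
  rw [h2, ZMod.dft_const_mul, ZMod.dft_comp_neg] at h1
  have h3 := hχ'.fourierTransform_eq_inv_mul_gaussSum (-1)
  simp only [smul_eq_mul] at h1
  rw [h3] at h1
  simp only [neg_neg, inv_inv, map_one, one_mul] at h1
  exact h1

/-- A closed form for `q φ*(q)`. -/
theorem mul_numPrimitive (q : ℕ) [NeZero q] :
    (q : ℂ) * numPrimitive q = ∑ x ∈ q.divisorsAntidiagonal with Nat.Coprime x.1 x.2,
      ((ArithmeticFunction.moebius x.1 : ℤ) : ℂ) * (x.2.totient : ℂ) ^ 2 := by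
  classical
  -- Each primitive `χ` is counted with `q = τ(χ̄) χ(-1) τ(χ)` instead of `1`. The Gauss weight
  -- kills the non-coprime factorisations, and orthogonality then evaluates the sum over `ψ`.
  have h1 : (q : ℂ) * numPrimitive q =
      ∑ χ : DirichletCharacter ℂ q with χ.IsPrimitive, tau χ⁻¹ * (χ (-1) * tau χ) := by
    have h2 : ∀ χ ∈ Finset.univ.filter (fun χ : DirichletCharacter ℂ q => χ.IsPrimitive),
        tau χ⁻¹ * (χ (-1) * tau χ) = q := by
      intro χ hχ
      have h3 := IsPrimitive.tau_mul_tau_inv (Finset.mem_filter.mp hχ).2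
      have h4 : χ (-1) * χ (-1) = 1 := by rw [← map_mul]; simp
      linear_combination χ (-1) * h3 + q * h4
    rw [Finset.sum_congr rfl h2, Finset.sum_const, nsmul_eq_mul, mul_comm, numPrimitive,
      Nat.card_eq_fintype_card, Fintype.card_subtype]
  rw [h1, sum_filter_isPrimitive_tau]
  refine Finset.sum_congr rfl fun x hx => ?_
  obtain ⟨hx, h⟩ := Finset.mem_filter.mp hx
  obtain ⟨hx1, hx2⟩ := Nat.mem_divisorsAntidiagonal.mp hx
  obtain ⟨c, d⟩ := x
  simp only at hx1 h ⊢
  subst hx1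
  have : NeZero c := ⟨left_ne_zero_of_mul hx2⟩
  have : NeZero d := ⟨right_ne_zero_of_mul hx2⟩
  have hu : IsUnit (c : ZMod d) := (ZMod.isUnit_iff_coprime c d).mpr h
  rw [sum_filter_conductor_dvd_tau h]
  by_cases hμ : ArithmeticFunction.moebius c = 0
  · simp [hμ]
  have hμ2 : ((ArithmeticFunction.moebius c : ℤ) : ℂ) ^ 2 = 1 := by
    have := ArithmeticFunction.moebius_sq_eq_one_of_squarefree
      (ArithmeticFunction.moebius_ne_zero_iff_squarefree.mp hμ)
    exact_mod_cast this
  have h5 : ∀ ψ : DirichletCharacter ℂ d, tau ψ⁻¹ * ψ (c : ZMod d)⁻¹ *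
      (changeLevel (Dvd.intro_left c rfl : d ∣ c * d) ψ (-1) *
        tau (changeLevel (Dvd.intro_left c rfl : d ∣ c * d) ψ)) =
      ((ArithmeticFunction.moebius c : ℤ) : ℂ) *
        ∑ b : ZMod d, ZMod.stdAddChar b * (tau ψ⁻¹ * ψ (-b)) := by
    intro ψ
    rw [tau_changeLevel_of_coprime h, changeLevel_apply_of_isUnit _ _ isUnit_one.neg]
    have h6 : ψ (c : ZMod d)⁻¹ * ψ (c : ZMod d) = 1 := by
      rw [← map_mul, ZMod.inv_mul_of_unit _ hu, map_one]
    have h7 : ∑ b : ZMod d, ZMod.stdAddChar b * (tau ψ⁻¹ * ψ (-b)) = tau ψ⁻¹ * ψ (-1) * tau ψ := by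
      nth_rewrite 3 [tau]
      rw [gaussSum, Finset.mul_sum]
      refine Finset.sum_congr rfl fun b _ => ?_
      rw [← neg_one_mul b, map_mul]; ring
    rw [h7]
    simp only [map_neg, map_one]
    linear_combination (tau ψ⁻¹ * ψ (-1) * ((ArithmeticFunction.moebius c : ℤ) : ℂ) * tau ψ) * h6
  simp_rw [h5]
  rw [← Finset.mul_sum, Finset.sum_comm]
  simp_rw [← Finset.mul_sum, sum_tau_inv_mul]
  have h8 : ∀ b : ZMod d, (ZMod.stdAddChar b : ℂ) *
      (if IsUnit (-b) then (d.totient : ℂ) * ZMod.stdAddChar (-b) else 0) =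
      if IsUnit b then (d.totient : ℂ) else 0 := by
    intro b
    simp only [IsUnit.neg_iff]
    split_ifs
    · have : (ZMod.stdAddChar b : ℂ) * ZMod.stdAddChar (-b) = 1 := by
        rw [← AddChar.map_add_eq_mul, add_neg_cancel, AddChar.map_zero_eq_one]
      linear_combination (d.totient : ℂ) * this
    · rw [mul_zero]
  simp_rw [h8]
  rw [← Finset.sum_filter, Finset.sum_const, nsmul_eq_mul]
  have h9 : (Finset.univ.filter fun b : ZMod d => IsUnit b).card = d.totient := by
    rw [← ZMod.card_units_eq_totient]
    symm
    refine Finset.card_nbij (fun u : (ZMod d)ˣ => (u : ZMod d)) (by simp) Units.val_injective.injOn ?_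
    intro b hb
    obtain ⟨u, hu⟩ : IsUnit b := by simpa using hb
    exact ⟨u, by simp, hu⟩
  rw [h9]
  linear_combination (((ArithmeticFunction.moebius c : ℤ) : ℂ) * (d.totient : ℂ) ^ 2) * hμ2

/-- The Dirichlet series agree for `re > 1`, and both sides are entire when `χ ≠ 1`. -/
theorem LFunction_inv_conj {q : ℕ} [NeZero q] {χ : DirichletCharacter ℂ q} (hχ : χ ≠ 1) (s : ℂ) :
    χ⁻¹.LFunction s = (starRingEnd ℂ) (χ.LFunction ((starRingEnd ℂ) s)) := by
  have hd1 : Differentiable ℂ (χ⁻¹.LFunction) := differentiable_LFunction (inv_ne_one.mpr hχ)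
  have hd2 : Differentiable ℂ (fun s => (starRingEnd ℂ) (χ.LFunction ((starRingEnd ℂ) s))) := by
    intro z
    have := ((differentiable_LFunction hχ) ((starRingEnd ℂ) z)).conj_conj
    rw [Complex.conj_conj] at this
    exact this
  have hev : χ⁻¹.LFunction =ᶠ[𝓝 2] (fun s => (starRingEnd ℂ) (χ.LFunction ((starRingEnd ℂ) s))) := by
    have hopen : {z : ℂ | 1 < z.re} ∈ 𝓝 (2 : ℂ) :=
      (isOpen_lt continuous_const continuous_re).mem_nhds (by simp)
    filter_upwards [hopen] with z hz
    have hz : 1 < z.re := hz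
    rw [LFunction_eq_LSeries _ hz, LFunction_eq_LSeries _ (by simpa using hz), LSeries, LSeries,
      Complex.conj_tsum]
    congr 1
    ext n
    rcases eq_or_ne n 0 with rfl | hn
    · simp
    · rw [LSeries.term_of_ne_zero hn, LSeries.term_of_ne_zero hn, map_div₀]
      have h1 : (starRingEnd ℂ) (χ (n : ZMod q)) = χ⁻¹ (n : ZMod q) := MulChar.star_apply' χ _
      have h2 : (starRingEnd ℂ) ((n : ℂ) ^ (starRingEnd ℂ) z) = (n : ℂ) ^ z := by
        rw [cpow_conj _ _ (by rw [Complex.natCast_arg]; exact Real.pi_pos.ne), Complex.conj_conj,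
          Complex.conj_natCast]
      rw [h1, h2]
  have := AnalyticOnNhd.eq_of_eventuallyEq (fun z _ => hd1.analyticAt z) (fun z _ => hd2.analyticAt z) hev
  exact congrFun this s

end DirichletCharacter

/-! ### The second moment weighted by Gauss sums and its functional equation -/

namespace DirichletCharacter

theorem ne_one_of_isPrimitive {q : ℕ} [NeZero q] (hq : 1 < q)
    {χ : DirichletCharacter ℂ q} (hχ : χ.IsPrimitive) : χ ≠ 1 := by
  rintro rfl
  rw [isPrimitive_def, conductor_one] at hχ
  omega

theorem expGrowth_LFunction {N : ℕ} [NeZero N] {χ : DirichletCharacter ℂ N} (hχ : χ ≠ 1) {b c : ℝ}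
    (hc : c < 2) : ExpGrowth χ.LFunction b c := by
  obtain ⟨C, h0, hC⟩ := ExpGrowth.indicator_LFunction (b := b) χ hc
  refine ExpGrowth.of_one_le_abs_im (fun z _ _ => (differentiable_LFunction hχ z).continuousAt)
    ⟨C, h0, fun z h1 h2 h3 => ?_⟩
  have := hC z h1 h2
  rwa [indicator_of_mem (show z ∈ farFromReal from h3)] at this

end DirichletCharacter

open Classical in
/-- `∑ τ(χ̄) L(w, χ)²`, over the even primitive characters modulo `q`. -/
noncomputable def evenPrimitiveTwist (q : ℕ) [NeZero q] (w : ℂ) : ℂ :=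
  ∑ χ : DirichletCharacter ℂ q with χ.IsPrimitive ∧ χ.Even, tau χ⁻¹ * χ.LFunction w ^ 2

theorem differentiable_evenPrimitiveTwist {q : ℕ} [NeZero q] (hq : 1 < q) :
    Differentiable ℂ (evenPrimitiveTwist q) := by
  classical
  unfold evenPrimitiveTwist
  refine Differentiable.fun_sum fun χ hχ => ?_
  exact ((DirichletCharacter.differentiable_LFunction
    (DirichletCharacter.ne_one_of_isPrimitive hq
      (Finset.mem_filter.mp hχ).2.1)).pow 2).const_mul _

theorem expGrowth_evenPrimitiveTwist {q : ℕ} [NeZero q] (hq : 1 < q) {b c : ℝ} (hc : c < 2) :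
    ExpGrowth (evenPrimitiveTwist q) b c := by
  classical
  unfold evenPrimitiveTwist
  refine ExpGrowth.sum _ fun χ hχ => ?_
  exact (ExpGrowth.const _).mul ((DirichletCharacter.expGrowth_LFunction
    (DirichletCharacter.ne_one_of_isPrimitive hq
      (Finset.mem_filter.mp hχ).2.1) hc).pow 2)

/-- The functional equation of the `L`-function of an even primitive character. -/
theorem LFunction_one_sub_of_isPrimitive_of_even {q : ℕ} [NeZero q]
    {χ : DirichletCharacter ℂ q} (hq : 1 < q) (hχ : χ.IsPrimitive) (he : χ.Even) {s : ℂ}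
    (hs : 0 < s.re) :
    χ.LFunction (1 - s) = (q : ℂ) ^ (s - 1) * tau χ * (Gammaℂ s * Complex.cos (Real.pi * s / 2)) *
      χ⁻¹.LFunction s := by
  have he' : χ⁻¹.Even := by
    have : χ⁻¹ (-1) = 1 := by
      rw [← MulChar.star_apply', he]; simp
    exact this
  have hq0 : (q : ℂ) ≠ 0 := Nat.cast_ne_zero.mpr (NeZero.ne q)
  rw [DirichletCharacter.LFunction_eq_completed_div_gammaFactor χ _ (Or.inr (by omega)),
    DirichletCharacter.LFunction_eq_completed_div_gammaFactor χ⁻¹ _ (Or.inr (by omega)),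
    he.gammaFactor_def, he'.gammaFactor_def, hχ.completedLFunction_one_sub, div_eq_mul_inv,
    inv_Gammaℝ_one_sub (fun n h => by rw [h] at hs; simp at hs; linarith [(n.cast_nonneg : (0:ℝ) ≤ n)]),
    DirichletCharacter.rootNumber, if_pos he, pow_zero, div_one]
  have e : (q : ℂ) ^ (s - 1 / 2) * (gaussSum χ ZMod.stdAddChar / (q : ℂ) ^ (1 / 2 : ℂ)) =
      (q : ℂ) ^ (s - 1) * tau χ := by
    rw [tau, show s - 1 = s - 1 / 2 - 1 / 2 by ring, cpow_sub (s - 1 / 2) (1 / 2) hq0]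
    ring
  rw [e]
  ring

theorem even_inv_iff {q : ℕ} {χ : DirichletCharacter ℂ q} : χ⁻¹.Even ↔ χ.Even := by
  have h : ∀ χ : DirichletCharacter ℂ q, χ.Even → χ⁻¹.Even := by
    intro χ he
    have : χ⁻¹ (-1) = 1 := by
      rw [MulChar.inv_apply, show Ring.inverse (-1 : ZMod q) = -1 from by
        simpa using Ring.inverse_unit (-1 : (ZMod q)ˣ)]
      exact he
    exact this
  exact ⟨fun he => by simpa using h _ he, h χ⟩

theorem isPrimitive_inv_iff {q : ℕ} {χ : DirichletCharacter ℂ q} :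
    χ⁻¹.IsPrimitive ↔ χ.IsPrimitive := by
  rw [DirichletCharacter.isPrimitive_def, DirichletCharacter.conductor_inv,
    DirichletCharacter.isPrimitive_def]

/-- The functional equation of `evenPrimitiveTwist`. -/
theorem evenPrimitiveTwist_one_sub {q : ℕ} [NeZero q] (hq : 1 < q) {s : ℂ} (hs : 0 < s.re) :
    evenPrimitiveTwist q (1 - s) = (q : ℂ) ^ (2 * s - 1) *
      (Gammaℂ s * Complex.cos (Real.pi * s / 2)) ^ 2 * evenPrimitiveTwist q s := by
  classical
  have hq0 : (q : ℂ) ≠ 0 := Nat.cast_ne_zero.mpr (NeZero.ne q)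
  -- Reindexing by `χ ↦ χ⁻¹` matches the dual L-functions. Then `τ(χ̄) τ(χ)² = q τ(χ)` absorbs the
  -- root number, so that all characters share one functional equation.
  have h1 : evenPrimitiveTwist q s =
      ∑ χ : DirichletCharacter ℂ q with χ.IsPrimitive ∧ χ.Even, tau χ * χ⁻¹.LFunction s ^ 2 := by
    rw [evenPrimitiveTwist, Finset.sum_filter, Finset.sum_filter, ← Equiv.sum_comp (Equiv.inv _)]
    refine Finset.sum_congr rfl fun χ _ => ?_
    simp only [Equiv.inv_apply, isPrimitive_inv_iff, even_inv_iff, inv_inv]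
  rw [h1, evenPrimitiveTwist, Finset.mul_sum]
  refine Finset.sum_congr rfl fun χ hχ => ?_
  obtain ⟨hp, he⟩ := (Finset.mem_filter.mp hχ).2
  rw [LFunction_one_sub_of_isPrimitive_of_even hq hp he hs]
  have h2 := hp.tau_mul_tau_inv
  have he' : χ (-1) = 1 := he
  rw [he', mul_one] at h2
  have h3 : (q : ℂ) ^ (2 * s - 1) = (q : ℂ) ^ (s - 1) * (q : ℂ) ^ (s - 1) * q := by
    rw [← cpow_add _ _ hq0]
    nth_rewrite 3 [← cpow_one (q : ℂ)]
    rw [← cpow_add _ _ hq0]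
    congr 1; ring
  rw [h3]
  linear_combination ((q : ℂ) ^ (s - 1) * (q : ℂ) ^ (s - 1) *
    (Gammaℂ s * Complex.cos (Real.pi * s / 2)) ^ 2 * tau χ * χ⁻¹.LFunction s ^ 2) * h2

theorem Gammaℂ_one_half_mul_cos : Gammaℂ (1 / 2) * Complex.cos (Real.pi * (1 / 2) / 2) = 1 := by
  rw [← Gammaℝ_div_Gammaℝ_one_sub (fun n h => by
    have := congrArg Complex.re h
    simp at this
    linarith [(n.cast_nonneg : (0:ℝ) ≤ n)]), show (1 : ℂ) - 1 / 2 = 1 / 2 by norm_num]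
  exact div_self (Gammaℝ_ne_zero_of_re_pos (by norm_num))

/-- Multiplying the functional equation at `1/2` by `τ(χ̄)` gives `τ(χ̄) L = √q · conj L`, hence
`τ(χ̄) L² = √q |L|²` for each character. -/
theorem sqrt_mul_evenPrimitiveMeanSquare {q : ℕ} [NeZero q] (hq : 1 < q) :
    (Real.sqrt q : ℂ) * evenPrimitiveMeanSquare q = evenPrimitiveTwist q (1 / 2) := by
  classical
  rw [evenPrimitiveMeanSquare, evenPrimitiveTwist, ofReal_sum, Finset.mul_sum]
  refine Finset.sum_congr rfl fun χ hχ => ?_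
  obtain ⟨hp, he⟩ := (Finset.mem_filter.mp hχ).2
  have h1 := LFunction_one_sub_of_isPrimitive_of_even hq hp he (s := 1 / 2) (by norm_num)
  rw [show (1 : ℂ) - 1 / 2 = 1 / 2 by norm_num, Gammaℂ_one_half_mul_cos, mul_one,
    DirichletCharacter.LFunction_inv_conj
      (DirichletCharacter.ne_one_of_isPrimitive hq hp)] at h1
  have hconj : (starRingEnd ℂ) (1 / 2 : ℂ) = 1 / 2 := by rw [map_div₀, map_one, map_ofNat]
  rw [hconj] at h1
  have h2 := hp.tau_mul_tau_inv
  have he' : χ (-1) = 1 := he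
  rw [he', mul_one] at h2
  have h3 : (q : ℂ) ^ ((1 / 2 : ℂ) - 1) * q = (Real.sqrt q : ℂ) := by
    have hq0 : (q : ℂ) ≠ 0 := Nat.cast_ne_zero.mpr (NeZero.ne q)
    rw [Real.sqrt_eq_rpow, ofReal_cpow (Nat.cast_nonneg q)]
    nth_rewrite 2 [← cpow_one (q : ℂ)]
    rw [← cpow_add _ _ hq0]
    push_cast
    congr 1; norm_num
  have h4 : ((‖χ.LFunction (1 / 2)‖ ^ 2 : ℝ) : ℂ) =
      χ.LFunction (1 / 2) * (starRingEnd ℂ) (χ.LFunction (1 / 2)) := by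
    rw [Complex.mul_conj, Complex.normSq_eq_norm_sq]
  set Lc := (starRingEnd ℂ) (χ.LFunction (1 / 2))
  set L := χ.LFunction (1 / 2)
  rw [h4]
  linear_combination (-(L * Lc)) * h3 - ((q : ℂ) ^ ((1 / 2 : ℂ) - 1) * Lc * L) * h2 -
    tau χ⁻¹ * L * h1

/-! ### Decomposition over coprime factorisations -/

/-- The contribution of the factorisation `x` to `evenPrimitiveTwist`. -/
noncomputable def factorTwist (q : ℕ) [NeZero q] (x : ℕ × ℕ) (w : ℂ) : ℂ :=
  open Classical in
  ((ArithmeticFunction.moebius x.1 : ℤ) : ℂ) *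
    ∑ χ : DirichletCharacter ℂ q with χ.conductor ∣ x.2,
      tau χ⁻¹ * ((1 + χ (-1)) / 2 * χ.LFunction w ^ 2)

theorem evenPrimitiveTwist_eq_sum (q : ℕ) [NeZero q] (w : ℂ) :
    evenPrimitiveTwist q w =
      ∑ x ∈ q.divisorsAntidiagonal with Nat.Coprime x.1 x.2, factorTwist q x w := by
  classical
  have h := DirichletCharacter.sum_filter_isPrimitive_tau
    (fun χ : DirichletCharacter ℂ q => (1 + χ (-1)) / 2 * χ.LFunction w ^ 2)
  unfold factorTwist
  refine Eq.trans ?_ (h.trans ?_)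
  · rw [evenPrimitiveTwist, Finset.sum_filter, Finset.sum_filter]
    refine Finset.sum_congr rfl fun χ _ => ?_
    rcases χ.even_or_odd with he | ho
    · have he' : χ (-1) = 1 := he
      simp only [he, and_true, he']
      norm_num
    · have ho' : χ (-1) = -1 := ho
      simp [ho.not_even, ho']
  · exact Finset.sum_congr rfl fun x _ => by congr

/-- The parity projector `(1 + ψ(-1)) / 2` becomes the average over the two twists `± c̄`. -/
theorem factorTwist_eq {c d : ℕ} [NeZero c] [NeZero d] [NeZero (c * d)] (h : Nat.Coprime c d) (w : ℂ) :
    factorTwist (c * d) (c, d) w = ((ArithmeticFunction.moebius c : ℤ) : ℂ) ^ 2 * d.totient *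
      ((twistedSquare (Dvd.intro_left c rfl : d ∣ c * d) (c : ZMod d)⁻¹ w +
        twistedSquare (Dvd.intro_left c rfl : d ∣ c * d) (-(c : ZMod d)⁻¹) w) / 2) := by
  classical
  have hphi : (d.totient : ℂ) ≠ 0 :=
    Nat.cast_ne_zero.mpr (Nat.totient_pos.mpr (NeZero.pos d)).ne'
  rw [factorTwist, twistedSquare, twistedSquare]
  have h2 := DirichletCharacter.sum_filter_conductor_dvd_tau h
    (fun χ => (1 + χ (-1)) / 2 * χ.LFunction w ^ 2)
  dsimp only
  refine Eq.trans (congrArg _ (Eq.trans (by congr) h2)) ?_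
  rw [← mul_add, ← Finset.sum_add_distrib]
  have h3 : ∀ ψ : DirichletCharacter ℂ d, tau ψ⁻¹ * ψ (c : ZMod d)⁻¹ *
      ((1 + DirichletCharacter.changeLevel (Dvd.intro_left c rfl : d ∣ c * d) ψ (-1)) / 2 *
      (DirichletCharacter.changeLevel (Dvd.intro_left c rfl : d ∣ c * d) ψ).LFunction w ^ 2) =
      (tau ψ⁻¹ * ψ (c : ZMod d)⁻¹ *
      (DirichletCharacter.changeLevel (Dvd.intro_left c rfl : d ∣ c * d) ψ).LFunction w ^ 2 +
      tau ψ⁻¹ * ψ (-(c : ZMod d)⁻¹) *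
      (DirichletCharacter.changeLevel (Dvd.intro_left c rfl : d ∣ c * d) ψ).LFunction w ^ 2) * (1 / 2) := by
    intro ψ
    rw [DirichletCharacter.changeLevel_apply_of_isUnit _ _ isUnit_one.neg,
      ← neg_one_mul (c : ZMod d)⁻¹, map_mul ψ]
    simp only [map_neg, map_one]
    ring
  simp_rw [h3]
  rw [← Finset.sum_mul]
  field_simp

theorem evenTwistedSum_eq {q k M : ℕ} [NeZero q] [NeZero k] (h : k ∣ q) (hM : Nat.Coprime M k) :
    evenTwistedSum q k M = k.totient * ((twistedSquare h (M : ZMod k)⁻¹ (1 / 2) +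
        twistedSquare h (-(M : ZMod k)⁻¹) (1 / 2)) / 2) := by
  classical
  have hphi : (k.totient : ℂ) ≠ 0 :=
    Nat.cast_ne_zero.mpr (Nat.totient_pos.mpr (NeZero.pos k)).ne'
  rw [evenTwistedSum, dif_neg (NeZero.ne k), twistedSquare, twistedSquare, ← mul_add,
    ← Finset.sum_add_distrib, Finset.sum_filter]
  have h3 : ∀ ψ : DirichletCharacter ℂ k, (if ψ.Even then
      tau ψ⁻¹ * ψ⁻¹ (M : ZMod k) * coprimeLFunction q ψ (1 / 2) ^ 2 else 0) =
      (tau ψ⁻¹ * ψ (M : ZMod k)⁻¹ *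
      (DirichletCharacter.changeLevel h ψ).LFunction (1 / 2) ^ 2 +
      tau ψ⁻¹ * ψ (-(M : ZMod k)⁻¹) *
      (DirichletCharacter.changeLevel h ψ).LFunction (1 / 2) ^ 2) * (1 / 2) := by
    intro ψ
    obtain ⟨u, hu⟩ : IsUnit (M : ZMod k) := (ZMod.isUnit_iff_coprime M k).mpr hM
    have h4 : ψ⁻¹ (M : ZMod k) = ψ (M : ZMod k)⁻¹ := by
      rw [← hu, MulChar.inv_apply, Ring.inverse_unit, ZMod.inv_coe_unit]
    rw [coprimeLFunction_eq_changeLevel h ψ (by norm_num), h4, ← neg_one_mul (M : ZMod k)⁻¹, map_mul ψ]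
    rcases ψ.even_or_odd with he | ho
    · have he' : ψ (-1) = 1 := he
      rw [if_pos he, he']; ring
    · have ho' : ψ (-1) = -1 := ho
      rw [if_neg ho.not_even, ho']; ring
  simp only [h3]
  rw [← Finset.sum_mul]
  field_simp

/-! ### Polar part of the twisted squares at `1`, and their Dirichlet series -/

/-- `(w - 1)² twistedSquare h b w`, as an entire function of `w`. -/
noncomputable def twistedSquareHat {q k : ℕ} [NeZero q] [NeZero k] (h : k ∣ q) (b : ZMod k) (w : ℂ) : ℂ :=
  1 / (k.totient : ℂ) * ∑ ψ : DirichletCharacter ℂ k,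
    tau ψ⁻¹ * ψ b * (DirichletCharacter.changeLevel h ψ).LFunctionHat w ^ 2

theorem changeLevel_natCast {q k : ℕ} (h : k ∣ q) (ψ : DirichletCharacter ℂ k) (n : ℕ) :
    DirichletCharacter.changeLevel h ψ (n : ZMod q) = if n.Coprime q then ψ (n : ZMod k) else 0 := by
  split_ifs with hn
  · have hu : IsUnit (n : ZMod q) := (ZMod.isUnit_iff_coprime n q).mpr hn
    rw [DirichletCharacter.changeLevel_apply_of_isUnit h ψ hu, map_natCast]
  · exact MulChar.map_nonunit _ fun hu => hn ((ZMod.isUnit_iff_coprime n q).mp hu)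

section twistedSquare

variable {q k : ℕ} [NeZero q] [NeZero k] (h : k ∣ q) (b : ZMod k)

theorem twistedSquareHat_of_ne_one {w : ℂ} (hw : w ≠ 1) :
    twistedSquareHat h b w = (w - 1) ^ 2 * twistedSquare h b w := by
  rw [twistedSquareHat, twistedSquare, Finset.mul_sum, Finset.mul_sum, Finset.mul_sum]
  refine Finset.sum_congr rfl fun ψ _ => ?_
  rw [DirichletCharacter.LFunctionHat_of_ne_one _ hw]
  ring

theorem differentiable_twistedSquareHat : Differentiable ℂ (twistedSquareHat h b) := by
  unfold twistedSquareHat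
  refine Differentiable.const_mul (Differentiable.fun_sum fun ψ _ => ?_) _
  exact ((DirichletCharacter.differentiable_LFunctionHat _).pow 2).const_mul _

theorem expGrowth_twistedSquareHat {a c : ℝ} (hc : c < 2) : ExpGrowth (twistedSquareHat h b) a c := by
  unfold twistedSquareHat
  refine (ExpGrowth.const _).mul (ExpGrowth.sum _ fun ψ _ => ?_)
  exact (ExpGrowth.const _).mul ((DirichletCharacter.expGrowth_LFunctionHat _ hc).pow 2)

theorem DirichletCharacter.tau_one (k : ℕ) [NeZero k] :
    tau (1 : DirichletCharacter ℂ k) = ((ArithmeticFunction.moebius k : ℤ) : ℂ) := by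
  classical
  rw [← sum_units_stdAddChar_unit k isUnit_one, tau, gaussSum]
  refine Finset.sum_congr rfl fun a _ => ?_
  split_ifs with ha
  · rw [MulChar.one_apply ha, one_mul, mul_one]
  · rw [MulChar.map_nonunit _ ha, zero_mul]

theorem LFunctionTrivChar₁_one (q : ℕ) [NeZero q] :
    DirichletCharacter.LFunctionTrivChar₁ q 1 = (q.totient : ℂ) / q := by
  have hq0 : (q : ℂ) ≠ 0 := Nat.cast_ne_zero.mpr (NeZero.ne q)
  rw [DirichletCharacter.LFunctionTrivChar₁, Function.update_self, eq_div_iff hq0]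
  have := Nat.totient_eq_mul_prod_factors q
  have h2 := congrArg (Rat.cast : ℚ → ℂ) this
  push_cast at h2
  rw [h2]; ring

theorem hasDerivAt_LFunctionTrivChar₁_one_level :
    HasDerivAt (DirichletCharacter.LFunctionTrivChar₁ 1) Real.eulerMascheroniConstant 1 := by
  rw [hasDerivAt_iff_tendsto_slope]
  refine tendsto_riemannZeta_sub_one_div.congr' ?_
  filter_upwards [self_mem_nhdsWithin] with s hs
  have hs : s ≠ 1 := hs
  have hs' : s - 1 ≠ 0 := sub_ne_zero.mpr hs
  rw [slope_def_field, DirichletCharacter.LFunctionTrivChar₁, Function.update_self,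
    Function.update_of_ne hs]
  simp only [Nat.primeFactors_one, Finset.prod_empty]
  rw [DirichletCharacter.LFunctionTrivChar, DirichletCharacter.LFunction_modOne_eq]
  field_simp

theorem LFunctionTrivChar₁_eq_mul_prod (q : ℕ) [NeZero q] (s : ℂ) :
    DirichletCharacter.LFunctionTrivChar₁ q s = DirichletCharacter.LFunctionTrivChar₁ 1 s *
      ∏ p ∈ q.primeFactors, (1 - (p : ℂ) ^ (-s)) := by
  by_cases hs : s = 1
  · rw [hs, DirichletCharacter.LFunctionTrivChar₁, DirichletCharacter.LFunctionTrivChar₁,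
      Function.update_self, Function.update_self]
    simp [cpow_neg_one]
  · rw [DirichletCharacter.LFunctionTrivChar₁, DirichletCharacter.LFunctionTrivChar₁,
      Function.update_of_ne hs, Function.update_of_ne hs,
      DirichletCharacter.LFunctionTrivChar_eq_mul_riemannZeta hs,
      DirichletCharacter.LFunctionTrivChar_eq_mul_riemannZeta hs]
    simp
    ring

/-- Source of the arithmetic constants of the main term: Euler's constant from the Laurent expansion
of zeta, and `log p / (p - 1)` as logarithmic derivative of `1 - p^(-s)` at `1`. -/
theorem hasDerivAt_LFunctionTrivChar₁ (q : ℕ) [NeZero q] :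
    HasDerivAt (DirichletCharacter.LFunctionTrivChar₁ q) ((q.totient : ℂ) / q *
      (Real.eulerMascheroniConstant +
        ∑ p ∈ q.primeFactors, (Real.log p : ℂ) / ((p : ℂ) - 1))) 1 := by
  have hfun : DirichletCharacter.LFunctionTrivChar₁ q = fun s =>
      DirichletCharacter.LFunctionTrivChar₁ 1 s * ∏ p ∈ q.primeFactors, (1 - (p : ℂ) ^ (-s)) :=
    funext (LFunctionTrivChar₁_eq_mul_prod q)
  have hp0 : ∀ p ∈ q.primeFactors, (p : ℂ) ≠ 0 ∧ (p : ℂ) - 1 ≠ 0 := fun p hp => by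
    have := Nat.prime_of_mem_primeFactors hp
    refine ⟨Nat.cast_ne_zero.mpr this.ne_zero, sub_ne_zero.mpr ?_⟩
    exact_mod_cast this.ne_one
  have hfac : ∀ p ∈ q.primeFactors, HasDerivAt (fun s : ℂ => 1 - (p : ℂ) ^ (-s))
      ((p : ℂ)⁻¹ * Real.log p) 1 := by
    intro p hp
    have h1 := ((hasDerivAt_id (1 : ℂ)).neg.const_cpow (c := (p : ℂ)) (Or.inl (hp0 p hp).1)).const_sub 1
    refine h1.congr_deriv ?_
    simp [cpow_neg_one]
  have hprod := HasDerivAt.fun_finsetProd hfac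
  have h1 : DirichletCharacter.LFunctionTrivChar₁ 1 1 = 1 := by
    rw [LFunctionTrivChar₁_one]; simp
  have hmul := hasDerivAt_LFunctionTrivChar₁_one_level.mul hprod
  have hval : ∏ p ∈ q.primeFactors, (1 - (p : ℂ) ^ (-(1 : ℂ))) = (q.totient : ℂ) / q := by
    rw [← LFunctionTrivChar₁_one, LFunctionTrivChar₁_eq_mul_prod q 1, h1, one_mul]
  rw [hfun]
  refine hmul.congr_deriv ?_
  rw [h1, hval, one_mul, mul_add, mul_comm, Finset.mul_sum]
  congr 1
  refine Finset.sum_congr rfl fun p hp => ?_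
  have h2 := Finset.mul_prod_erase q.primeFactors (fun p : ℕ => 1 - (p : ℂ) ^ (-(1 : ℂ))) hp
  rw [← hval, ← h2, cpow_neg_one, smul_eq_mul]
  obtain ⟨e1, e2⟩ := hp0 p hp
  field_simp

/-- For `ψ ≠ 1` the function `LFunctionHat` vanishes at `1`, so its square vanishes doubly. Only the
trivial character remains, and its Gauss sum is `μ(k)`. -/
theorem hasDerivAt_twistedSquareHat {b : ZMod k} (hb : IsUnit b) :
    HasDerivAt (twistedSquareHat h b) (((ArithmeticFunction.moebius k : ℤ) : ℂ) / k.totient *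
      (2 * ((q.totient : ℂ) / q) ^ 2 * (Real.eulerMascheroniConstant +
        ∑ p ∈ q.primeFactors, (Real.log p : ℂ) / ((p : ℂ) - 1)))) 1 := by
  classical
  have h1 : ∀ ψ : DirichletCharacter ℂ k, HasDerivAt (fun w => tau ψ⁻¹ * ψ b *
      (DirichletCharacter.changeLevel h ψ).LFunctionHat w ^ 2)
      (if ψ = 1 then ((ArithmeticFunction.moebius k : ℤ) : ℂ) *
      (2 * ((q.totient : ℂ) / q) ^ 2 * (Real.eulerMascheroniConstant +
        ∑ p ∈ q.primeFactors, (Real.log p : ℂ) / ((p : ℂ) - 1))) else 0) 1 := by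
    intro ψ
    split_ifs with hψ
    · subst hψ
      rw [map_one, DirichletCharacter.LFunctionHat_one_eq, inv_one, DirichletCharacter.tau_one,
        MulChar.one_apply hb, mul_one]
      refine (((hasDerivAt_LFunctionTrivChar₁ q).pow 2).const_mul _).congr_deriv ?_
      rw [LFunctionTrivChar₁_one]
      push_cast
      ring
    · have hψ' : DirichletCharacter.changeLevel h ψ ≠ 1 := fun h' =>
        hψ ((DirichletCharacter.changeLevel_eq_one_iff h).mp h')
      have h2 := ((DirichletCharacter.changeLevel h ψ).differentiable_LFunctionHat 1).hasDerivAt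
      refine ((h2.pow 2).const_mul (tau ψ⁻¹ * ψ b)).congr_deriv ?_
      rw [DirichletCharacter.LFunctionHat_eq_of_ne_one _ hψ']
      simp
  have h2 := (HasDerivAt.fun_sum fun ψ (_ : ψ ∈ Finset.univ) => h1 ψ).const_mul (1 / (k.totient : ℂ))
  refine h2.congr_deriv ?_
  rw [Finset.sum_ite_eq']
  simp only [Finset.mem_univ, if_true]
  ring

theorem twistedSquareHat_one {b : ZMod k} (hb : IsUnit b) :
    twistedSquareHat h b 1 = ((ArithmeticFunction.moebius k : ℤ) : ℂ) / k.totient *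
      ((q.totient : ℂ) / q) ^ 2 := by
  classical
  rw [twistedSquareHat, Finset.sum_eq_single 1]
  · rw [map_one, DirichletCharacter.LFunctionHat_one_eq, inv_one, DirichletCharacter.tau_one,
        MulChar.one_apply hb, mul_one, LFunctionTrivChar₁_one]
    ring
  · intro ψ _ hψ
    have hψ' : DirichletCharacter.changeLevel h ψ ≠ 1 := fun h' =>
      hψ ((DirichletCharacter.changeLevel_eq_one_iff h).mp h')
    rw [DirichletCharacter.LFunctionHat_eq_of_ne_one _ hψ']
    simp
  · simp

/-- `e(b n / k)` if `n` is coprime to `q`, and zero otherwise. -/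
noncomputable def coprimeStdAddChar (q : ℕ) {k : ℕ} [NeZero k] (b : ZMod k) (n : ℕ) : ℂ :=
  if n.Coprime q then ZMod.stdAddChar (b * (n : ZMod k)) else 0

theorem norm_coprimeStdAddChar_le (q : ℕ) {k : ℕ} [NeZero k] (b : ZMod k) (n : ℕ) :
    ‖coprimeStdAddChar q b n‖ ≤ 1 := by
  unfold coprimeStdAddChar
  split_ifs
  · rw [AddChar.norm_apply]
  · simp

theorem summable_norm_natCast_cpow {w : ℂ} (hw : 1 < w.re) :
    Summable fun n : ℕ => ‖(n : ℂ) ^ (-w)‖ := by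
  have h := Real.summable_nat_rpow.mpr (show -w.re < -1 by linarith)
  refine h.congr fun n => ?_
  rcases Nat.eq_zero_or_pos n with rfl | hn
  · have : w ≠ 0 := by rintro rfl; simp at hw; linarith
    simp [this, Real.zero_rpow (show -w.re ≠ 0 by linarith)]
  · rw [Complex.norm_natCast_cpow_of_pos hn, neg_re]

theorem summable_norm_prod_natCast_cpow {w : ℂ} (hw : 1 < w.re) :
    Summable fun x : ℕ × ℕ => ‖((x.1 * x.2 : ℕ) : ℂ) ^ (-w)‖ := by
  have h := (summable_norm_natCast_cpow hw).mul_of_nonneg (summable_norm_natCast_cpow hw)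
    (fun _ => norm_nonneg _) (fun _ => norm_nonneg _)
  refine h.congr fun x => ?_
  rw [← norm_mul]
  push_cast
  rw [natCast_mul_natCast_cpow]

/-- The Dirichlet series of `twistedSquare` in the region of absolute convergence. -/
theorem twistedSquare_eq_tsum {b : ZMod k} (hb : IsUnit b) {w : ℂ} (hw : 1 < w.re) :
    twistedSquare h b w = ∑' x : ℕ × ℕ, coprimeStdAddChar q b (x.1 * x.2) *
      ((x.1 * x.2 : ℕ) : ℂ) ^ (-w) := by
  classical
  have hphi : (k.totient : ℂ) ≠ 0 :=
    Nat.cast_ne_zero.mpr (Nat.totient_pos.mpr (NeZero.pos k)).ne'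
  have hw0 : w ≠ 0 := by rintro rfl; simp at hw; linarith
  have hs : ∀ χ : DirichletCharacter ℂ q, Summable fun n : ℕ => ‖χ (n : ZMod q) * (n : ℂ) ^ (-w)‖ :=
    fun χ => Summable.of_nonneg_of_le (fun _ => norm_nonneg _) (fun n => by
      rw [norm_mul]
      exact mul_le_of_le_one_left (norm_nonneg _) (DirichletCharacter.norm_le_one χ _))
      (summable_norm_natCast_cpow hw)
  have hL : ∀ χ : DirichletCharacter ℂ q, χ.LFunction w ^ 2 = ∑' x : ℕ × ℕ,
      (χ (x.1 : ZMod q) * (x.1 : ℂ) ^ (-w)) * (χ (x.2 : ZMod q) * (x.2 : ℂ) ^ (-w)) := by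
    intro χ
    have h1 : χ.LFunction w = ∑' n : ℕ, χ (n : ZMod q) * (n : ℂ) ^ (-w) := by
      rw [DirichletCharacter.LFunction_eq_LSeries _ hw, LSeries]
      congr 1
      ext n
      rcases eq_or_ne n 0 with rfl | hn
      · simp [hw0]
      · rw [LSeries.term_of_ne_zero hn, cpow_neg, div_eq_mul_inv]
    rw [pow_two, h1, tsum_mul_tsum_of_summable_norm (hs χ) (hs χ)]
  have hsum : ∀ ψ : DirichletCharacter ℂ k, Summable fun x : ℕ × ℕ => tau ψ⁻¹ * ψ b *
      ((DirichletCharacter.changeLevel h ψ (x.1 : ZMod q) * (x.1 : ℂ) ^ (-w)) *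
        (DirichletCharacter.changeLevel h ψ (x.2 : ZMod q) * (x.2 : ℂ) ^ (-w))) := fun ψ =>
    (summable_mul_of_summable_norm (hs _) (hs _)).mul_left _
  rw [twistedSquare]
  simp_rw [hL, ← tsum_mul_left]
  rw [← Summable.tsum_finsetSum fun ψ _ => hsum ψ, ← tsum_mul_left]
  congr 1
  ext x
  rw [Nat.cast_mul, natCast_mul_natCast_cpow, coprimeStdAddChar]
  simp only [changeLevel_natCast]
  by_cases h1 : x.1.Coprime q
  · by_cases h2 : x.2.Coprime q
    · rw [if_pos (Nat.Coprime.mul_left h1 h2)]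
      simp_rw [if_pos h1, if_pos h2]
      have h3 := sum_tau_inv_mul k (b * ((x.1 * x.2 : ℕ) : ZMod k))
      have hu : IsUnit (b * ((x.1 * x.2 : ℕ) : ZMod k)) := hb.mul
        ((ZMod.isUnit_iff_coprime _ k).mpr ((Nat.Coprime.mul_left h1 h2).of_dvd_right h))
      rw [if_pos hu] at h3
      have h4 : ∀ ψ : DirichletCharacter ℂ k, tau ψ⁻¹ * ψ b * (ψ (x.1 : ZMod k) * (x.1 : ℂ) ^ (-w) *
          (ψ (x.2 : ZMod k) * (x.2 : ℂ) ^ (-w))) = tau ψ⁻¹ * ψ (b * ((x.1 * x.2 : ℕ) : ZMod k)) *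
          ((x.1 : ℂ) ^ (-w) * (x.2 : ℂ) ^ (-w)) := by
        intro ψ
        push_cast
        rw [map_mul, map_mul]; ring
      simp_rw [h4]
      rw [← Finset.sum_mul, h3]
      push_cast
      field_simp
    · rw [if_neg fun h' => h2 (Nat.Coprime.coprime_mul_left h')]
      simp [h2]
  · rw [if_neg fun h' => h1 (Nat.Coprime.coprime_mul_right h')]
    simp [h1]

end twistedSquare

/-! ### Rapid decay and convolution along vertical lines -/

/-- Decay faster than any exponential in the imaginary direction, uniformly on a vertical strip. -/
def RapidDecay (k : ℂ → ℂ) (a b : ℝ) : Prop :=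
  ∀ A : ℝ, ∃ C : ℝ, 0 ≤ C ∧ ∀ z : ℂ, a ≤ z.re → z.re ≤ b → ‖k z‖ ≤ C * Real.exp (-(A * |z.im|))

/-- `|exp (z²)| = exp (x² - y²)` is Gaussian in `y`; the term `(A + C)²` in the constant comes from
completing the square. -/
theorem ExpGrowth.mul_exp_sq {f : ℂ → ℂ} {a b : ℝ} (hf : ExpGrowth f a b) :
    RapidDecay (fun z => f z * cexp (z ^ 2)) a b := by
  obtain ⟨C, h0, hC⟩ := hf
  intro A
  refine ⟨C * Real.exp (a ^ 2 + b ^ 2 + (A + C) ^ 2), by positivity, fun z h1 h2 => ?_⟩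
  have e := norm_exp_mul_sq 1 z
  rw [ofReal_one, one_mul, one_mul] at e
  rw [norm_mul, e]
  calc ‖f z‖ * Real.exp (z.re ^ 2 - z.im ^ 2)
      ≤ C * Real.exp (C * |z.im|) * Real.exp (z.re ^ 2 - z.im ^ 2) := by
        gcongr; exact hC z h1 h2
    _ = C * Real.exp (C * |z.im| + (z.re ^ 2 - z.im ^ 2)) := by rw [mul_assoc, ← Real.exp_add]
    _ ≤ C * Real.exp ((a ^ 2 + b ^ 2 + (A + C) ^ 2) + -(A * |z.im|)) := by
        refine mul_le_mul_of_nonneg_left (Real.exp_le_exp.mpr ?_) h0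
        have hre : z.re ^ 2 ≤ a ^ 2 + b ^ 2 := by
          rcases le_total 0 z.re with h | h <;> nlinarith [sq_nonneg a, sq_nonneg b]
        have him : z.im ^ 2 = |z.im| ^ 2 := (sq_abs _).symm
        nlinarith [sq_nonneg (|z.im| - (A + C)), sq_nonneg (|z.im|), sq_nonneg (A + C)]
    _ = _ := by rw [Real.exp_add, mul_assoc]

namespace RapidDecay

variable {k : ℂ → ℂ} {a b : ℝ}

theorem expGrowth (hk : RapidDecay k a b) : ExpGrowth k a b := by
  obtain ⟨C, h0, hC⟩ := hk 0
  exact ExpGrowth.of_bounded (K := C) fun z h1 h2 => by simpa using hC z h1 h2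

theorem mul_expGrowth {f : ℂ → ℂ} (hk : RapidDecay k a b) (hf : ExpGrowth f a b) :
    RapidDecay (fun z => k z * f z) a b := by
  intro A
  obtain ⟨D, h1, hD⟩ := hf
  obtain ⟨C, h0, hC⟩ := hk (A + D)
  refine ⟨C * D, by positivity, fun z hz1 hz2 => ?_⟩
  rw [norm_mul]
  calc _ ≤ C * Real.exp (-((A + D) * |z.im|)) * (D * Real.exp (D * |z.im|)) := by
        gcongr
        · exact hC z hz1 hz2
        · exact hD z hz1 hz2
    _ = C * D * (Real.exp (-((A + D) * |z.im|)) * Real.exp (D * |z.im|)) := by ring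
    _ = _ := by rw [← Real.exp_add]; congr 2; ring

theorem congr {l : ℂ → ℂ} (hk : RapidDecay k a b)
    (h : ∀ z : ℂ, a ≤ z.re → z.re ≤ b → l z = k z) : RapidDecay l a b := fun A => by
  obtain ⟨C, h0, hC⟩ := hk A
  exact ⟨C, h0, fun z h1 h2 => by rw [h z h1 h2]; exact hC z h1 h2⟩

theorem mono {a' b' : ℝ} (hk : RapidDecay k a b) (ha : a ≤ a') (hb : b' ≤ b) :
    RapidDecay k a' b' := fun A => by
  obtain ⟨C, h0, hC⟩ := hk A
  exact ⟨C, h0, fun z h1 h2 => hC z (ha.trans h1) (h2.trans hb)⟩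

theorem comp_add_const (hk : RapidDecay k a b) (c : ℝ) :
    RapidDecay (fun z => k (z + c)) (a - c) (b - c) := fun A => by
  obtain ⟨C, h0, hC⟩ := hk A
  refine ⟨C, h0, fun z h1 h2 => ?_⟩
  simpa using hC (z + c) (by simp; linarith) (by simp; linarith)

theorem comp_const_sub (hk : RapidDecay k a b) (c : ℂ) :
    RapidDecay (fun z => k (c - z)) (c.re - b) (c.re - a) := fun A => by
  obtain ⟨C, h0, hC⟩ := hk |A|
  refine ⟨C * Real.exp (|A| * |c.im|), by positivity, fun z h1 h2 => ?_⟩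
  refine (hC (c - z) (by simp; linarith) (by simp; linarith)).trans ?_
  rw [mul_assoc, ← Real.exp_add]
  have h3 : |z.im| ≤ |c.im| + |(c - z).im| := by
    have := abs_sub_abs_le_abs_sub z.im c.im
    rw [abs_sub_comm] at this
    simp only [sub_im]; linarith
  gcongr
  have h4 := mul_le_mul_of_nonneg_left h3 (abs_nonneg A)
  have h5 : A * |z.im| ≤ |A| * |z.im| := by gcongr; exact le_abs_self A
  linarith

/-- Rapid decay is stronger than polynomial decay. -/
theorem exists_norm_le (hk : RapidDecay k a b) (n : ℕ) :
    ∃ C : ℝ, 0 ≤ C ∧ ∀ z : ℂ, a ≤ z.re → z.re ≤ b → ‖k z‖ ≤ C * ((1 + |z.im|) ^ n)⁻¹ := by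
  obtain ⟨C, h0, hC⟩ := hk 1
  refine ⟨C * (n.factorial * Real.exp 1), by positivity, fun z h1 h2 => (hC z h1 h2).trans ?_⟩
  rw [mul_assoc]
  gcongr
  have h3 := Real.pow_div_factorial_le_exp (1 + |z.im|) (by positivity) n
  rw [div_le_iff₀ (by positivity), Real.exp_add] at h3
  rw [one_mul, Real.exp_neg, ← div_eq_mul_inv, inv_eq_one_div, div_le_div_iff₀ (Real.exp_pos _) (by positivity)]
  linarith

end RapidDecay

theorem integrable_inv_one_add_abs_sq : Integrable fun t : ℝ => ((1 + |t|) ^ 2)⁻¹ := by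
  refine integrable_inv_one_add_sq.mono' (Continuous.aestronglyMeasurable ?_)
    (Eventually.of_forall fun t => ?_)
  · exact Continuous.inv₀ (by fun_prop) fun t => by positivity
  · rw [Real.norm_of_nonneg (by positivity)]
    gcongr
    nlinarith [abs_nonneg t, sq_abs t]

theorem integrable_of_norm_le_inv_sq {f : ℝ → ℂ} {C : ℝ} (hf : AEStronglyMeasurable f)
    (h : ∀ t, ‖f t‖ ≤ C * ((1 + |t|) ^ 2)⁻¹) : Integrable f :=
  (integrable_inv_one_add_abs_sq.const_mul C).mono' hf (Eventually.of_forall h)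

theorem continuous_vertical {k : ℂ → ℂ} {a b : ℝ}
    (hd : ∀ z : ℂ, a ≤ z.re → z.re ≤ b → DifferentiableAt ℂ k z) {σ : ℝ} (h1 : a ≤ σ) (h2 : σ ≤ b) :
    Continuous fun t : ℝ => k (σ + t * I) := by
  rw [continuous_iff_continuousAt]
  intro t
  have := (hd (σ + t * I) (by simpa using h1) (by simpa using h2)).continuousAt
  exact this.comp (f := fun t : ℝ => (σ : ℂ) + t * I) (by fun_prop)

theorem RapidDecay.integrable {k : ℂ → ℂ} {a b : ℝ} (hk : RapidDecay k a b)
    (hd : ∀ z : ℂ, a ≤ z.re → z.re ≤ b → DifferentiableAt ℂ k z) {σ : ℝ} (h1 : a ≤ σ) (h2 : σ ≤ b) :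
    Integrable fun t : ℝ => k (σ + t * I) := by
  obtain ⟨C, h0, hC⟩ := hk.exists_norm_le 2
  refine integrable_of_norm_le_inv_sq (continuous_vertical hd h1 h2).aestronglyMeasurable (C := C)
    fun t => ?_
  simpa using hC (σ + t * I) (by simpa using h1) (by simpa using h2)

theorem exp_abs_im_le_of_norm_sub_le {C r : ℝ} (hC : 0 ≤ C) {z w : ℂ} (h : ‖w - z‖ ≤ r) :
    Real.exp (C * |w.im|) ≤ Real.exp (C * r) * Real.exp (C * |z.im|) := by
  rw [← Real.exp_add, ← mul_add]
  gcongr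
  have h1 := (Complex.abs_im_le_norm (w - z)).trans h
  rw [sub_im] at h1
  linarith [abs_sub_abs_le_abs_sub w.im z.im]

theorem norm_deriv_le_of_strip {f : ℂ → ℂ} {a b r K : ℝ} (hr : 0 < r)
    (hd : ∀ z : ℂ, a ≤ z.re → z.re ≤ b → DifferentiableAt ℂ f z) {z : ℂ} (h1 : a + r ≤ z.re)
    (h2 : z.re ≤ b - r) (hK : ∀ w : ℂ, a ≤ w.re → w.re ≤ b → ‖w - z‖ ≤ r → ‖f w‖ ≤ K) :
    ‖deriv f z‖ ≤ K / r := by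
  have hre : ∀ w : ℂ, ‖w - z‖ ≤ r → a ≤ w.re ∧ w.re ≤ b := by
    intro w hw
    have h3 := abs_le.mp ((Complex.abs_re_le_norm (w - z)).trans hw)
    rw [sub_re] at h3
    constructor <;> linarith
  refine norm_deriv_le_of_forall_mem_sphere_norm_le hr ?_ fun w hw => ?_
  · refine DifferentiableOn.diffContOnCl fun w hw => ?_
    rw [closure_ball _ hr.ne', Metric.mem_closedBall, dist_eq_norm] at hw
    exact (hd w (hre w hw).1 (hre w hw).2).differentiableWithinAt
  · rw [Metric.mem_sphere, dist_eq_norm] at hw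
    exact hK w (hre w hw.le).1 (hre w hw.le).2 hw.le

theorem ExpGrowth.deriv {f : ℂ → ℂ} {a b r : ℝ} (hr : 0 < r) (hf : ExpGrowth f a b)
    (hd : ∀ z : ℂ, a ≤ z.re → z.re ≤ b → DifferentiableAt ℂ f z) :
    ExpGrowth (deriv f) (a + r) (b - r) := by
  obtain ⟨C, h0, hC⟩ := hf
  refine ⟨C + C * Real.exp (C * r) / r, by positivity, fun z h1 h2 => ?_⟩
  refine (norm_deriv_le_of_strip hr hd h1 h2 (K := C * (Real.exp (C * r) * Real.exp (C * |z.im|)))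
    fun w hw1 hw2 hw => (hC w hw1 hw2).trans ?_).trans ?_
  · gcongr
    exact exp_abs_im_le_of_norm_sub_le h0 hw
  · have h3 : 0 ≤ C * Real.exp (C * r) / r := by positivity
    calc _ = C * Real.exp (C * r) / r * Real.exp (C * |z.im|) := by ring
      _ ≤ _ := by gcongr <;> linarith

theorem RapidDecay.deriv {k : ℂ → ℂ} {a b r : ℝ} (hr : 0 < r) (hk : RapidDecay k a b)
    (hd : ∀ z : ℂ, a ≤ z.re → z.re ≤ b → DifferentiableAt ℂ k z) :
    RapidDecay (deriv k) (a + r) (b - r) := by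
  intro A
  obtain ⟨C, h0, hC⟩ := hk |A|
  refine ⟨C * Real.exp (|A| * r) / r, by positivity, fun z h1 h2 => ?_⟩
  refine (norm_deriv_le_of_strip hr hd h1 h2
    (K := C * (Real.exp (|A| * r) * Real.exp (-(A * |z.im|)))) fun w hw1 hw2 hw => (hC w hw1 hw2).trans ?_).trans
    (le_of_eq (by ring))
  gcongr
  rw [norm_sub_rev] at hw
  have h3 := exp_abs_im_le_of_norm_sub_le (abs_nonneg A) hw
  have h4 : A * |z.im| ≤ |A| * |z.im| := by gcongr; exact le_abs_self A
  rw [Real.exp_neg, Real.exp_neg, ← div_eq_mul_inv, inv_eq_one_div,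
    div_le_div_iff₀ (Real.exp_pos _) (Real.exp_pos _), one_mul]
  exact (Real.exp_le_exp.mpr h4).trans h3

/-- Convolution along vertical lines preserves polynomial decay. -/
theorem RapidDecay.exists_norm_integral_le {k : ℂ → ℂ} {a b : ℝ} (hk : RapidDecay k a b)
    {g : ℝ → ℂ} {B : ℝ} {n : ℕ} (hg : ∀ t, ‖g t‖ ≤ B * ((1 + |t|) ^ n)⁻¹) :
    ∃ C : ℝ, 0 ≤ C ∧ ∀ z : ℂ, a ≤ z.re → z.re ≤ b →
      ‖∫ t : ℝ, g t * k (z - t * I)‖ ≤ C * ((1 + |z.im|) ^ n)⁻¹ := by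
  -- Of these powers `n` transport the decay of `g` from `t` to `z.im`, through `1 + |y| ≤ (1 +
  -- |t|)(1 + |y - t|)`, and two make the integral converge.
  obtain ⟨D, h0, hD⟩ := hk.exists_norm_le (n + 2)
  have hB : 0 ≤ B := by simpa using (norm_nonneg _).trans (hg 0)
  set J : ℝ := ∫ t : ℝ, ((1 + |t|) ^ 2)⁻¹ with hJ
  have hJ0 : 0 ≤ J := integral_nonneg fun t => by positivity
  refine ⟨B * D * J, by positivity, fun z h1 h2 => ?_⟩
  have hint : Integrable fun t : ℝ => B * D * ((1 + |z.im|) ^ n)⁻¹ * ((1 + |z.im - t|) ^ 2)⁻¹ :=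
    (integrable_inv_one_add_abs_sq.comp_sub_left z.im).const_mul _
  calc _ ≤ ∫ t : ℝ, B * D * ((1 + |z.im|) ^ n)⁻¹ * ((1 + |z.im - t|) ^ 2)⁻¹ := by
        refine norm_integral_le_of_norm_le hint (Eventually.of_forall fun t => ?_)
        have h3 := hD (z - t * I) (by simpa using h1) (by simpa using h2)
        have h4 : (z - t * I).im = z.im - t := by simp
        rw [h4] at h3
        rw [norm_mul]
        have h5 : 1 + |z.im| ≤ (1 + |t|) * (1 + |z.im - t|) := by
          have : |z.im| ≤ |t| + |z.im - t| := by simpa using abs_add_le t (z.im - t)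
          nlinarith [abs_nonneg t, abs_nonneg (z.im - t)]
        calc ‖g t‖ * ‖k (z - t * I)‖
            ≤ (B * ((1 + |t|) ^ n)⁻¹) * (D * ((1 + |z.im - t|) ^ (n + 2))⁻¹) := by
              gcongr
              exact hg t
          _ = B * D * (((1 + |t|) * (1 + |z.im - t|)) ^ n)⁻¹ * ((1 + |z.im - t|) ^ 2)⁻¹ := by
              rw [pow_add, mul_pow, mul_inv, mul_inv]; ring
          _ ≤ _ := by gcongr
    _ = B * D * J * ((1 + |z.im|) ^ n)⁻¹ := by
        rw [integral_const_mul, integral_sub_left_eq_self (fun t : ℝ => ((1 + |t|) ^ 2)⁻¹) volume z.im]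
        ring

theorem RapidDecay.integrable_mul {k : ℂ → ℂ} {a b : ℝ} (hk : RapidDecay k a b)
    (hd : ∀ z : ℂ, a ≤ z.re → z.re ≤ b → DifferentiableAt ℂ k z) {g : ℝ → ℂ} {B : ℝ}
    (hgc : Continuous g) (hg : ∀ t, ‖g t‖ ≤ B) {z : ℂ} (h1 : a ≤ z.re) (h2 : z.re ≤ b) :
    Integrable fun t : ℝ => g t * k (z - t * I) := by
  have h3 := (hk.integrable hd h1 h2).comp_sub_left z.im
  have h4 : Integrable fun t : ℝ => k (z - t * I) := by
    refine h3.congr (Eventually.of_forall fun t => ?_)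
    dsimp only
    congr 1
    apply Complex.ext <;> simp
  exact h4.bdd_mul (c := B) hgc.aestronglyMeasurable (Eventually.of_forall hg)

/-- Differentiation of a convolution along a vertical line. -/
theorem RapidDecay.hasDerivAt_integral {k : ℂ → ℂ} {a b : ℝ} (hk : RapidDecay k a b)
    (hd : ∀ z : ℂ, a ≤ z.re → z.re ≤ b → DifferentiableAt ℂ k z) {g : ℝ → ℂ} {B : ℝ}
    (hgc : Continuous g) (hg : ∀ t, ‖g t‖ ≤ B) {z : ℂ} (h1 : a < z.re) (h2 : z.re < b) :
    HasDerivAt (fun z => ∫ t : ℝ, g t * k (z - t * I)) (∫ t : ℝ, g t * _root_.deriv k (z - t * I)) z := by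
  have hB : 0 ≤ B := (norm_nonneg _).trans (hg 0)
  -- The ball of radius `r` about `z` keeps a further margin `r` inside the strip, where Cauchy's
  -- estimate bounds the derivative. The condition `r ≤ 1` makes the decay at points of the ball
  -- comparable with that at `z`, up to the factor `4`.
  set r : ℝ := min 1 (min (z.re - a) (b - z.re) / 2) with hr
  have hr0 : 0 < r := lt_min one_pos (half_pos (lt_min (by linarith) (by linarith)))
  have hr1 : r ≤ 1 := min_le_left _ _
  have hra : 2 * r ≤ z.re - a := by
    have := (min_le_right (1 : ℝ) (min (z.re - a) (b - z.re) / 2)).trans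
      (div_le_div_of_nonneg_right (min_le_left _ _) two_pos.le)
    linarith
  have hrb : 2 * r ≤ b - z.re := by
    have := (min_le_right (1 : ℝ) (min (z.re - a) (b - z.re) / 2)).trans
      (div_le_div_of_nonneg_right (min_le_right _ _) two_pos.le)
    linarith
  obtain ⟨D, h0, hD⟩ := (hk.deriv hr0 hd).exists_norm_le 2
  have hball : ∀ x ∈ Metric.ball z r, a + r ≤ x.re ∧ x.re ≤ b - r ∧ |z.im - x.im| ≤ 1 := by
    intro x hx
    rw [mem_ball_iff_norm] at hx
    have h3 := abs_le.mp ((Complex.abs_re_le_norm (x - z)).trans hx.le)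
    have h4 := (Complex.abs_im_le_norm (x - z)).trans hx.le
    rw [sub_re] at h3
    rw [sub_im, abs_sub_comm] at h4
    exact ⟨by linarith, by linarith, h4.trans hr1⟩
  have hsub : ∀ t : ℝ, (z - t * I) = (z.re : ℂ) + ((z.im - t : ℝ) : ℂ) * I := fun t => by
    apply Complex.ext <;> simp
  refine (hasDerivAt_integral_of_dominated_loc_of_deriv_le (s := Metric.ball z r)
    (F := fun z (t : ℝ) => g t * k (z - t * I)) (F' := fun z (t : ℝ) => g t * _root_.deriv k (z - t * I))
    (bound := fun t => 4 * (B * D) * ((1 + |z.im - t|) ^ 2)⁻¹) (Metric.ball_mem_nhds z hr0) ?_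
    (hk.integrable_mul hd hgc hg h1.le h2.le) ?_ ?_ ?_ ?_).2
  · filter_upwards [Metric.ball_mem_nhds z hr0] with x hx
    obtain ⟨e1, e2, -⟩ := hball x hx
    exact (hk.integrable_mul hd hgc hg (by linarith) (by linarith)).aestronglyMeasurable
  · refine hgc.aestronglyMeasurable.mul ?_
    have hcd : ContinuousOn (_root_.deriv k) {z : ℂ | a < z.re ∧ z.re < b} := by
      have ho : IsOpen {z : ℂ | a < z.re ∧ z.re < b} :=
        (isOpen_lt continuous_const continuous_re).inter (isOpen_lt continuous_re continuous_const)
      have : DifferentiableOn ℂ k {z : ℂ | a < z.re ∧ z.re < b} := fun w hw =>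
        (hd w hw.1.le hw.2.le).differentiableWithinAt
      exact (this.deriv ho).continuousOn
    refine Continuous.aestronglyMeasurable (hcd.comp_continuous (by fun_prop) fun t => ?_)
    simpa using ⟨h1, h2⟩
  · refine Eventually.of_forall fun t x hx => ?_
    obtain ⟨e1, e2, e3⟩ := hball x hx
    have h3 := hD (x - t * I) (by simpa using e1) (by simpa using e2)
    have h4 : (x - t * I).im = x.im - t := by simp
    rw [h4] at h3
    rw [norm_mul]
    calc _ ≤ B * (D * ((1 + |x.im - t|) ^ 2)⁻¹) := by gcongr; exact hg t
      _ ≤ B * (D * (4 * ((1 + |z.im - t|) ^ 2)⁻¹)) := by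
          gcongr
          rw [← div_eq_mul_inv, inv_eq_one_div, div_le_div_iff₀ (by positivity) (by positivity), one_mul]
          have h5 : |z.im - t| ≤ |z.im - x.im| + |x.im - t| := by
            simpa using abs_add_le (z.im - x.im) (x.im - t)
          have h6 : 1 + |z.im - t| ≤ 2 * (1 + |x.im - t|) := by linarith [abs_nonneg (x.im - t)]
          calc _ ≤ (2 * (1 + |x.im - t|)) ^ 2 := by gcongr
            _ = _ := by ring
      _ = _ := by ring
  · exact ((integrable_inv_one_add_abs_sq.comp_sub_left z.im).const_mul _)
  · refine Eventually.of_forall fun t x hx => ?_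
    obtain ⟨e1, e2, -⟩ := hball x hx
    have h3 := (hd (x - t * I) (by simp; linarith) (by simp; linarith)).hasDerivAt
    exact (h3.comp_sub_const x (t * I)).const_mul (g t)

/-- Moving a vertical line of integration across a simple pole on the real axis. -/
theorem integral_vertical_simple_pole_at {E : ℂ → ℂ} {a b p : ℝ} (ha : a < p) (hb : p < b)
    (hd : ∀ z : ℂ, a ≤ z.re → z.re ≤ b → DifferentiableAt ℂ E z) (hE : ExpGrowth E a b)
    (hia : Integrable fun t : ℝ => E (a + t * I) / (a + t * I - p))
    (hib : Integrable fun t : ℝ => E (b + t * I) / (b + t * I - p)) :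
    (∫ t : ℝ, E (b + t * I) / (b + t * I - p)) - ∫ t : ℝ, E (a + t * I) / (a + t * I - p)
      = 2 * Real.pi * E p := by
  have e1 : ∀ (σ t : ℝ), ((σ - p : ℝ) : ℂ) + t * I + p = σ + t * I := fun σ t => by push_cast; ring
  have e2 : ∀ (σ t : ℝ), ((σ - p : ℝ) : ℂ) + t * I = σ + t * I - p := fun σ t => by push_cast; ring
  have e3 : ∀ σ : ℝ, (fun t : ℝ => E (((σ - p : ℝ) : ℂ) + t * I + p) / (((σ - p : ℝ) : ℂ) + t * I)) =
      fun t : ℝ => E (σ + t * I) / (σ + t * I - p) := fun σ => by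
    ext t
    rw [e1, e2]
  have main := integral_vertical_simple_pole (E := fun z => E (z + p)) (sub_neg.mpr ha)
    (sub_pos.mpr hb) (fun z h1 h2 =>
      (hd (z + p) (by simp; linarith) (by simp; linarith)).comp z (by fun_prop)) (hE.comp_add_const p)
    (by rw [e3]; exact hia) (by rw [e3]; exact hib)
  rw [e3, e3, zero_add] at main
  exact main

/-- An even function against `1 / s` over a vertical line is half of the residue at the origin. -/
theorem integral_vertical_div_of_even {E : ℂ → ℂ} {b : ℝ} (hb : 0 < b)
    (hd : ∀ z : ℂ, -b ≤ z.re → z.re ≤ b → DifferentiableAt ℂ E z) (hE : ExpGrowth E (-b) b)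
    (he : ∀ t : ℝ, E (-(b + t * I)) = E (b + t * I))
    (hib : Integrable fun t : ℝ => E (b + t * I) / (b + t * I)) :
    ∫ t : ℝ, E (b + t * I) / (b + t * I) = Real.pi * E 0 := by
  have e1 : ∀ t : ℝ, E (((-b : ℝ) : ℂ) + t * I) / (((-b : ℝ) : ℂ) + t * I) =
      -(E (b + (-t : ℝ) * I) / (b + (-t : ℝ) * I)) := fun t => by
    have h1 : ((-b : ℝ) : ℂ) + t * I = -(b + (-t : ℝ) * I) := by push_cast; ring
    rw [h1, he, div_neg]
  have h1 : Integrable fun t : ℝ => E (((-b : ℝ) : ℂ) + t * I) / (((-b : ℝ) : ℂ) + t * I) := by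
    simp_rw [e1]
    exact hib.comp_neg.neg
  have main := integral_vertical_simple_pole (neg_lt_zero.mpr hb) hb hd hE h1 hib
  simp_rw [e1] at main
  rw [integral_neg, integral_neg_eq_self (fun t : ℝ => E (b + t * I) / (b + t * I)) volume] at main
  linear_combination main / 2

/-! ### The Mellin transform of `exp (2πiux)` and Taylor remainders -/

theorem ExpGrowth.Gamma {a b : ℝ} (ha : 0 < a) : ExpGrowth Complex.Gamma a b := by
  obtain ⟨K, hK⟩ := (isCompact_Icc (a := a) (b := b)).exists_bound_of_continuousOn
    (f := Real.Gamma) fun x hx =>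
      (Real.differentiableAt_Gamma fun m h => by
        have := hx.1; have h2 : (0 : ℝ) ≤ m := m.cast_nonneg; linarith).continuousAt.continuousWithinAt
  refine ExpGrowth.of_bounded (K := K) fun z h1 h2 => (Complex.norm_Gamma_le (ha.trans_le h1)).trans ?_
  exact (le_abs_self _).trans (hK z.re ⟨h1, h2⟩)

theorem ExpGrowth.exp_mul_I (u a b : ℝ) : ExpGrowth (fun w => cexp (u * Real.pi * w / 2 * I)) a b := by
  refine ⟨1 + |u| * Real.pi, by positivity, fun z _ _ => ?_⟩
  rw [Complex.norm_exp]
  have h1 : (u * Real.pi * z / 2 * I : ℂ).re = -(u * Real.pi / 2 * z.im) := by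
    rw [show (u * Real.pi * z / 2 * I : ℂ) = ((u * Real.pi / 2 : ℝ) : ℂ) * (z * I) by push_cast; ring,
      re_ofReal_mul]
    simp
  rw [h1]
  have h2 : -(u * Real.pi / 2 * z.im) ≤ (1 + |u| * Real.pi) * |z.im| := by
    refine (neg_le_abs _).trans ?_
    rw [abs_mul, abs_div, abs_mul, abs_of_pos Real.pi_pos, abs_two]
    gcongr
    have : 0 ≤ |u| * Real.pi := by positivity
    linarith
  calc _ ≤ 1 * Real.exp ((1 + |u| * Real.pi) * |z.im|) := by rw [one_mul]; gcongr
    _ ≤ _ := by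
      gcongr
      have : 0 ≤ |u| * Real.pi := by positivity
      linarith

/-- The Mellin transform of `exp (2πiux)` for `u = ±1`. -/
noncomputable def expMellin (u : ℝ) (w : ℂ) : ℂ :=
  ((2 * Real.pi : ℝ) : ℂ) ^ (-w) * cexp (u * Real.pi * w / 2 * I) * Complex.Gamma w

/-- `w * expMellin u w`, holomorphic for `-1 < w.re`. -/
noncomputable def expMellinReg (u : ℝ) (w : ℂ) : ℂ :=
  ((2 * Real.pi : ℝ) : ℂ) ^ (-w) * cexp (u * Real.pi * w / 2 * I) * Complex.Gamma (w + 1)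

theorem expMellinReg_eq (u : ℝ) {w : ℂ} (hw : w ≠ 0) : expMellinReg u w = w * expMellin u w := by
  rw [expMellinReg, expMellin, Complex.Gamma_add_one w hw]; ring

theorem expMellinReg_zero (u : ℝ) : expMellinReg u 0 = 1 := by
  simp [expMellinReg]

theorem two_pi_ofReal_ne_zero : ((2 * Real.pi : ℝ) : ℂ) ≠ 0 := ofReal_ne_zero.mpr (by positivity)

theorem differentiableAt_expMellinReg (u : ℝ) {w : ℂ} (hw : -1 < w.re) :
    DifferentiableAt ℂ (expMellinReg u) w := by
  unfold expMellinReg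
  have h1 : DifferentiableAt ℂ (fun w => Complex.Gamma (w + 1)) w := by
    refine (Complex.differentiableAt_Gamma (w + 1) fun m h => ?_).comp w (by fun_prop)
    have h2 := congrArg Complex.re h
    simp at h2
    have h3 : (0 : ℝ) ≤ m := m.cast_nonneg
    linarith
  have h2 : DifferentiableAt ℂ (fun w : ℂ => ((2 * Real.pi : ℝ) : ℂ) ^ (-w)) w :=
    (differentiableAt_id.neg).const_cpow (Or.inl two_pi_ofReal_ne_zero)
  exact (h2.mul (by fun_prop)).mul h1

theorem expGrowth_expMellinReg (u : ℝ) {a b : ℝ} (ha : -1 < a) : ExpGrowth (expMellinReg u) a b := by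
  unfold expMellinReg
  refine ExpGrowth.mul (ExpGrowth.mul ?_ (ExpGrowth.exp_mul_I u a b)) ?_
  · refine (ExpGrowth.const_cpow (c := 2 * Real.pi) (by positivity) (u := -1) (v := 0)).congr
      fun z _ _ => ?_
    simp
  · refine ((ExpGrowth.Gamma (a := a + 1) (b := b + 1) (by linarith)).comp_add_const 1).mono
      (by linarith) (by linarith) |>.congr fun z _ _ => by simp

theorem expMellin_add_one {u : ℝ} (hu : u = 1 ∨ u = -1) {w : ℂ} (hw : w ≠ 0) :
    w * expMellin u w = -(2 * Real.pi * u * I) * expMellin u (w + 1) := by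
  rw [expMellin, expMellin, Complex.Gamma_add_one w hw,
    show -(w + 1) = -w - 1 by ring, cpow_sub _ _ two_pi_ofReal_ne_zero, cpow_one,
    show (u * Real.pi * (w + 1) / 2 * I : ℂ) = u * Real.pi * w / 2 * I + u * (Real.pi / 2 * I) by ring,
    Complex.exp_add]
  have h1 : cexp (u * (Real.pi / 2 * I)) = u * I := by
    rcases hu with rfl | rfl
    · simp [Complex.exp_pi_div_two_mul_I]
    · rw [ofReal_neg, ofReal_one, neg_one_mul, Complex.exp_neg, Complex.exp_pi_div_two_mul_I, inv_I]
      ring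
  have h2 : (u : ℂ) * u = 1 := by rcases hu with rfl | rfl <;> simp
  have h3 := two_pi_ofReal_ne_zero
  rw [h1]
  push_cast at h3 ⊢
  field_simp
  linear_combination Complex.Gamma w * (I ^ 2 * h2 + I_sq)

theorem prod_mul_expMellin {u : ℝ} (hu : u = 1 ∨ u = -1) (n : ℕ) {w : ℂ} (hw : ∀ i < n, w + i ≠ 0) :
    (∏ i ∈ Finset.range n, (w + i)) * expMellin u w =
      (-(2 * Real.pi * u * I)) ^ n * expMellin u (w + n) := by
  induction n with
  | zero => simp
  | succ n ih =>
    rw [Finset.prod_range_succ, mul_right_comm, ih fun i hi => hw i (by omega), mul_assoc,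
      mul_comm (expMellin u (w + n)), expMellin_add_one hu (hw n (by omega)), pow_succ]
    push_cast
    rw [add_assoc]; ring

/-- `|Γ(1/2 + it)|² = π / cosh(πt)` is compensated by the exponential, whose squared modulus is at
most `2 cosh(πt)`. There is boundedness on this line but no decay; decay is gained only by moving to
the left. -/
theorem norm_expMellin_half_le {u : ℝ} (hu : u = 1 ∨ u = -1) (t : ℝ) :
    ‖expMellin u ((1 / 2 : ℝ) + t * I)‖ ≤ 1 := by
  set w : ℂ := (1 / 2 : ℝ) + t * I with hw
  have hΓ : ‖Complex.Gamma w‖ ^ 2 = Real.pi / Real.cosh (Real.pi * t) := by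
    have h1 := Complex.Gamma_mul_Gamma_one_sub w
    have h2 : 1 - w = (starRingEnd ℂ) w := by
      apply Complex.ext <;> simp [hw]; norm_num
    rw [h2, Complex.Gamma_conj, Complex.mul_conj, hw,
      show (Real.pi : ℂ) * (((1 / 2 : ℝ) : ℂ) + t * I) = (Real.pi * t : ℂ) * I + Real.pi / 2 by
        push_cast; ring, Complex.sin_add_pi_div_two, Complex.cos_mul_I, ← ofReal_mul, ← ofReal_cosh,
      ← ofReal_div, ofReal_inj, Complex.normSq_eq_norm_sq] at h1
    exact h1
  have h2 : ‖((2 * Real.pi : ℝ) : ℂ) ^ (-w)‖ ^ 2 = (2 * Real.pi)⁻¹ := by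
    rw [norm_cpow_eq_rpow_re_of_pos (by positivity), ← Real.rpow_natCast, ← Real.rpow_mul (by positivity)]
    have : (-w).re * ((2 : ℕ) : ℝ) = -1 := by simp [hw]
    rw [this, Real.rpow_neg_one]
  have h3 : ‖cexp (u * Real.pi * w / 2 * I)‖ ^ 2 ≤ 2 * Real.cosh (Real.pi * t) := by
    rw [Complex.norm_exp, ← Real.exp_nat_mul]
    have h1 : (u * Real.pi * w / 2 * I : ℂ).re = -(u * Real.pi / 2 * t) := by
      rw [show (u * Real.pi * w / 2 * I : ℂ) = ((u * Real.pi / 2 : ℝ) : ℂ) * (w * I) by push_cast; ring,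
        re_ofReal_mul]
      simp [hw]
    rw [h1, Real.cosh_eq]
    have e1 := Real.exp_pos (Real.pi * t)
    have e2 := Real.exp_pos (-(Real.pi * t))
    rcases hu with rfl | rfl
    · rw [show ((2 : ℕ) : ℝ) * -(1 * Real.pi / 2 * t) = -(Real.pi * t) by push_cast; ring]; linarith
    · rw [show ((2 : ℕ) : ℝ) * -(-1 * Real.pi / 2 * t) = Real.pi * t by push_cast; ring]; linarith
  rw [← abs_of_nonneg (norm_nonneg (expMellin u w)), ← sq_le_one_iff_abs_le_one, expMellin, norm_mul,
    norm_mul, mul_pow, mul_pow, hΓ, h2]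
  have hc := Real.cosh_pos (Real.pi * t)
  calc _ ≤ (2 * Real.pi)⁻¹ * (2 * Real.cosh (Real.pi * t)) * (Real.pi / Real.cosh (Real.pi * t)) := by
        gcongr
    _ = 1 := by field_simp

theorem one_add_abs_div_three_le_norm {σ : ℝ} (hσ : 1 / 2 ≤ |σ|) (t : ℝ) :
    (1 + |t|) / 3 ≤ ‖(σ : ℂ) + t * I‖ := by
  have h1 := abs_le_norm_vertical σ t
  have h2 : |t| ≤ ‖(σ : ℂ) + t * I‖ := by simpa using Complex.abs_im_le_norm ((σ : ℂ) + t * I)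
  linarith

/-- The recurrence for `expMellin`, iterated `n` times from the line `1/2`: each unit step to the
left divides by one factor `w + i`. -/
theorem norm_expMellin_eq {u : ℝ} (hu : u = 1 ∨ u = -1) (n : ℕ) (t : ℝ) :
    ‖expMellin u ((1 / 2 - n : ℝ) + t * I)‖ ≤
      (2 * Real.pi) ^ n / ∏ i ∈ Finset.range n, ‖((1 / 2 - (n - i) : ℝ) : ℂ) + t * I‖ := by
  have hne : ∀ i < n, (((1 / 2 - n : ℝ) : ℂ) + t * I) + i ≠ 0 := fun i hi h => by
    have h1 := congrArg Complex.re h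
    simp at h1
    have h2 : (i : ℝ) + 1 ≤ n := by exact_mod_cast hi
    linarith
  have hpos : 0 < ∏ i ∈ Finset.range n, ‖((1 / 2 - (n - i) : ℝ) : ℂ) + t * I‖ := by
    refine Finset.prod_pos fun i hi => norm_pos_iff.mpr (vertical_ne_zero ?_ t)
    have h2 : (i : ℝ) + 1 ≤ n := by exact_mod_cast Finset.mem_range.mp hi
    linarith
  rw [le_div_iff₀ hpos, mul_comm]
  have h1 := congrArg norm (prod_mul_expMellin hu n hne)
  rw [norm_mul, norm_mul, norm_pow, norm_prod] at h1
  have h2 : ‖-(2 * Real.pi * u * I : ℂ)‖ = 2 * Real.pi := by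
    rcases hu with rfl | rfl <;> simp [abs_of_pos Real.pi_pos]
  have h3 : (((1 / 2 - n : ℝ) : ℂ) + t * I) + n = (1 / 2 : ℝ) + t * I := by push_cast; ring
  have h4 : ∀ i ∈ Finset.range n, ‖(((1 / 2 - n : ℝ) : ℂ) + t * I) + i‖ =
      ‖((1 / 2 - (n - i) : ℝ) : ℂ) + t * I‖ := fun i _ => by congr 1; push_cast; ring
  rw [h2, h3, Finset.prod_congr rfl h4] at h1
  rw [h1]
  exact mul_le_of_le_one_right (by positivity) (norm_expMellin_half_le hu t)

theorem norm_expMellin_le {u : ℝ} (hu : u = 1 ∨ u = -1) (n : ℕ) (t : ℝ) :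
    ‖expMellin u ((1 / 2 - n : ℝ) + t * I)‖ ≤ (6 * Real.pi) ^ n * ((1 + |t|) ^ n)⁻¹ := by
  refine (norm_expMellin_eq hu n t).trans ?_
  have h1 : ((1 + |t|) / 3) ^ n ≤ ∏ i ∈ Finset.range n, ‖((1 / 2 - (n - i) : ℝ) : ℂ) + t * I‖ := by
    rw [← Finset.card_range n, ← Finset.prod_const, Finset.card_range]
    refine Finset.prod_le_prod (fun _ _ => by positivity) fun i hi => one_add_abs_div_three_le_norm ?_ t
    have h2 : (i : ℝ) + 1 ≤ n := by exact_mod_cast Finset.mem_range.mp hi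
    rw [abs_of_nonpos (by linarith)]; linarith
  calc _ ≤ (2 * Real.pi) ^ n / ((1 + |t|) / 3) ^ n := by gcongr
    _ = _ := by rw [div_pow, show 6 * Real.pi = 2 * Real.pi * 3 by ring, mul_pow (2 * Real.pi) 3]; field_simp

/-- Two of the `n + 2` factors are kept for integrability in `t`. The others are bounded below by
their real parts, whose product is at least `n!`; this makes the Taylor remainders tend to zero. -/
theorem norm_expMellin_add_two_le {u : ℝ} (hu : u = 1 ∨ u = -1) (n : ℕ) (t : ℝ) :
    ‖expMellin u ((1 / 2 - (n + 2 : ℕ) : ℝ) + t * I)‖ ≤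
      (6 * Real.pi) ^ 2 * ((2 * Real.pi) ^ n / n.factorial) * ((1 + |t|) ^ 2)⁻¹ := by
  refine (norm_expMellin_eq hu (n + 2) t).trans ?_
  have h1 : (n.factorial : ℝ) * ((1 + |t|) / 3) ^ 2 ≤
      ∏ i ∈ Finset.range (n + 2), ‖((1 / 2 - ((n + 2 : ℕ) - i) : ℝ) : ℂ) + t * I‖ := by
    rw [Finset.prod_range_succ, Finset.prod_range_succ, mul_assoc]
    refine mul_le_mul ?_ ?_ (by positivity) (by positivity)
    · rw [← Finset.prod_range_add_one_eq_factorial, ← Finset.prod_range_reflect, Nat.cast_prod]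
      refine Finset.prod_le_prod (fun _ _ => by positivity) fun i hi => ?_
      refine le_trans ?_ (abs_le_norm_vertical _ t)
      have h2 := Finset.mem_range.mp hi
      have h3 : (n - 1 - i + 1 : ℕ) = n - i := by omega
      have h4 : (i : ℝ) + 1 ≤ n := by exact_mod_cast h2
      rw [h3, Nat.cast_sub h2.le, abs_of_nonpos (by push_cast; linarith)]
      push_cast; linarith
    · rw [pow_two]
      refine mul_le_mul (one_add_abs_div_three_le_norm ?_ t) (one_add_abs_div_three_le_norm ?_ t)
        (by positivity) (by positivity)
      · push_cast; rw [abs_of_nonpos (by linarith)]; linarith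
      · push_cast; rw [abs_of_nonpos (by linarith)]; linarith
  calc _ ≤ (2 * Real.pi) ^ (n + 2) / ((n.factorial : ℝ) * ((1 + |t|) / 3) ^ 2) := by gcongr
    _ = _ := by field_simp; ring

theorem continuous_expMellin (u : ℝ) (n : ℕ) :
    Continuous fun t : ℝ => expMellin u ((1 / 2 - n : ℝ) + t * I) := by
  have hG : ∀ t : ℝ, ∀ m : ℕ, ((1 / 2 - n : ℝ) + t * I : ℂ) ≠ -m := fun t m h => by
    have h1 := congrArg Complex.re h
    simp at h1
    have h2 : (2 * n : ℝ) = 1 + 2 * m := by linarith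
    have h3 : 2 * n = 1 + 2 * m := by exact_mod_cast h2
    omega
  unfold expMellin
  rw [continuous_iff_continuousAt]
  intro t
  refine ((ContinuousAt.const_cpow (by fun_prop) (Or.inl two_pi_ofReal_ne_zero)).mul (by fun_prop)).mul ?_
  exact (Complex.differentiableAt_Gamma _ (hG t)).continuousAt.comp
    (f := fun t : ℝ => ((1 / 2 - n : ℝ) : ℂ) + t * I) (by fun_prop)

/-- Moving the line of integration of a product with `expMellin` across the pole at `-n`. -/
theorem integral_expMellin_mul_sub {u : ℝ} (hu : u = 1 ∨ u = -1) (n : ℕ) {Φ : ℂ → ℂ}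
    (hd : ∀ z : ℂ, 1 / 2 - (n + 1 : ℕ) ≤ z.re → z.re ≤ 1 / 2 - n → DifferentiableAt ℂ Φ z)
    (hΦ : ExpGrowth Φ (1 / 2 - (n + 1 : ℕ)) (1 / 2 - n))
    (hia : Integrable fun t : ℝ => expMellin u ((1 / 2 - (n + 1 : ℕ) : ℝ) + t * I) *
      Φ ((1 / 2 - (n + 1 : ℕ) : ℝ) + t * I))
    (hib : Integrable fun t : ℝ => expMellin u ((1 / 2 - n : ℝ) + t * I) * Φ ((1 / 2 - n : ℝ) + t * I)) :
    (∫ t : ℝ, expMellin u ((1 / 2 - n : ℝ) + t * I) * Φ ((1 / 2 - n : ℝ) + t * I)) -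
      ∫ t : ℝ, expMellin u ((1 / 2 - (n + 1 : ℕ) : ℝ) + t * I) * Φ ((1 / 2 - (n + 1 : ℕ) : ℝ) + t * I) =
      2 * Real.pi * ((2 * Real.pi * u * I) ^ n / n.factorial * Φ (-n)) := by
  have hne : ∀ z : ℂ, z.re ≤ 1 / 2 - n → ∀ i < n, z + i ≠ 0 := fun z hz i hi h => by
    have h1 := congrArg Complex.re h
    simp at h1
    have h2 : (i : ℝ) + 1 ≤ n := by exact_mod_cast hi
    linarith
  -- By the recurrence `E w / (w + n)` equals `expMellin u w * Φ w`, and `E` is holomorphic on the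
  -- strip. The residue at `-n` is therefore `E (-n)`.
  set E : ℂ → ℂ := fun w => (-(2 * Real.pi * u * I)) ^ n * expMellinReg u (w + (n : ℝ)) *
    (∏ i ∈ Finset.range n, (w + i)⁻¹) * Φ w with hE
  have hEd : ∀ z : ℂ, 1 / 2 - (n + 1 : ℕ) ≤ z.re → z.re ≤ 1 / 2 - n → DifferentiableAt ℂ E z := by
    intro z h1 h2
    refine DifferentiableAt.mul (DifferentiableAt.mul (DifferentiableAt.const_mul ?_ _) ?_) (hd z h1 h2)
    · refine (differentiableAt_expMellinReg u ?_).comp z (by fun_prop)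
      push_cast at h1
      simp; linarith
    · refine DifferentiableAt.fun_finsetProd fun i hi => ?_
      exact DifferentiableAt.inv (by fun_prop) (hne z h2 i (Finset.mem_range.mp hi))
  have hEg : ExpGrowth E (1 / 2 - (n + 1 : ℕ)) (1 / 2 - n) := by
    refine ExpGrowth.mul (ExpGrowth.mul ((ExpGrowth.const _).mul ?_) ?_) hΦ
    · refine ((expGrowth_expMellinReg u (a := -1 / 2) (b := 1 / 2) (by norm_num)).comp_add_const
        (n : ℝ)).mono ?_ ?_ <;> push_cast <;> linarith
    · refine ExpGrowth.of_bounded (K := 2 ^ n) fun z h1 h2 => ?_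
      rw [norm_prod, ← Finset.card_range n, ← Finset.prod_const, Finset.card_range]
      refine Finset.prod_le_prod (fun _ _ => norm_nonneg _) fun i hi => ?_
      rw [norm_inv]
      have h3 : (1 / 2 : ℝ) ≤ ‖z + i‖ := by
        refine le_trans ?_ (Complex.abs_re_le_norm _)
        have h2' : (i : ℝ) + 1 ≤ n := by exact_mod_cast Finset.mem_range.mp hi
        simp only [add_re, natCast_re]
        rw [abs_of_nonpos (by linarith)]; linarith
      exact (inv_anti₀ (by norm_num) h3).trans (by norm_num)
  have hval : ∀ z : ℂ, z.re ≤ 1 / 2 - n → z + n ≠ 0 →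
      E z / (z - ((-n : ℝ) : ℂ)) = expMellin u z * Φ z := by
    intro z h1 h2
    have h3 := prod_mul_expMellin hu n (hne z h1)
    have h4 : (∏ i ∈ Finset.range n, (z + i)) ≠ 0 :=
      Finset.prod_ne_zero_iff.mpr fun i hi => hne z h1 i (Finset.mem_range.mp hi)
    have h5 : z - ((-n : ℝ) : ℂ) = z + n := by push_cast; ring
    simp only [hE]
    rw [h5, ofReal_natCast, expMellinReg_eq u h2, Finset.prod_inv_distrib]
    field_simp
    linear_combination (-Φ z) * h3
  have hvne : ∀ σ : ℝ, σ + n ≠ 0 → ∀ t : ℝ, (σ : ℂ) + t * I + n ≠ 0 := by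
    intro σ hσ t h
    refine vertical_ne_zero hσ t ?_
    rw [← h]; push_cast; ring
  have hn1 : ((1 / 2 - (n + 1 : ℕ) : ℝ)) + n ≠ 0 := by push_cast; intro h; linarith
  have hn2 : ((1 / 2 - n : ℝ)) + n ≠ 0 := by norm_num
  have e1 : ∀ t : ℝ, E ((1 / 2 - (n + 1 : ℕ) : ℝ) + t * I) /
      (((1 / 2 - (n + 1 : ℕ) : ℝ) : ℂ) + t * I - ((-n : ℝ) : ℂ)) =
      expMellin u ((1 / 2 - (n + 1 : ℕ) : ℝ) + t * I) * Φ ((1 / 2 - (n + 1 : ℕ) : ℝ) + t * I) :=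
    fun t => hval _ (by simp; linarith) (hvne _ hn1 t)
  have e2 : ∀ t : ℝ, E ((1 / 2 - n : ℝ) + t * I) / (((1 / 2 - n : ℝ) : ℂ) + t * I - ((-n : ℝ) : ℂ)) =
      expMellin u ((1 / 2 - n : ℝ) + t * I) * Φ ((1 / 2 - n : ℝ) + t * I) :=
    fun t => hval _ (by simp) (hvne _ hn2 t)
  have main := integral_vertical_simple_pole_at (E := E) (p := -n) (by push_cast; linarith)
    (by linarith) hEd hEg (by simp_rw [e1]; exact hia) (by simp_rw [e2]; exact hib)
  simp_rw [e1, e2] at main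
  rw [main]
  congr 1
  simp only [hE]
  have h6 : ((-n : ℝ) : ℂ) + ((n : ℝ) : ℂ) = 0 := by push_cast; ring
  -- This sign cancels the one in `(-(2πiu))^n` and leaves the Taylor coefficient `(2πiu)^n / n!`.
  have h7 : ∏ i ∈ Finset.range n, (((-n : ℝ) : ℂ) + i)⁻¹ = (-1) ^ n / (n.factorial : ℂ) := by
    rw [← Finset.prod_range_add_one_eq_factorial, ← Finset.prod_range_reflect, Nat.cast_prod,
      ← Finset.card_range n, ← Finset.prod_const, Finset.card_range, ← Finset.prod_div_distrib]
    refine Finset.prod_congr rfl fun i hi => ?_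
    have h2 := Finset.mem_range.mp hi
    have h3 : ((-n : ℝ) : ℂ) + ((n - 1 - i : ℕ) : ℂ) = -((i + 1 : ℕ) : ℂ) := by
      rw [Nat.sub_sub, Nat.cast_sub (by omega)]
      push_cast; ring
    rw [h3, inv_neg, neg_div, one_div]
  rw [h6, expMellinReg_zero, h7, neg_pow (2 * Real.pi * u * I : ℂ)]
  have h8 : ((-1 : ℂ) ^ n) * (-1) ^ n = 1 := by rw [← mul_pow]; norm_num
  push_cast
  linear_combination ((2 * Real.pi * u * I : ℂ) ^ n * Φ (-n) / n.factorial) * h8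

theorem integrable_expMellin_mul_cpow {u : ℝ} (hu : u = 1 ∨ u = -1) {x : ℝ} (hx : 0 < x) {n : ℕ} (hn : 2 ≤ n) :
    Integrable fun t : ℝ => expMellin u ((1 / 2 - n : ℝ) + t * I) *
      (x : ℂ) ^ (-(((1 / 2 - n : ℝ) : ℂ) + t * I)) := by
  refine integrable_of_norm_le_inv_sq (C := (6 * Real.pi) ^ n * x ^ (-(1 / 2 - n : ℝ)))
    (Continuous.aestronglyMeasurable ?_) fun t => ?_
  · refine (continuous_expMellin u n).mul ?_
    exact Continuous.const_cpow (by fun_prop) (Or.inl (ofReal_ne_zero.mpr hx.ne'))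
  · have h1 : ‖(x : ℂ) ^ (-(((1 / 2 - n : ℝ) : ℂ) + t * I))‖ = x ^ (-(1 / 2 - n : ℝ)) := by
      rw [norm_cpow_eq_rpow_re_of_pos hx]; simp
    rw [norm_mul, h1, mul_right_comm]
    gcongr
    refine (norm_expMellin_le hu n t).trans ?_
    gcongr
    linarith [abs_nonneg t]

/-- The Taylor remainders of `exp (2πiux)` as inverse Mellin transforms. -/
theorem integral_expMellin_mul_cpow {u : ℝ} (hu : u = 1 ∨ u = -1) {x : ℝ} (hx : 0 < x) {n : ℕ} (hn : 2 ≤ n) :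
    ∫ t : ℝ, expMellin u ((1 / 2 - n : ℝ) + t * I) * (x : ℂ) ^ (-(((1 / 2 - n : ℝ) : ℂ) + t * I)) =
      2 * Real.pi * (cexp (2 * Real.pi * u * I * x) -
        ∑ j ∈ Finset.range n, (2 * Real.pi * u * I * x) ^ j / j.factorial) := by
  set f : ℕ → ℂ := fun n => ∫ t : ℝ, expMellin u ((1 / 2 - n : ℝ) + t * I) *
    (x : ℂ) ^ (-(((1 / 2 - n : ℝ) : ℂ) + t * I)) with hf
  have hx0 : (x : ℂ) ≠ 0 := ofReal_ne_zero.mpr hx.ne'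
  have hstep : ∀ m : ℕ, 2 ≤ m → f m - f (m + 1) =
      2 * Real.pi * ((2 * Real.pi * u * I * x) ^ m / m.factorial) := by
    intro m hm
    have := integral_expMellin_mul_sub hu m (Φ := fun w => (x : ℂ) ^ (-w))
      (fun z _ _ => (differentiableAt_id.neg).const_cpow (Or.inl hx0))
      ((ExpGrowth.const_cpow hx (u := -1) (v := 0)).congr fun z _ _ => by simp)
      (integrable_expMellin_mul_cpow hu hx (by omega)) (integrable_expMellin_mul_cpow hu hx hm)
    simp only [hf]
    rw [this, neg_neg, cpow_natCast, mul_pow _ (x : ℂ)]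
    ring
  -- Each pole crossed adds one Taylor term, so line integral plus Taylor polynomial does not depend
  -- on the line. As `m → ∞` the integral dies by the factorial bound and the polynomial tends to
  -- the exponential. The start at `2` is dictated by absolute convergence.
  have hconst : ∀ m : ℕ, f (m + 2) + 2 * Real.pi *
      ∑ j ∈ Finset.range (m + 2), (2 * Real.pi * u * I * x) ^ j / j.factorial =
      f 2 + 2 * Real.pi * ∑ j ∈ Finset.range 2, (2 * Real.pi * u * I * x) ^ j / j.factorial := by
    intro m
    induction m with
    | zero => rfl
    | succ m ih =>
      rw [← ih, Finset.sum_range_succ _ (m + 1 + 1)]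
      have h2 := hstep (m + 2) (by omega)
      linear_combination -h2
  have hlim0 : Tendsto (fun m : ℕ => f (m + 2)) atTop (𝓝 0) := by
    set J : ℝ := ∫ t : ℝ, ((1 + |t|) ^ 2)⁻¹ with hJ
    have hb : ∀ m : ℕ, ‖f (m + 2)‖ ≤
        (6 * Real.pi) ^ 2 * x ^ (3 / 2 : ℝ) * J * ((2 * Real.pi * x) ^ m / m.factorial) := by
      intro m
      have h1 : ∀ t : ℝ, ‖expMellin u ((1 / 2 - (m + 2 : ℕ) : ℝ) + t * I) *
          (x : ℂ) ^ (-(((1 / 2 - (m + 2 : ℕ) : ℝ) : ℂ) + t * I))‖ ≤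
          (6 * Real.pi) ^ 2 * x ^ (3 / 2 : ℝ) * ((2 * Real.pi * x) ^ m / m.factorial) *
            ((1 + |t|) ^ 2)⁻¹ := by
        intro t
        have h1 : ‖(x : ℂ) ^ (-(((1 / 2 - (m + 2 : ℕ) : ℝ) : ℂ) + t * I))‖ = x ^ m * x ^ (3 / 2 : ℝ) := by
          rw [norm_cpow_eq_rpow_re_of_pos hx, ← Real.rpow_natCast, ← Real.rpow_add hx]
          congr 1
          simp; ring
        rw [norm_mul, h1]
        calc _ ≤ (6 * Real.pi) ^ 2 * ((2 * Real.pi) ^ m / m.factorial) * ((1 + |t|) ^ 2)⁻¹ *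
              (x ^ m * x ^ (3 / 2 : ℝ)) := by
              gcongr
              exact norm_expMellin_add_two_le hu m t
          _ = _ := by rw [mul_pow _ x m]; ring
      refine (norm_integral_le_of_norm_le (integrable_inv_one_add_abs_sq.const_mul _)
        (Eventually.of_forall h1)).trans (le_of_eq ?_)
      rw [integral_const_mul]; ring
    refine squeeze_zero_norm hb ?_
    simpa using (FloorSemiring.tendsto_pow_div_factorial_atTop (2 * Real.pi * x)).const_mul
      ((6 * Real.pi) ^ 2 * x ^ (3 / 2 : ℝ) * J)
  have hlim1 : Tendsto (fun m : ℕ => ∑ j ∈ Finset.range (m + 2),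
      (2 * Real.pi * u * I * x : ℂ) ^ j / j.factorial) atTop (𝓝 (cexp (2 * Real.pi * u * I * x))) := by
    have := (NormedSpace.expSeries_div_hasSum_exp (2 * Real.pi * u * I * x : ℂ)).tendsto_sum_nat
    rw [← Complex.exp_eq_exp_ℂ] at this
    exact this.comp (tendsto_add_atTop_nat 2)
  have hlim := hlim0.add (hlim1.const_mul (2 * Real.pi : ℂ))
  simp_rw [hconst] at hlim
  have huniq := tendsto_nhds_unique tendsto_const_nhds hlim
  obtain ⟨m, rfl⟩ := Nat.exists_eq_add_of_le hn
  have := hconst m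
  rw [add_comm 2 m]
  change f (m + 2) = _
  linear_combination this + huniq

theorem ExpGrowth.natCast_cpow {q : ℕ} (hq : q ≠ 0) (a b : ℝ) : ExpGrowth (fun z => (q : ℂ) ^ z) a b :=
  (ExpGrowth.const_cpow (c := q) (by positivity) (u := 1) (v := 0)).congr fun z _ _ => by simp

theorem differentiableAt_natCast_cpow {q : ℕ} (hq : q ≠ 0) (z : ℂ) :
    DifferentiableAt ℂ (fun z => (q : ℂ) ^ z) z :=
  differentiableAt_id.const_cpow (Or.inl (Nat.cast_ne_zero.mpr hq))

/-! ### The gamma factor of the even functional equation -/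

/-- The factor `Gammaℂ w * cos (π w / 2)` of the even functional equation. -/
noncomputable def gammaFactor (w : ℂ) : ℂ := expMellin 1 w + expMellin (-1) w

theorem gammaFactor_eq (w : ℂ) : gammaFactor w = Gammaℂ w * Complex.cos (Real.pi * w / 2) := by
  have h1 : cexp (Real.pi * w / 2 * I) + cexp (-(Real.pi * w / 2) * I) =
      2 * Complex.cos (Real.pi * w / 2) := by
    rw [Complex.cos]; ring
  rw [gammaFactor, expMellin, expMellin, Gammaℂ,
    show (((-1 : ℝ) : ℂ) * Real.pi * w / 2 * I) = -(Real.pi * w / 2) * I by push_cast; ring]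
  push_cast
  rw [one_mul]
  linear_combination (2 * (Real.pi : ℂ)) ^ (-w) * Complex.Gamma w * h1

/-- The factor equals `Gammaℝ w / Gammaℝ (1 - w)`. Integers are excluded because zeros, poles and
default values sit there. -/
theorem gammaFactor_mul_gammaFactor_one_sub {w : ℂ} (hw : ∀ n : ℤ, w ≠ n) :
    gammaFactor w * gammaFactor (1 - w) = 1 := by
  rw [gammaFactor_eq, gammaFactor_eq, ← Gammaℝ_div_Gammaℝ_one_sub fun n h => hw (-(2 * n + 1))
    (by rw [h]; push_cast; ring), ← Gammaℝ_div_Gammaℝ_one_sub fun n h => hw (2 * n + 2)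
    (by push_cast; linear_combination -h), sub_sub_cancel]
  have h1 : Gammaℝ w ≠ 0 := fun h => by
    obtain ⟨n, hn⟩ := Gammaℝ_eq_zero_iff.mp h
    exact hw (-(2 * n)) (by rw [hn]; push_cast; ring)
  have h2 : Gammaℝ (1 - w) ≠ 0 := fun h => by
    obtain ⟨n, hn⟩ := Gammaℝ_eq_zero_iff.mp h
    exact hw (1 + 2 * n) (by push_cast; linear_combination -hn)
  field_simp

theorem ne_intCast_of_re {w : ℂ} {n : ℤ} (h1 : n < w.re) (h2 : w.re < n + 1) (m : ℤ) : w ≠ m := by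
  rintro rfl
  simp only [intCast_re] at h1 h2
  have h3 : n < m := by exact_mod_cast h1
  have h4 : m < n + 1 := by exact_mod_cast h2
  omega

/-- `w * gammaFactor w`, holomorphic for `-1 < w.re`. -/
noncomputable def gammaFactorReg (w : ℂ) : ℂ := expMellinReg 1 w + expMellinReg (-1) w

theorem gammaFactorReg_eq {w : ℂ} (hw : w ≠ 0) : gammaFactorReg w = w * gammaFactor w := by
  rw [gammaFactorReg, gammaFactor, expMellinReg_eq _ hw, expMellinReg_eq _ hw]; ring

theorem differentiableAt_gammaFactorReg {w : ℂ} (hw : -1 < w.re) :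
    DifferentiableAt ℂ gammaFactorReg w :=
  (differentiableAt_expMellinReg 1 hw).add (differentiableAt_expMellinReg (-1) hw)

theorem expGrowth_gammaFactorReg {a b : ℝ} (ha : -1 < a) : ExpGrowth gammaFactorReg a b :=
  (expGrowth_expMellinReg 1 ha).add (expGrowth_expMellinReg (-1) ha)

theorem hasDerivAt_gammaFactor {w : ℂ} (hw : -1 < w.re) (h0 : w ≠ 0) :
    HasDerivAt gammaFactor ((w * deriv gammaFactorReg w - gammaFactorReg w) / w ^ 2) w := by
  have h1 := (differentiableAt_gammaFactorReg hw).hasDerivAt.fun_div (hasDerivAt_id w) h0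
  refine (h1.congr_of_eventuallyEq ?_).congr_deriv (by simp; ring)
  filter_upwards [isOpen_ne.mem_nhds h0] with z hz
  rw [gammaFactorReg_eq hz, id, mul_div_cancel_left₀ _ hz]

/-- Differentiated form of `γ(w) γ(1 - w) = 1`: the logarithmic derivative is symmetric under `w ↦ 1
- w`. -/
theorem deriv_gammaFactor_mul {w : ℂ} (h1 : -1 < w.re) (h2 : w.re < 0) :
    deriv gammaFactor w * gammaFactor (1 - w) = gammaFactor w * deriv gammaFactor (1 - w) := by
  have hne : ∀ z : ℂ, z.re ≠ 0 → z ≠ 0 := fun z hz h => hz (by rw [h]; simp)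
  have d1 := (hasDerivAt_gammaFactor h1 (hne w h2.ne)).differentiableAt.hasDerivAt
  have d2 := (hasDerivAt_gammaFactor (w := 1 - w) (by simp; linarith)
    (hne _ (by simp; linarith))).differentiableAt.hasDerivAt
  have d3 : HasDerivAt (fun z => gammaFactor (1 - z)) (-deriv gammaFactor (1 - w)) w := by
    simpa using d2.comp_const_sub 1 w
  have d4 := d1.fun_mul d3
  have d5 : HasDerivAt (fun z => gammaFactor z * gammaFactor (1 - z)) 0 w := by
    refine (hasDerivAt_const w (1 : ℂ)).congr_of_eventuallyEq ?_
    have ho : IsOpen {z : ℂ | -1 < z.re ∧ z.re < 0} :=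
      (isOpen_lt continuous_const continuous_re).inter (isOpen_lt continuous_re continuous_const)
    filter_upwards [ho.mem_nhds ⟨h1, h2⟩] with z hz
    exact gammaFactor_mul_gammaFactor_one_sub (ne_intCast_of_re (n := -1) (by simpa using hz.1)
      (by simpa using hz.2))
  linear_combination d4.unique d5

theorem gammaFactor_one_half : gammaFactor (1 / 2) = 1 := by
  rw [gammaFactor_eq]; exact Gammaℂ_one_half_mul_cos

/-- The archimedean constants of the main term. As `γ(1/2) = 1`, this is the logarithmic derivative;
the cosine contributes `-(π/2) tan(π/4)`. -/
theorem deriv_gammaFactor_one_half : deriv gammaFactor (1 / 2) =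
    ((logDeriv Real.Gamma (1 / 2) - Real.log (2 * Real.pi) - Real.pi / 2 : ℝ) : ℂ) := by
  have hΓ : HasDerivAt Complex.Gamma ((logDeriv Real.Gamma (1 / 2) : ℝ) * Complex.Gamma (1 / 2)) (1 / 2) := by
    refine Complex.hasDerivAt_Gamma_one_half.congr_deriv ?_
    have h1 : Complex.Gamma (1 / 2) = (Real.Gamma (1 / 2) : ℝ) := by
      rw [← Complex.Gamma_ofReal]; norm_num
    rw [h1, ← ofReal_mul, logDeriv_apply, Real.hasDerivAt_Gamma_one_half.deriv,
      div_mul_cancel₀ _ (Real.Gamma_pos_of_pos (by norm_num)).ne']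
    have h2 : Complex.log 2 = (Real.log 2 : ℝ) := by rw [Complex.ofReal_log (by norm_num)]; norm_num
    rw [h2]
    push_cast; ring
  have hpow : HasDerivAt (fun w : ℂ => (2 * Real.pi : ℂ) ^ (-w))
      (-(Real.log (2 * Real.pi) : ℝ) * (2 * Real.pi : ℂ) ^ (-(1 / 2 : ℂ))) (1 / 2) := by
    have h0 : (2 * Real.pi : ℂ) ≠ 0 := by
      have := two_pi_ofReal_ne_zero; push_cast at this; exact this
    refine ((hasDerivAt_id' (1 / 2 : ℂ)).fun_neg.const_cpow (c := (2 * Real.pi : ℂ)) (Or.inl h0)).congr_deriv ?_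
    rw [Complex.ofReal_log (by positivity)]
    push_cast
    ring
  have hcos : HasDerivAt (fun w : ℂ => Complex.cos (Real.pi * w / 2))
      (-(Real.pi / 2) * Complex.cos (Real.pi * (1 / 2) / 2)) (1 / 2) := by
    have h1 : HasDerivAt (fun w : ℂ => Real.pi * w / 2) (Real.pi / 2 : ℂ) (1 / 2) := by
      simpa using ((hasDerivAt_id (1 / 2 : ℂ)).const_mul (Real.pi : ℂ)).div_const 2
    refine h1.ccos.congr_deriv ?_
    have h2 : Complex.sin (Real.pi * (1 / 2) / 2) = Complex.cos (Real.pi * (1 / 2) / 2) := by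
      rw [← Complex.cos_pi_div_two_sub]
      congr 1; ring
    rw [h2]; ring
  have h := ((hpow.fun_mul hΓ).fun_mul hcos).const_mul (2 : ℂ)
  have h' : HasDerivAt gammaFactor _ (1 / 2) := h.congr_of_eventuallyEq
    (Eventually.of_forall fun w => by
      rw [gammaFactor_eq, Gammaℂ]
      ring)
  rw [h'.deriv]
  have h3 := gammaFactor_one_half
  rw [gammaFactor_eq, Gammaℂ] at h3
  push_cast
  linear_combination ((logDeriv Real.Gamma (1 / 2) : ℝ) - (Real.log (2 * Real.pi) : ℝ) - Real.pi / 2 : ℂ) * h3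

/-! ### The approximate functional equation -/

/-- The kernel of the approximate functional equation divided by `(s - 1/2)²`. -/
noncomputable def afeKernelReg (s : ℂ) : ℂ :=
  -8 * ((2 * Real.pi : ℝ) : ℂ) ^ (-s - 1 / 2) * Complex.Gamma (s + 3 / 2) *
    dslope (fun s : ℂ => Complex.cos (Real.pi / 4 + Real.pi * s / 2)) ((1 / 2 : ℝ) : ℂ) s * cexp (s ^ 2)

/-- The kernel of the approximate functional equation. It has a double zero at `1 / 2`. -/
noncomputable def afeKernel (s : ℂ) : ℂ := (s - 1 / 2) ^ 2 * afeKernelReg s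

theorem differentiableAt_afeKernelReg {s : ℂ} (hs : -3 / 2 < s.re) :
    DifferentiableAt ℂ afeKernelReg s := by
  unfold afeKernelReg
  have h1 : DifferentiableAt ℂ (fun s => Complex.Gamma (s + 3 / 2)) s := by
    refine (Complex.differentiableAt_Gamma (s + 3 / 2) fun m h => ?_).comp s (by fun_prop)
    have h2 := congrArg Complex.re h
    simp at h2
    have h3 : (0 : ℝ) ≤ m := m.cast_nonneg
    linarith
  have h2 : DifferentiableAt ℂ (fun s : ℂ => ((2 * Real.pi : ℝ) : ℂ) ^ (-s - 1 / 2)) s :=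
    (by fun_prop : DifferentiableAt ℂ (fun s : ℂ => -s - 1 / 2) s).const_cpow
      (Or.inl two_pi_ofReal_ne_zero)
  have h3 : DifferentiableAt ℂ
      (dslope (fun s : ℂ => Complex.cos (Real.pi / 4 + Real.pi * s / 2)) ((1 / 2 : ℝ) : ℂ)) s :=
    differentiableAt_dslope_strip (a := min s.re 0 - 1) (b := max s.re 1)
      (by linarith [min_le_right s.re 0]) (by linarith [le_max_right s.re 1])
      (fun z _ _ => by fun_prop) (by linarith [min_le_left s.re 0]) (le_max_left _ _)
  exact (((h2.const_mul (-8)).mul h1).mul h3).mul (by fun_prop)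

theorem rapidDecay_afeKernelReg {a b : ℝ} (ha : -3 / 2 < a) : RapidDecay afeKernelReg a b := by
  unfold afeKernelReg
  refine ExpGrowth.mul_exp_sq (ExpGrowth.mul (ExpGrowth.mul ((ExpGrowth.const _).mul ?_) ?_) ?_)
  · refine (ExpGrowth.const_cpow (c := 2 * Real.pi) (by positivity) (u := -1) (v := -1 / 2)).congr
      fun z _ _ => ?_
    congr 1; push_cast; ring
  · refine ((ExpGrowth.Gamma (a := a + 3 / 2) (b := b + 3 / 2) (by linarith)).comp_add_const
      (3 / 2)).mono (by linarith) (by linarith) |>.congr fun z _ _ => by push_cast; rfl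
  · refine ExpGrowth.dslope (fun z h1 h2 => ?_) ?_
    · exact differentiableAt_dslope_strip (a := min z.re 0 - 1) (b := max z.re 1)
        (by linarith [min_le_right z.re 0]) (by linarith [le_max_right z.re 1])
        (fun z _ _ => by fun_prop) (by linarith [min_le_left z.re 0]) (le_max_left _ _)
    · refine ⟨1 + Real.pi, by positivity, fun z _ _ => (Complex.norm_cos_le_exp _).trans ?_⟩
      have h1 : (Real.pi / 4 + Real.pi * z / 2 : ℂ).im = Real.pi / 2 * z.im := by
        rw [show (Real.pi / 4 + Real.pi * z / 2 : ℂ) = ((Real.pi / 4 : ℝ) : ℂ) + ((Real.pi / 2 : ℝ) : ℂ) * z by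
          push_cast; ring, add_im, ofReal_im, zero_add, im_ofReal_mul]
      rw [h1, abs_mul, abs_of_pos (by positivity)]
      calc _ ≤ 1 * Real.exp ((1 + Real.pi) * |z.im|) := by
            rw [one_mul]; gcongr; linarith [Real.pi_pos]
        _ ≤ _ := by gcongr; linarith [Real.pi_pos]

theorem differentiableAt_afeKernel {s : ℂ} (hs : -3 / 2 < s.re) : DifferentiableAt ℂ afeKernel s :=
  (by fun_prop : DifferentiableAt ℂ (fun s : ℂ => (s - 1 / 2) ^ 2) s).mul (differentiableAt_afeKernelReg hs)

theorem rapidDecay_afeKernel {a b : ℝ} (ha : -3 / 2 < a) : RapidDecay afeKernel a b :=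
  ((rapidDecay_afeKernelReg ha).mul_expGrowth
    ((ExpGrowth.id.sub (ExpGrowth.const (1 / 2))).pow 2)).congr fun _ _ _ => mul_comm _ _

/-- In `1 - 4 s² = -4 (s - 1/2)(s + 1/2)` the second factor cancels the pole of the Gamma function
at `-1/2`. The first joins the zero of the cosine at `1/2` to give a double zero, just what the
double pole of the trivial character requires. -/
theorem afeKernel_eq {s : ℂ} (hs : s ≠ -1 / 2) :
    afeKernel s = gammaFactor (1 / 2 + s) * (1 - 4 * s ^ 2) * cexp (s ^ 2) := by
  have h1 : (s - 1 / 2) * dslope (fun s : ℂ => Complex.cos (Real.pi / 4 + Real.pi * s / 2))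
      ((1 / 2 : ℝ) : ℂ) s = Complex.cos (Real.pi / 4 + Real.pi * s / 2) := by
    have h2 := sub_smul_dslope (fun s : ℂ => Complex.cos (Real.pi / 4 + Real.pi * s / 2))
      ((1 / 2 : ℝ) : ℂ) s
    have h3 : Complex.cos (Real.pi / 4 + Real.pi * ((1 / 2 : ℝ) : ℂ) / 2) = 0 := by
      rw [show (Real.pi / 4 + Real.pi * ((1 / 2 : ℝ) : ℂ) / 2 : ℂ) = Real.pi / 2 by push_cast; ring]
      exact Complex.cos_pi_div_two
    rw [h3, sub_zero, smul_eq_mul] at h2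
    rw [← h2]; push_cast; ring
  have h4 : s + 1 / 2 ≠ 0 := fun h => hs (by linear_combination h)
  have h5 : Complex.Gamma (s + 3 / 2) = (s + 1 / 2) * Complex.Gamma (s + 1 / 2) := by
    rw [← Complex.Gamma_add_one _ h4]; congr 1; ring
  rw [afeKernel, afeKernelReg, gammaFactor_eq, Gammaℂ, h5, add_comm (1 / 2 : ℂ) s,
    show -(s + 1 / 2) = -s - 1 / 2 by ring,
    show (Real.pi * (s + 1 / 2) / 2 : ℂ) = Real.pi / 4 + Real.pi * s / 2 by ring, ← h1]
  push_cast
  ring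

theorem afeKernel_zero : afeKernel 0 = 1 := by
  rw [afeKernel_eq (by norm_num), add_zero, gammaFactor_one_half]; simp

/-- This symmetry matches the functional equation of `evenPrimitiveTwist`, so that kernel, moment
and `q ^ s` multiply to an even function. -/
theorem gammaFactor_sq_mul_afeKernel_neg {s : ℂ} (hs : ∀ n : ℤ, 1 / 2 + s ≠ n) :
    gammaFactor (1 / 2 + s) ^ 2 * afeKernel (-s) = afeKernel s := by
  have h1 := gammaFactor_mul_gammaFactor_one_sub hs
  rw [afeKernel_eq (s := s) fun h => hs 0 (by push_cast; linear_combination h),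
    afeKernel_eq (s := -s) fun h => hs 1 (by push_cast; linear_combination -h),
    show (1 / 2 + -s : ℂ) = 1 - (1 / 2 + s) by ring, neg_sq]
  linear_combination gammaFactor (1 / 2 + s) * (1 - 4 * s ^ 2) * cexp (s ^ 2) * h1

/-- The approximate functional equation for `evenPrimitiveTwist` at the central point. -/
theorem integral_evenPrimitiveTwist {q : ℕ} [NeZero q] (hq : 1 < q) :
    ∫ t : ℝ, evenPrimitiveTwist q (1 / 2 + ((3 / 4 : ℝ) + t * I)) *
      (q : ℂ) ^ (((3 / 4 : ℝ) : ℂ) + t * I) * (afeKernel ((3 / 4 : ℝ) + t * I) / ((3 / 4 : ℝ) + t * I)) =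
      Real.pi * evenPrimitiveTwist q (1 / 2) := by
  have hq0 : q ≠ 0 := by omega
  set E : ℂ → ℂ := fun s => afeKernel s * (evenPrimitiveTwist q (s + (1 / 2 : ℝ)) * (q : ℂ) ^ s) with hE
  have hEd : ∀ z : ℂ, -(3 / 4) ≤ z.re → z.re ≤ 3 / 4 → DifferentiableAt ℂ E z := fun z h1 _ =>
    (differentiableAt_afeKernel (by linarith)).mul
      (((differentiable_evenPrimitiveTwist hq _).comp z (by fun_prop)).mul
        (differentiableAt_natCast_cpow hq0 z))
  have hEr : RapidDecay E (-(3 / 4)) (3 / 4) :=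
    (rapidDecay_afeKernel (by norm_num)).mul_expGrowth (ExpGrowth.mul
      (((expGrowth_evenPrimitiveTwist hq (b := -1 / 4) (c := 5 / 4) (by norm_num)).comp_add_const
        (1 / 2)).mono (by norm_num) (by norm_num)) (ExpGrowth.natCast_cpow hq0 _ _))
  have hint : Integrable fun t : ℝ => E ((3 / 4 : ℝ) + t * I) / ((3 / 4 : ℝ) + t * I) := by
    have h1 := hEr.integrable hEd (σ := 3 / 4) (by norm_num) le_rfl
    simp_rw [div_eq_mul_inv]
    refine h1.mul_bdd (c := 4 / 3) (Continuous.aestronglyMeasurable ?_) (Eventually.of_forall fun t => ?_)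
    · exact Continuous.inv₀ (by fun_prop) (vertical_ne_zero (by norm_num))
    · rw [norm_inv, inv_le_comm₀ (norm_pos_iff.mpr (vertical_ne_zero (by norm_num) t)) (by norm_num)]
      refine le_trans ?_ (abs_le_norm_vertical (3 / 4) t)
      rw [abs_of_pos] <;> norm_num
  have heven : ∀ t : ℝ, E (-((3 / 4 : ℝ) + t * I)) = E ((3 / 4 : ℝ) + t * I) := by
    intro t
    set s : ℂ := (3 / 4 : ℝ) + t * I with hs
    have hsre : s.re = 3 / 4 := by simp [hs]
    have h1 := evenPrimitiveTwist_one_sub hq (s := 1 / 2 + s) (by rw [add_re, hsre]; norm_num)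
    rw [← gammaFactor_eq] at h1
    have h2 := gammaFactor_sq_mul_afeKernel_neg (s := s) (ne_intCast_of_re (n := 1)
      (by rw [add_re, hsre]; norm_num) (by rw [add_re, hsre]; norm_num))
    have hqc : (q : ℂ) ≠ 0 := Nat.cast_ne_zero.mpr hq0
    have h3 : (q : ℂ) ^ (2 * (1 / 2 + s) - 1) * (q : ℂ) ^ (-s) = (q : ℂ) ^ s := by
      rw [← cpow_add _ _ hqc]; congr 1; ring
    simp only [hE]
    rw [show -s + ((1 / 2 : ℝ) : ℂ) = 1 - (1 / 2 + s) by push_cast; ring, h1,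
      show s + ((1 / 2 : ℝ) : ℂ) = 1 / 2 + s by push_cast; ring, ← h2, ← h3]
    ring
  have main := integral_vertical_div_of_even (E := E) (b := 3 / 4) (by norm_num) hEd hEr.expGrowth heven hint
  have h0 : E 0 = evenPrimitiveTwist q (1 / 2) := by
    simp only [hE]
    rw [afeKernel_zero, zero_add, cpow_zero]
    push_cast; ring
  rw [h0] at main
  rw [← main]
  congr 1
  ext t
  simp only [hE]
  rw [add_comm (((3 / 4 : ℝ) : ℂ) + t * I) ((1 / 2 : ℝ) : ℂ)]
  push_cast; ring

/-! ### The weight and its integrals against the gamma factor -/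

/-- The weight `afeKernel s / s`. -/
noncomputable def afeWeight (s : ℂ) : ℂ := afeKernel s / s

theorem differentiableAt_afeWeight {s : ℂ} (hs : 0 < s.re) : DifferentiableAt ℂ afeWeight s :=
  (differentiableAt_afeKernel (by linarith)).div differentiableAt_id fun h => by
    rw [h] at hs; simp at hs

theorem rapidDecay_afeWeight {a b : ℝ} (ha : 0 < a) : RapidDecay afeWeight a b := by
  refine ((rapidDecay_afeKernel (a := a) (b := b) (by linarith)).mul_expGrowth
    (ExpGrowth.of_bounded (f := fun s => s⁻¹) (K := a⁻¹) fun z h1 _ => ?_)).congr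
    fun z _ _ => div_eq_mul_inv _ _
  rw [norm_inv]
  exact inv_anti₀ ha (h1.trans (Complex.re_le_norm z))

theorem norm_gammaFactor_le (n : ℕ) (t : ℝ) : ‖gammaFactor ((1 / 2 - n : ℝ) + t * I)‖ ≤
    2 * (6 * Real.pi) ^ n * ((1 + |t|) ^ n)⁻¹ := by
  refine (norm_add_le _ _).trans ?_
  have h1 := norm_expMellin_le (Or.inl rfl) n t
  have h2 := norm_expMellin_le (Or.inr rfl) n t
  linarith

/-- With `w = 1/2 - s` the product `γ(1/2 - s) γ(1/2 + s) = 1` removes the gamma factors. The even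
function `(1 - 4 s²) exp (s²)` against `1 / s` remains, which gives half a residue. -/
theorem integral_gammaFactor_mul_afeWeight :
    ∫ t : ℝ, gammaFactor ((1 / 2 - (1 : ℕ) : ℝ) + t * I) *
      afeWeight (1 / 2 - ((1 / 2 - (1 : ℕ) : ℝ) + t * I)) = Real.pi := by
  set E : ℂ → ℂ := fun s => (1 - 4 * s ^ 2) * cexp (s ^ 2) with hE
  have hEr : RapidDecay E (-1) 1 := ExpGrowth.mul_exp_sq
    ((ExpGrowth.const 1).sub ((ExpGrowth.const 4).mul (ExpGrowth.id.pow 2)))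
  have hEd : ∀ z : ℂ, -1 ≤ z.re → z.re ≤ 1 → DifferentiableAt ℂ E z := fun z _ _ => by
    simp only [hE]; fun_prop
  have hint : Integrable fun t : ℝ => E ((1 : ℝ) + t * I) / ((1 : ℝ) + t * I) := by
    have h1 := hEr.integrable hEd (σ := 1) (by norm_num) le_rfl
    simp_rw [div_eq_mul_inv]
    refine h1.mul_bdd (c := 1) (Continuous.aestronglyMeasurable ?_) (Eventually.of_forall fun t => ?_)
    · exact Continuous.inv₀ (by fun_prop) (vertical_ne_zero (by norm_num))
    · rw [norm_inv]
      refine inv_le_one_of_one_le₀ (le_trans ?_ (abs_le_norm_vertical 1 t))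
      simp
  have main := integral_vertical_div_of_even (E := E) (b := 1) one_pos hEd hEr.expGrowth
    (fun t => by simp only [hE, neg_sq]) hint
  have h0 : E 0 = 1 := by simp [hE]
  rw [h0, mul_one] at main
  rw [← main, ← integral_neg_eq_self]
  congr 1
  ext t
  have hw : (((1 / 2 - (1 : ℕ) : ℝ) : ℂ) + (-t : ℝ) * I) = 1 - (1 / 2 + ((1 : ℝ) + t * I)) := by
    push_cast; ring
  set s : ℂ := (1 : ℝ) + t * I with hs
  have hsre : s.re = 1 := by simp [hs]
  have h1 := gammaFactor_mul_gammaFactor_one_sub (w := 1 / 2 + s) (ne_intCast_of_re (n := 1)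
      (by rw [add_re, hsre]; norm_num) (by rw [add_re, hsre]; norm_num))
  rw [hw, show (1 / 2 - (1 - (1 / 2 + s)) : ℂ) = s by ring, afeWeight, afeKernel_eq fun h => by
    rw [h] at hsre; norm_num at hsre]
  simp only [hE]
  linear_combination (1 - 4 * s ^ 2) * cexp (s ^ 2) / s * h1

/-- Evenness of `K(s) γ'(1/2 - s)`, from the symmetry of the logarithmic derivative of `γ`. -/
theorem afeKernel_mul_deriv_gammaFactor {s : ℂ} (hs : s.re = 1) :
    afeKernel s * deriv gammaFactor (1 / 2 - s) = afeKernel (-s) * deriv gammaFactor (1 / 2 - -s) := by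
  have h1 := deriv_gammaFactor_mul (w := 1 / 2 - s) (by rw [sub_re, hs]; norm_num)
    (by rw [sub_re, hs]; norm_num)
  rw [afeKernel_eq fun h => by rw [h] at hs; norm_num at hs,
    afeKernel_eq fun h => by rw [neg_eq_iff_eq_neg.mp h] at hs; norm_num at hs, neg_sq,
    show (1 / 2 + -s : ℂ) = 1 / 2 - s by ring, show (1 / 2 - -s : ℂ) = 1 - (1 / 2 - s) by ring,
    show (1 / 2 + s : ℂ) = 1 - (1 / 2 - s) by ring]
  linear_combination (1 - 4 * s ^ 2) * cexp (s ^ 2) * h1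

/-- The double zero of the kernel cancels the double pole of `γ'(1/2 - s)` at `s = 1/2`, so the
right side continues the product across this point. -/
theorem deriv_gammaFactor_mul_afeKernel {s : ℂ} (hs : s.re < 3 / 2) (h0 : s ≠ 1 / 2) :
    afeKernel s * deriv gammaFactor (1 / 2 - s) =
      afeKernelReg s * ((1 / 2 - s) * deriv gammaFactorReg (1 / 2 - s) - gammaFactorReg (1 / 2 - s)) := by
  have h1 : (1 / 2 - s : ℂ) ≠ 0 := fun h => h0 (by linear_combination -h)
  rw [(hasDerivAt_gammaFactor (w := 1 / 2 - s) (by simp; linarith) h1).deriv, afeKernel,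
    show (s - 1 / 2 : ℂ) ^ 2 = (1 / 2 - s) ^ 2 by ring]
  have h2 := pow_ne_zero 2 h1
  rw [mul_right_comm, mul_div_cancel₀ _ h2, mul_comm]

/-- Again an even function against `1 / s`; its value at the origin is `K(0) γ'(1/2)`. -/
theorem integral_deriv_gammaFactor_mul_afeWeight :
    (Integrable fun t : ℝ => deriv gammaFactor ((1 / 2 - (1 : ℕ) : ℝ) + t * I) *
      afeWeight (1 / 2 - ((1 / 2 - (1 : ℕ) : ℝ) + t * I))) ∧
    ∫ t : ℝ, deriv gammaFactor ((1 / 2 - (1 : ℕ) : ℝ) + t * I) *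
      afeWeight (1 / 2 - ((1 / 2 - (1 : ℕ) : ℝ) + t * I)) = Real.pi * deriv gammaFactor (1 / 2) := by
  set E : ℂ → ℂ := fun s => afeKernelReg s * ((((1 / 2 : ℝ) : ℂ) - s) *
    deriv gammaFactorReg (((1 / 2 : ℝ) : ℂ) - s) - gammaFactorReg (((1 / 2 : ℝ) : ℂ) - s)) with hE
  have hEr : RapidDecay E (-1) 1 := by
    refine (rapidDecay_afeKernelReg (by norm_num)).mul_expGrowth (ExpGrowth.sub (ExpGrowth.mul
      (ExpGrowth.sub (ExpGrowth.const _) ExpGrowth.id) ?_) ?_)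
    · have h1 := ((expGrowth_gammaFactorReg (a := -3 / 4) (b := 7 / 4) (by norm_num)).deriv
        (r := 1 / 4) (by norm_num) fun z hz _ => differentiableAt_gammaFactorReg (by linarith)).comp_const_sub (1 / 2)
      exact h1.mono (by norm_num) (by norm_num)
    · exact ((expGrowth_gammaFactorReg (a := -1 / 2) (b := 3 / 2) (by norm_num)).comp_const_sub (1 / 2)).mono
        (by norm_num) (by norm_num)
  have hEd : ∀ z : ℂ, -1 ≤ z.re → z.re ≤ 1 → DifferentiableAt ℂ E z := by
    intro z h1 h2
    have hre : -1 < (((1 / 2 : ℝ) : ℂ) - z).re := by simp; linarith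
    have ho : IsOpen {z : ℂ | -1 < z.re} := isOpen_lt continuous_const continuous_re
    have h3 : DifferentiableOn ℂ gammaFactorReg {z : ℂ | -1 < z.re} := fun w hw =>
      (differentiableAt_gammaFactorReg hw).differentiableWithinAt
    have h4 := (h3.deriv ho).differentiableAt (ho.mem_nhds hre)
    have h5 : DifferentiableAt ℂ (fun z => deriv gammaFactorReg (((1 / 2 : ℝ) : ℂ) - z)) z :=
      h4.comp z (by fun_prop)
    have h6 : DifferentiableAt ℂ (fun z => gammaFactorReg (((1 / 2 : ℝ) : ℂ) - z)) z :=
      (differentiableAt_gammaFactorReg hre).comp z (by fun_prop)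
    exact (differentiableAt_afeKernelReg (by linarith)).mul
      (((by fun_prop : DifferentiableAt ℂ (fun z : ℂ => ((1 / 2 : ℝ) : ℂ) - z) z).mul h5).sub h6)
  have hval : ∀ s : ℂ, s.re < 3 / 2 → s ≠ 1 / 2 → E s = afeKernel s * deriv gammaFactor (1 / 2 - s) := by
    intro s hs h0
    rw [deriv_gammaFactor_mul_afeKernel hs h0]
    simp only [hE]
    push_cast; rfl
  have hint : Integrable fun t : ℝ => E ((1 : ℝ) + t * I) / ((1 : ℝ) + t * I) := by
    have h1 := hEr.integrable hEd (σ := 1) (by norm_num) le_rfl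
    simp_rw [div_eq_mul_inv]
    refine h1.mul_bdd (c := 1) (Continuous.aestronglyMeasurable ?_) (Eventually.of_forall fun t => ?_)
    · exact Continuous.inv₀ (by fun_prop) (vertical_ne_zero (by norm_num))
    · rw [norm_inv]
      refine inv_le_one_of_one_le₀ (le_trans ?_ (abs_le_norm_vertical 1 t))
      simp
  have hre : ∀ t : ℝ, (((1 : ℝ) : ℂ) + t * I).re = 1 := fun t => by simp
  have hne : ∀ s : ℂ, s.re ≠ 1 / 2 → s ≠ 1 / 2 := fun s hs h => hs (by rw [h]; norm_num)
  have heven : ∀ t : ℝ, E (-((1 : ℝ) + t * I)) = E ((1 : ℝ) + t * I) := by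
    intro t
    rw [hval (-_) (by rw [neg_re, hre]; norm_num) (hne _ (by rw [neg_re, hre]; norm_num)),
      hval _ (by rw [hre]; norm_num) (hne _ (by rw [hre]; norm_num)), afeKernel_mul_deriv_gammaFactor (hre t)]
  have main := integral_vertical_div_of_even (E := E) (b := 1) one_pos hEd hEr.expGrowth heven hint
  rw [hval 0 (by norm_num) (by norm_num), afeKernel_zero, one_mul, sub_zero] at main
  have hfun : ∀ t : ℝ, deriv gammaFactor ((1 / 2 - (1 : ℕ) : ℝ) + (-t : ℝ) * I) *
      afeWeight (1 / 2 - ((1 / 2 - (1 : ℕ) : ℝ) + (-t : ℝ) * I)) =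
      E ((1 : ℝ) + t * I) / ((1 : ℝ) + t * I) := by
    intro t
    have hw : (((1 / 2 - (1 : ℕ) : ℝ) : ℂ) + (-t : ℝ) * I) = 1 / 2 - ((1 : ℝ) + t * I) := by
      push_cast; ring
    rw [hw, sub_sub_cancel, hval _ (by rw [hre]; norm_num) (hne _ (by rw [hre]; norm_num)), afeWeight]
    ring
  constructor
  · have h1 := (hint.congr (Eventually.of_forall fun t => (hfun t).symm)).comp_neg
    simpa only [neg_neg] using h1
  · rw [← main, ← integral_neg_eq_self]
    exact integral_congr_ae (Eventually.of_forall hfun)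

/-- Integration by parts along the line reduces this to the preceding integral. The sign is plus
because the weight is evaluated at `1/2 - w`. -/
theorem integral_gammaFactor_mul_deriv_afeWeight :
    ∫ t : ℝ, gammaFactor ((1 / 2 - (1 : ℕ) : ℝ) + t * I) *
      deriv afeWeight (1 / 2 - ((1 / 2 - (1 : ℕ) : ℝ) + t * I)) =
      Real.pi * deriv gammaFactor (1 / 2) := by
  obtain ⟨hi, hv⟩ := integral_deriv_gammaFactor_mul_afeWeight
  rw [← hv]
  have hline : ∀ t : ℝ, HasDerivAt (fun t : ℝ => ((1 / 2 - (1 : ℕ) : ℝ) : ℂ) + t * I) I t := fun t => by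
    simpa using ((hasDerivAt_id t).ofReal_comp.mul_const I).const_add (((1 / 2 - (1 : ℕ) : ℝ)) : ℂ)
  have hline' : ∀ t : ℝ, HasDerivAt (fun t : ℝ => (1 / 2 : ℂ) - (((1 / 2 - (1 : ℕ) : ℝ) : ℂ) + t * I)) (-I) t :=
    fun t => (hline t).const_sub _
  have hu : ∀ t : ℝ, HasDerivAt (fun t : ℝ => gammaFactor ((1 / 2 - (1 : ℕ) : ℝ) + t * I))
      (deriv gammaFactor ((1 / 2 - (1 : ℕ) : ℝ) + t * I) * I) t := fun t =>
    (hasDerivAt_gammaFactor (by norm_num) (vertical_ne_zero (by norm_num) t)).differentiableAt.hasDerivAt.comp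
      (h := fun t : ℝ => ((1 / 2 - (1 : ℕ) : ℝ) : ℂ) + t * I) t (hline t)
  have hv : ∀ t : ℝ, HasDerivAt (fun t : ℝ => afeWeight (1 / 2 - ((1 / 2 - (1 : ℕ) : ℝ) + t * I)))
      (deriv afeWeight (1 / 2 - ((1 / 2 - (1 : ℕ) : ℝ) + t * I)) * -I) t := fun t =>
    (differentiableAt_afeWeight (by norm_num)).hasDerivAt.comp
      (h := fun t : ℝ => (1 / 2 : ℂ) - (((1 / 2 - (1 : ℕ) : ℝ) : ℂ) + t * I)) t (hline' t)
  have hbd : ∀ t : ℝ, ‖gammaFactor ((1 / 2 - (1 : ℕ) : ℝ) + t * I)‖ ≤ 2 * (6 * Real.pi) ^ 1 := by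
    intro t
    refine (norm_gammaFactor_le 1 t).trans (mul_le_of_le_one_right (by positivity) ?_)
    exact inv_le_one_of_one_le₀ (by rw [pow_one]; linarith [abs_nonneg t])
  have hcont : Continuous fun t : ℝ => gammaFactor ((1 / 2 - (1 : ℕ) : ℝ) + t * I) :=
    continuous_iff_continuousAt.mpr fun t => (hu t).continuousAt
  have hpt : ∀ t : ℝ, (1 / 2 - (((1 / 2 - (1 : ℕ) : ℝ) : ℂ) + t * I)) = 1 - t * I := fun t => by
    push_cast; ring
  have hkd : ∀ z : ℂ, 1 / 2 ≤ z.re → z.re ≤ 2 → DifferentiableAt ℂ afeWeight z := fun z h _ =>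
    differentiableAt_afeWeight (by linarith)
  have hk := rapidDecay_afeWeight (a := 1 / 2) (b := 2) (by norm_num)
  have i1 : Integrable fun t : ℝ => gammaFactor ((1 / 2 - (1 : ℕ) : ℝ) + t * I) * afeWeight (1 - t * I) :=
    hk.integrable_mul hkd hcont hbd (by norm_num) (by norm_num)
  have ho : IsOpen {z : ℂ | 0 < z.re} := isOpen_lt continuous_const continuous_re
  have hdd : DifferentiableOn ℂ (deriv afeWeight) {z : ℂ | 0 < z.re} :=
    DifferentiableOn.deriv (fun z hz => (differentiableAt_afeWeight hz).differentiableWithinAt) ho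
  have i2 : Integrable fun t : ℝ => gammaFactor ((1 / 2 - (1 : ℕ) : ℝ) + t * I) *
      deriv afeWeight (1 - t * I) :=
    (hk.deriv (r := 1 / 4) (by norm_num) hkd).integrable_mul
      (fun z hz _ => hdd.differentiableAt (ho.mem_nhds (show 0 < z.re by linarith))) hcont hbd
      (by norm_num) (by norm_num)
  have main := integral_mul_deriv_eq_deriv_mul_of_integrable (fun t _ => hu t) (fun t _ => hv t)
    (by
      refine (i2.mul_const (-I)).congr (Eventually.of_forall fun t => ?_)
      simp only [Pi.mul_apply, hpt]; ring)
    (by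
      refine (hi.mul_const I).congr (Eventually.of_forall fun t => ?_)
      simp only [Pi.mul_apply]; ring)
    (by
      refine i1.congr (Eventually.of_forall fun t => ?_)
      simp only [Pi.mul_apply, hpt])
  have e1 : ∀ t : ℝ, gammaFactor ((1 / 2 - (1 : ℕ) : ℝ) + t * I) *
      (deriv afeWeight (1 / 2 - ((1 / 2 - (1 : ℕ) : ℝ) + t * I)) * -I) =
      -I * (gammaFactor ((1 / 2 - (1 : ℕ) : ℝ) + t * I) *
      deriv afeWeight (1 / 2 - ((1 / 2 - (1 : ℕ) : ℝ) + t * I))) := fun t => by ring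
  have e2 : ∀ t : ℝ, deriv gammaFactor ((1 / 2 - (1 : ℕ) : ℝ) + t * I) * I *
      afeWeight (1 / 2 - ((1 / 2 - (1 : ℕ) : ℝ) + t * I)) =
      I * (deriv gammaFactor ((1 / 2 - (1 : ℕ) : ℝ) + t * I) *
      afeWeight (1 / 2 - ((1 / 2 - (1 : ℕ) : ℝ) + t * I))) := fun t => by ring
  simp_rw [e1, e2] at main
  rw [integral_const_mul, integral_const_mul] at main
  refine mul_left_cancel₀ (neg_ne_zero.mpr I_ne_zero) ?_
  rw [main]; ring

theorem ExpGrowth.ofReal_cpow_neg {x : ℝ} (hx : 0 < x) (a b : ℝ) :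
    ExpGrowth (fun z => (x : ℂ) ^ (-z)) a b :=
  (ExpGrowth.const_cpow hx (u := -1) (v := 0)).congr fun z _ _ => by simp

theorem differentiable_ofReal_cpow_neg {x : ℝ} (hx : 0 < x) :
    Differentiable ℂ fun z : ℂ => (x : ℂ) ^ (-z) := fun _ =>
  differentiableAt_id.neg.const_cpow (Or.inl (ofReal_ne_zero.mpr hx.ne'))

theorem integrable_cpow_neg_mul_afeWeight {x σ : ℝ} (hx : 0 < x) (hσ : 0 < σ) :
    Integrable fun t : ℝ => (x : ℂ) ^ (-((σ : ℂ) + t * I)) * afeWeight (σ + t * I) := by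
  have h1 := (rapidDecay_afeWeight hσ).mul_expGrowth (ExpGrowth.ofReal_cpow_neg hx σ (σ + 1))
  refine (h1.integrable (fun z hz _ => ?_) le_rfl (by linarith)).congr
    (Eventually.of_forall fun t => mul_comm _ _)
  exact (differentiableAt_afeWeight (by linarith)).mul (differentiable_ofReal_cpow_neg hx z)

theorem integral_cpow_neg_mul_afeWeight {x σ τ : ℝ} (hx : 0 < x) (hσ : 0 < σ) (hτ : σ ≤ τ) :
    ∫ t : ℝ, (x : ℂ) ^ (-((σ : ℂ) + t * I)) * afeWeight (σ + t * I) =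
      ∫ t : ℝ, (x : ℂ) ^ (-((τ : ℂ) + t * I)) * afeWeight (τ + t * I) := by
  obtain ⟨C, -, hC⟩ := ((ExpGrowth.ofReal_cpow_neg hx σ τ).mul (rapidDecay_afeWeight hσ (b := τ)).expGrowth)
  exact integral_vertical_eq (g := fun z => (x : ℂ) ^ (-z) * afeWeight z) hτ (fun z hz _ =>
    (differentiable_ofReal_cpow_neg hx z).mul (differentiableAt_afeWeight (by linarith))) hC
    (integrable_cpow_neg_mul_afeWeight hx hσ) (integrable_cpow_neg_mul_afeWeight hx (hσ.trans_le hτ))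

/-! ### The Mellin transform of the weight times `exp (2πiux) - 1` -/

/-- The Mellin transform of the product of the weight with the `n`-th Taylor remainder of
`exp (2πiux)`. -/
noncomputable def taylorWeight (u : ℝ) (n : ℕ) (z : ℂ) : ℂ :=
  1 / (2 * Real.pi) * ∫ t : ℝ, expMellin u ((1 / 2 - n : ℝ) + t * I) *
    afeWeight (z - ((1 / 2 - n : ℝ) + t * I))

theorem taylorWeight_eq (u : ℝ) (n : ℕ) : taylorWeight u n = fun z => 1 / (2 * Real.pi) *
    ∫ t : ℝ, expMellin u ((1 / 2 - n : ℝ) + t * I) *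
      (fun z => afeWeight (z + ((n - 1 / 2 : ℝ) : ℂ))) (z - t * I) := by
  ext z
  simp only [taylorWeight]
  congr 2
  ext t
  congr 2
  push_cast; ring

theorem norm_expMellin_le_const {u : ℝ} (hu : u = 1 ∨ u = -1) (n : ℕ) (t : ℝ) :
    ‖expMellin u ((1 / 2 - n : ℝ) + t * I)‖ ≤ (6 * Real.pi) ^ n :=
  (norm_expMellin_le hu n t).trans (mul_le_of_le_one_right (by positivity)
    (inv_le_one_of_one_le₀ (one_le_pow₀ (by linarith [abs_nonneg t]))))

theorem rapidDecay_afeWeight_comp_add {a b c : ℝ} (ha : 0 < a + c) :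
    RapidDecay (fun z => afeWeight (z + (c : ℂ))) a b :=
  ((rapidDecay_afeWeight (b := b + c) ha).comp_add_const c).mono (by linarith) (by linarith)

theorem differentiableAt_afeWeight_comp_add {c : ℝ} {z : ℂ} (hz : 0 < z.re + c) :
    DifferentiableAt ℂ (fun z => afeWeight (z + (c : ℂ))) z :=
  (differentiableAt_afeWeight (by simpa using hz)).comp z (by fun_prop)

theorem hasDerivAt_taylorWeight {u : ℝ} (hu : u = 1 ∨ u = -1) {n : ℕ} {z : ℂ} (hz : 1 / 2 - n < z.re) :
    HasDerivAt (taylorWeight u n) (1 / (2 * Real.pi) * ∫ t : ℝ, expMellin u ((1 / 2 - n : ℝ) + t * I) *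
      deriv afeWeight (z - ((1 / 2 - n : ℝ) + t * I))) z := by
  rw [taylorWeight_eq]
  have h1 := (rapidDecay_afeWeight_comp_add (a := (z.re + (1 / 2 - n)) / 2) (b := z.re + 1)
    (c := n - 1 / 2) (by linarith)).hasDerivAt_integral (fun w hw _ =>
      differentiableAt_afeWeight_comp_add (by linarith)) (continuous_expMellin u n)
      (norm_expMellin_le_const hu n) (z := z) (by linarith) (by linarith)
  refine (h1.const_mul (1 / (2 * Real.pi) : ℂ)).congr_deriv ?_
  congr 2
  ext t
  congr 1
  rw [deriv_comp_add_const]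
  congr 1
  push_cast; ring

theorem exists_norm_taylorWeight_le {u : ℝ} (hu : u = 1 ∨ u = -1) (n : ℕ) {a b : ℝ} (ha : 1 / 2 - n < a) :
    ∃ C : ℝ, 0 ≤ C ∧ ∀ z : ℂ, a ≤ z.re → z.re ≤ b → ‖taylorWeight u n z‖ ≤ C * ((1 + |z.im|) ^ n)⁻¹ := by
  obtain ⟨C, h0, hC⟩ := (rapidDecay_afeWeight_comp_add (a := a) (b := b)
    (c := n - 1 / 2) (by linarith)).exists_norm_integral_le (norm_expMellin_le hu n)
  refine ⟨‖(1 / (2 * Real.pi) : ℂ)‖ * C, by positivity, fun z h1 h2 => ?_⟩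
  rw [taylorWeight_eq]
  simp only
  rw [norm_mul, mul_assoc]
  gcongr
  exact hC z h1 h2

/-- The difference is the residue of `expMellin` at `-n`; multiplying the original function by `x ^
n` shifts its Mellin transform by `n`. -/
theorem taylorWeight_sub {u : ℝ} (hu : u = 1 ∨ u = -1) {n : ℕ} {z : ℂ} (hz : 1 / 2 - n < z.re) :
    taylorWeight u n z - taylorWeight u (n + 1) z =
      (2 * Real.pi * u * I) ^ n / n.factorial * afeWeight (z + n) := by
  have hk : RapidDecay (fun w => afeWeight (z - w)) (1 / 2 - (n + 1 : ℕ)) (1 / 2 - n) := by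
    refine ((rapidDecay_afeWeight (a := z.re - (1 / 2 - n)) (b := z.re - (1 / 2 - (n + 1 : ℕ)))
      (by linarith)).comp_const_sub z).mono ?_ ?_ <;> linarith
  have hd : ∀ w : ℂ, 1 / 2 - ((n + 1 : ℕ) : ℝ) ≤ w.re → w.re ≤ 1 / 2 - n →
      DifferentiableAt ℂ (fun w => afeWeight (z - w)) w := fun w _ h2 =>
    (differentiableAt_afeWeight (by simp; linarith)).comp w (by fun_prop)
  have hint : ∀ m : ℕ, (1 / 2 - ((n + 1 : ℕ) : ℝ)) ≤ 1 / 2 - m → (1 / 2 - m : ℝ) ≤ 1 / 2 - n →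
      Integrable fun t : ℝ => expMellin u ((1 / 2 - m : ℝ) + t * I) *
        afeWeight (z - ((1 / 2 - m : ℝ) + t * I)) := fun m h1 h2 =>
    (hk.integrable hd h1 h2).bdd_mul (c := (6 * Real.pi) ^ m) (continuous_expMellin u m).aestronglyMeasurable
      (Eventually.of_forall (norm_expMellin_le_const hu m))
  have main := integral_expMellin_mul_sub hu n hd hk.expGrowth
    (hint (n + 1) le_rfl (by push_cast; linarith)) (hint n (by push_cast; linarith) le_rfl)
  rw [taylorWeight, taylorWeight, ← mul_sub, main, sub_neg_eq_add]
  have : (Real.pi : ℂ) ≠ 0 := ofReal_ne_zero.mpr Real.pi_ne_zero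
  field_simp

/-- The Mellin transform of the product of the weight with `exp (2πiux) - 1`. -/
noncomputable def expWeight (u : ℝ) (z : ℂ) : ℂ :=
  (∑ j ∈ Finset.Ico (1 : ℕ) 6, (2 * Real.pi * u * I) ^ j / j.factorial * afeWeight (z + (j : ℝ))) +
    taylorWeight u 6 z

/-- Telescoping over the poles `-1, ..., -5`. The sixth remainder gives decay and continuation to
the left, the first remainder permits exact evaluation at `1/2`. -/
theorem expWeight_eq_taylorWeight {u : ℝ} (hu : u = 1 ∨ u = -1) {z : ℂ} (hz : -1 / 2 < z.re) :
    expWeight u z = taylorWeight u 1 z := by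
  have h : ∀ n : ℕ, 1 ≤ n → (∑ j ∈ Finset.Ico 1 n, (2 * Real.pi * u * I) ^ j / j.factorial *
      afeWeight (z + (j : ℝ))) + taylorWeight u n z = taylorWeight u 1 z := by
    intro n hn
    induction n, hn using Nat.le_induction with
    | base => simp
    | succ n hn ih =>
      have h1 : (1 : ℝ) ≤ n := by exact_mod_cast hn
      have h2 := taylorWeight_sub hu (n := n) (z := z) (by linarith)
      rw [Finset.sum_Ico_succ_top hn, ← ih, ofReal_natCast]
      linear_combination -h2
  exact h 6 (by norm_num)

/-- The term `j = 0`, with its pole at the origin, is absent because `1` is subtracted from the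
exponential. The next pole is at `-1`, which leaves room for the line `-1/2 - η`. -/
theorem differentiableAt_expWeight {u : ℝ} (hu : u = 1 ∨ u = -1) {z : ℂ} (hz : -1 < z.re) :
    DifferentiableAt ℂ (expWeight u) z := by
  unfold expWeight
  refine DifferentiableAt.add (DifferentiableAt.fun_sum fun j hj => ?_)
    (hasDerivAt_taylorWeight hu (n := 6) (z := z) (by norm_num; linarith)).differentiableAt
  refine (differentiableAt_afeWeight_comp_add ?_).const_mul _
  have : (1 : ℝ) ≤ j := by exact_mod_cast (Finset.mem_Ico.mp hj).1
  linarith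

/-- The explicit terms decay rapidly, and the sixth Taylor remainder decays with exponent six. This
is ample against the cubic growth of `twistedSquare` on the left line. -/
theorem exists_norm_expWeight_le {u : ℝ} (hu : u = 1 ∨ u = -1) {a b : ℝ} (ha : -1 < a) :
    ∃ C : ℝ, 0 ≤ C ∧ ∀ z : ℂ, a ≤ z.re → z.re ≤ b → ‖expWeight u z‖ ≤ C * ((1 + |z.im|) ^ 6)⁻¹ := by
  have h1 : ∀ j ∈ Finset.Ico (1 : ℕ) 6, ∃ C : ℝ, 0 ≤ C ∧ ∀ z : ℂ, a ≤ z.re → z.re ≤ b →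
      ‖afeWeight (z + ((j : ℝ) : ℂ))‖ ≤ C * ((1 + |z.im|) ^ 6)⁻¹ := by
    intro j hj
    have : (1 : ℝ) ≤ j := by exact_mod_cast (Finset.mem_Ico.mp hj).1
    exact (rapidDecay_afeWeight_comp_add (c := j) (by linarith)).exists_norm_le 6
  choose! C h0 hC using h1
  obtain ⟨D, hD0, hD⟩ := exists_norm_taylorWeight_le hu 6 (a := a) (b := b) (by norm_num; linarith)
  refine ⟨(∑ j ∈ Finset.Ico (1 : ℕ) 6, ‖((2 * Real.pi * u * I) ^ j / j.factorial : ℂ)‖ * C j) + D,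
    add_nonneg (Finset.sum_nonneg fun j hj => mul_nonneg (norm_nonneg _) (h0 j hj)) hD0,
    fun z hz1 hz2 => (norm_add_le _ _).trans ?_⟩
  rw [add_mul, Finset.sum_mul]
  refine add_le_add ((norm_sum_le _ _).trans (Finset.sum_le_sum fun j hj => ?_)) (hD z hz1 hz2)
  rw [norm_mul, mul_assoc ‖_‖]
  exact mul_le_mul_of_nonneg_left (hC j hj z hz1 hz2) (norm_nonneg _)

theorem integrable_expWeight {u : ℝ} (hu : u = 1 ∨ u = -1) {σ : ℝ} (hσ : -1 < σ) :
    Integrable fun t : ℝ => expWeight u (σ + t * I) := by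
  obtain ⟨C, h0, hC⟩ := exists_norm_expWeight_le hu (a := σ) (b := σ) hσ
  refine integrable_of_norm_le_inv_sq (C := C) (continuous_vertical (a := σ) (b := σ) (fun z hz _ =>
    differentiableAt_expWeight hu (by linarith)) le_rfl le_rfl).aestronglyMeasurable fun t => ?_
  refine (hC (σ + t * I) (by simp) (by simp)).trans ?_
  have h1 : ((σ : ℂ) + t * I).im = t := by simp
  rw [h1]
  gcongr
  · linarith [abs_nonneg t]
  · norm_num

/-- Multiplying the weight by `exp (2πiux) - 1` amounts to replacing `afeWeight` by `expWeight`. -/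
theorem integral_cpow_neg_mul_expWeight {u : ℝ} (hu : u = 1 ∨ u = -1) {x : ℝ} (hx : 0 < x) :
    ∫ t : ℝ, (x : ℂ) ^ (-(((3 / 4 : ℝ) : ℂ) + t * I)) * expWeight u ((3 / 4 : ℝ) + t * I) =
      (cexp (2 * Real.pi * u * I * x) - 1) *
        ∫ t : ℝ, (x : ℂ) ^ (-(((3 / 4 : ℝ) : ℂ) + t * I)) * afeWeight ((3 / 4 : ℝ) + t * I) := by
  have hx0 : (x : ℂ) ≠ 0 := ofReal_ne_zero.mpr hx.ne'
  set v : ℂ := ∫ t : ℝ, (x : ℂ) ^ (-(((3 / 4 : ℝ) : ℂ) + t * I)) * afeWeight ((3 / 4 : ℝ) + t * I) with hv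
  have hline : ∀ (j : ℝ) (t : ℝ), (((3 / 4 : ℝ) : ℂ) + t * I) + (j : ℂ) = ((3 / 4 + j : ℝ) : ℂ) + t * I :=
    fun j t => by push_cast; ring
  have hterm : ∀ j ∈ Finset.Ico (1 : ℕ) 6, (∀ t : ℝ, (x : ℂ) ^ (-(((3 / 4 : ℝ) : ℂ) + t * I)) *
      ((2 * Real.pi * u * I) ^ j / j.factorial * afeWeight (((3 / 4 : ℝ) + t * I) + (j : ℝ))) =
      (2 * Real.pi * u * I * x) ^ j / j.factorial *
        ((x : ℂ) ^ (-(((3 / 4 + j : ℝ) : ℂ) + t * I)) * afeWeight ((3 / 4 + j : ℝ) + t * I))) := by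
    intro j _ t
    have h1 : (x : ℂ) ^ (-(((3 / 4 : ℝ) : ℂ) + t * I)) =
        (x : ℂ) ^ j * (x : ℂ) ^ (-(((3 / 4 + j : ℝ) : ℂ) + t * I)) := by
      rw [← cpow_natCast, ← cpow_add _ _ hx0]
      congr 1; push_cast; ring
    rw [h1, hline, mul_pow _ (x : ℂ)]
    ring
  have hjpos : ∀ j : ℕ, (0 : ℝ) < 3 / 4 + j := fun j => by positivity
  have hint1 : ∀ j ∈ Finset.Ico (1 : ℕ) 6, Integrable fun t : ℝ => (x : ℂ) ^ (-(((3 / 4 : ℝ) : ℂ) + t * I)) *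
      ((2 * Real.pi * u * I) ^ j / j.factorial * afeWeight (((3 / 4 : ℝ) + t * I) + (j : ℝ))) := by
    intro j hj
    simp_rw [hterm j hj]
    exact (integrable_cpow_neg_mul_afeWeight hx (hjpos j)).const_mul _
  have hval1 : ∀ j ∈ Finset.Ico (1 : ℕ) 6, ∫ t : ℝ, (x : ℂ) ^ (-(((3 / 4 : ℝ) : ℂ) + t * I)) *
      ((2 * Real.pi * u * I) ^ j / j.factorial * afeWeight (((3 / 4 : ℝ) + t * I) + (j : ℝ))) =
      (2 * Real.pi * u * I * x) ^ j / j.factorial * v := by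
    intro j hj
    simp_rw [hterm j hj]
    rw [integral_const_mul, hv, integral_cpow_neg_mul_afeWeight hx (by norm_num : (0 : ℝ) < 3 / 4)
      (by linarith [(j.cast_nonneg : (0 : ℝ) ≤ j)] : (3 / 4 : ℝ) ≤ 3 / 4 + j)]
  set c : ℝ := 1 / 2 - (6 : ℕ) with hc
  set f : ℝ → ℂ := fun t => expMellin u (c + t * I) * (x : ℂ) ^ (-((c : ℂ) + t * I)) with hf
  set g : ℝ → ℂ := fun t => (x : ℂ) ^ (-(((3 / 4 - c : ℝ) : ℂ) + t * I)) * afeWeight ((3 / 4 - c : ℝ) + t * I)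
    with hg
  have hfi : Integrable f := integrable_expMellin_mul_cpow hu hx (by norm_num)
  have hgi : Integrable g := integrable_cpow_neg_mul_afeWeight hx (by rw [hc]; norm_num)
  -- The remainder term is a convolution of two integrands on the lines `c` and `3/4 - c`. Its
  -- integral factors, which is the multiplicativity of inverse Mellin transforms.
  have hconv : ∀ y : ℝ, convolution f g (ContinuousLinearMap.mul ℂ ℂ) volume y =
      2 * Real.pi * ((x : ℂ) ^ (-(((3 / 4 : ℝ) : ℂ) + y * I)) * taylorWeight u 6 ((3 / 4 : ℝ) + y * I)) := by
    intro y
    have h2 : ∀ t : ℝ, f t * g (y - t) = (x : ℂ) ^ (-(((3 / 4 : ℝ) : ℂ) + y * I)) *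
        (expMellin u (c + t * I) * afeWeight (((3 / 4 : ℝ) : ℂ) + y * I - (c + t * I))) := by
      intro t
      have h3 : (((3 / 4 - c : ℝ) : ℂ) + ((y - t : ℝ) : ℂ) * I) =
          ((3 / 4 : ℝ) : ℂ) + y * I - (c + t * I) := by push_cast; ring
      have h4 : (x : ℂ) ^ (-(((3 / 4 : ℝ) : ℂ) + y * I)) = (x : ℂ) ^ (-((c : ℂ) + t * I)) *
          (x : ℂ) ^ (-(((3 / 4 : ℝ) : ℂ) + y * I - (c + t * I))) := by
        rw [← cpow_add _ _ hx0]; congr 1; ring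
      simp only [hf, hg]
      rw [h3, h4]; ring
    rw [convolution_def]
    simp only [ContinuousLinearMap.mul_apply']
    simp_rw [h2]
    have h4 : (2 * Real.pi : ℂ) ≠ 0 := mul_ne_zero two_ne_zero (ofReal_ne_zero.mpr Real.pi_ne_zero)
    rw [integral_const_mul, taylorWeight, ← hc, mul_left_comm (2 * Real.pi : ℂ), ← mul_assoc (2 * Real.pi : ℂ),
      mul_one_div_cancel h4, one_mul]
  have hmain := integral_convolution (L := ContinuousLinearMap.mul ℂ ℂ) hfi hgi
  simp_rw [hconv] at hmain
  rw [integral_const_mul, ContinuousLinearMap.mul_apply'] at hmain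
  have hgv : ∫ t, g t = v := (integral_cpow_neg_mul_afeWeight hx (by norm_num : (0 : ℝ) < 3 / 4)
    (by rw [hc]; norm_num : (3 / 4 : ℝ) ≤ 3 / 4 - c)).symm
  have hfv : ∫ t, f t = _ := integral_expMellin_mul_cpow hu hx (n := 6) (by norm_num)
  rw [hgv, hfv] at hmain
  have hint2 : Integrable fun t : ℝ => (x : ℂ) ^ (-(((3 / 4 : ℝ) : ℂ) + t * I)) *
      taylorWeight u 6 ((3 / 4 : ℝ) + t * I) := by
    have h1 : Integrable fun y : ℝ => convolution f g (ContinuousLinearMap.mul ℂ ℂ) volume y :=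
      hfi.integrable_convolution (ContinuousLinearMap.mul ℂ ℂ) hgi
    simp_rw [hconv] at h1
    have h3 := h1.const_mul (2 * Real.pi : ℂ)⁻¹
    have h4 : (2 * Real.pi : ℂ) ≠ 0 := by
      have := two_pi_ofReal_ne_zero; push_cast at this; exact this
    refine h3.congr (Eventually.of_forall fun t => ?_)
    exact inv_mul_cancel_left₀ h4 _
  have hexp : ∀ t : ℝ, (x : ℂ) ^ (-(((3 / 4 : ℝ) : ℂ) + t * I)) * expWeight u ((3 / 4 : ℝ) + t * I) =
      (∑ j ∈ Finset.Ico (1 : ℕ) 6, (x : ℂ) ^ (-(((3 / 4 : ℝ) : ℂ) + t * I)) *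
      ((2 * Real.pi * u * I) ^ j / j.factorial * afeWeight (((3 / 4 : ℝ) + t * I) + (j : ℝ)))) +
      (x : ℂ) ^ (-(((3 / 4 : ℝ) : ℂ) + t * I)) * taylorWeight u 6 ((3 / 4 : ℝ) + t * I) := fun t => by
    rw [expWeight, mul_add, Finset.mul_sum]
  simp_rw [hexp]
  rw [integral_add (integrable_finsetSum _ hint1) hint2, integral_finsetSum _ hint1,
    Finset.sum_congr rfl hval1, ← Finset.sum_mul]
  have hsum := Finset.sum_range_eq_add_Ico (fun j => (2 * Real.pi * u * I * x : ℂ) ^ j / j.factorial)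
    (n := 6) (by norm_num)
  rw [hsum] at hmain
  have hpi : (Real.pi : ℂ) ≠ 0 := ofReal_ne_zero.mpr Real.pi_ne_zero
  have hmain' := mul_left_cancel₀ (mul_ne_zero two_ne_zero hpi) (hmain.trans (mul_assoc _ _ _))
  rw [hmain', pow_zero, Nat.factorial_zero]
  push_cast
  ring

/-- Summing over both signs of `u` turns `expMellin` into `gammaFactor`, whose integral against the
weight is known; the value is `π / (2π)`. -/
theorem expWeight_one_half_add :
    expWeight 1 (1 / 2) + expWeight (-1) (1 / 2) = 1 / 2 := by
  rw [expWeight_eq_taylorWeight (Or.inl rfl) (by norm_num), expWeight_eq_taylorWeight (Or.inr rfl) (by norm_num),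
    taylorWeight, taylorWeight, ← mul_add]
  have hk := rapidDecay_afeWeight_comp_add (a := 1 / 4) (b := 1) (c := 1 / 2) (by norm_num)
  have hd : ∀ z : ℂ, 1 / 4 ≤ z.re → z.re ≤ 1 →
      DifferentiableAt ℂ (fun z => afeWeight (z + ((1 / 2 : ℝ) : ℂ))) z := fun z hz _ =>
    differentiableAt_afeWeight_comp_add (by linarith)
  have hint : ∀ u : ℝ, u = 1 ∨ u = -1 → Integrable fun t : ℝ => expMellin u ((1 / 2 - (1 : ℕ) : ℝ) + t * I) *
      afeWeight (1 / 2 - ((1 / 2 - (1 : ℕ) : ℝ) + t * I)) := by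
    intro u hu
    refine (hk.integrable_mul hd (continuous_expMellin u 1) (norm_expMellin_le_const hu 1)
      (z := 1 / 2) (by norm_num) (by norm_num)).congr (Eventually.of_forall fun t => ?_)
    dsimp only
    congr 2
    push_cast; ring
  rw [← integral_add (hint 1 (Or.inl rfl)) (hint (-1) (Or.inr rfl))]
  simp_rw [← add_mul]
  have h1 := integral_gammaFactor_mul_afeWeight
  unfold gammaFactor at h1
  rw [h1]
  have : (Real.pi : ℂ) ≠ 0 := ofReal_ne_zero.mpr Real.pi_ne_zero
  field_simp

/-- Same mechanism with the derivative of the weight. Together with the value at `1/2` it fixes the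
residue that becomes the main term. -/
theorem deriv_expWeight_one_half_add :
    deriv (expWeight 1) (1 / 2) + deriv (expWeight (-1)) (1 / 2) = deriv gammaFactor (1 / 2) / 2 := by
  have ho : IsOpen {z : ℂ | -1 / 2 < z.re} := isOpen_lt continuous_const continuous_re
  have hder : ∀ u : ℝ, u = 1 ∨ u = -1 → deriv (expWeight u) (1 / 2) =
      1 / (2 * Real.pi) * ∫ t : ℝ, expMellin u ((1 / 2 - (1 : ℕ) : ℝ) + t * I) *
      deriv afeWeight (1 / 2 - ((1 / 2 - (1 : ℕ) : ℝ) + t * I)) := by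
    intro u hu
    have h1 : expWeight u =ᶠ[𝓝 (1 / 2)] taylorWeight u 1 := by
      filter_upwards [ho.mem_nhds (show -1 / 2 < (1 / 2 : ℂ).re by norm_num)] with z hz
      exact expWeight_eq_taylorWeight hu hz
    rw [h1.deriv_eq, (hasDerivAt_taylorWeight hu (by norm_num)).deriv]
  rw [hder 1 (Or.inl rfl), hder (-1) (Or.inr rfl), ← mul_add]
  have hk := (rapidDecay_afeWeight (a := 1 / 2) (b := 2) (by norm_num)).deriv (r := 1 / 4) (by norm_num)
    fun z hz _ => differentiableAt_afeWeight (by linarith)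
  have ho' : IsOpen {z : ℂ | 0 < z.re} := isOpen_lt continuous_const continuous_re
  have hdd : DifferentiableOn ℂ (deriv afeWeight) {z : ℂ | 0 < z.re} :=
    DifferentiableOn.deriv (fun z hz => (differentiableAt_afeWeight hz).differentiableWithinAt) ho'
  have hint : ∀ u : ℝ, u = 1 ∨ u = -1 → Integrable fun t : ℝ => expMellin u ((1 / 2 - (1 : ℕ) : ℝ) + t * I) *
      deriv afeWeight (1 / 2 - ((1 / 2 - (1 : ℕ) : ℝ) + t * I)) := by
    intro u hu
    refine (hk.integrable_mul (fun z hz _ => hdd.differentiableAt (ho'.mem_nhds (show 0 < z.re by linarith)))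
      (continuous_expMellin u 1) (norm_expMellin_le_const hu 1)
      (z := 1) (by norm_num) (by norm_num)).congr (Eventually.of_forall fun t => ?_)
    dsimp only
    congr 2
    push_cast; ring
  rw [← integral_add (hint 1 (Or.inl rfl)) (hint (-1) (Or.inr rfl))]
  simp_rw [← add_mul]
  have h1 := integral_gammaFactor_mul_deriv_afeWeight
  unfold gammaFactor at h1 ⊢
  rw [h1]
  have : (Real.pi : ℂ) ≠ 0 := ofReal_ne_zero.mpr Real.pi_ne_zero
  field_simp

/-! ### Contour integrals of the twisted squares -/

/-- The integral of `twistedSquare h b (1/2 + s) * q ^ s * g s` over the line `s.re = σ`. -/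
noncomputable def twistedIntegral {q k : ℕ} [NeZero q] [NeZero k] (h : k ∣ q) (b : ZMod k) (σ : ℝ)
    (g : ℂ → ℂ) : ℂ :=
  ∫ t : ℝ, twistedSquare h b (1 / 2 + ((σ : ℂ) + t * I)) * (q : ℂ) ^ ((σ : ℂ) + t * I) * g (σ + t * I)

theorem norm_natCast_cpow_vertical {q : ℕ} (hq : q ≠ 0) (σ t : ℝ) :
    ‖(q : ℂ) ^ ((σ : ℂ) + t * I)‖ = (q : ℝ) ^ σ := by
  rw [Complex.norm_natCast_cpow_of_pos (Nat.pos_of_ne_zero hq)]; simp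

theorem continuous_natCast_cpow_vertical {q : ℕ} (hq : q ≠ 0) (σ : ℝ) :
    Continuous fun t : ℝ => (q : ℂ) ^ ((σ : ℂ) + t * I) :=
  Continuous.const_cpow (by fun_prop) (Or.inl (Nat.cast_ne_zero.mpr hq))

section twistedIntegral

variable {q k : ℕ} [NeZero q] [NeZero k] (h : k ∣ q) (b : ZMod k)

theorem differentiableAt_twistedSquare {w : ℂ} (hw : w ≠ 1) :
    DifferentiableAt ℂ (twistedSquare h b) w := by
  unfold twistedSquare
  refine DifferentiableAt.const_mul (DifferentiableAt.fun_sum fun ψ _ => ?_) _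
  exact ((DirichletCharacter.differentiableAt_LFunction _ w (Or.inl hw)).pow 2).const_mul _

theorem continuous_twistedSquare_vertical {σ : ℝ} (hσ : σ ≠ 1 / 2) :
    Continuous fun t : ℝ => twistedSquare h b (1 / 2 + ((σ : ℂ) + t * I)) := by
  rw [continuous_iff_continuousAt]
  intro t
  refine (differentiableAt_twistedSquare h b fun h1 => hσ ?_).continuousAt.comp
    (f := fun t : ℝ => (1 / 2 : ℂ) + ((σ : ℂ) + t * I)) (by fun_prop)
  have h2 := congrArg Complex.re h1
  simp at h2
  linarith

theorem exists_norm_twistedSquare_le {b : ZMod k} (hb : IsUnit b) :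
    ∃ K : ℝ, ∀ t : ℝ, ‖twistedSquare h b (1 / 2 + (((3 / 4 : ℝ) : ℂ) + t * I))‖ ≤ K := by
  refine ⟨∑' x : ℕ × ℕ, ‖((x.1 * x.2 : ℕ) : ℂ) ^ (-(5 / 4 : ℂ))‖, fun t => ?_⟩
  set w : ℂ := 1 / 2 + (((3 / 4 : ℝ) : ℂ) + t * I) with hw
  have hre : w.re = 5 / 4 := by simp [hw]; norm_num
  rw [twistedSquare_eq_tsum h hb (by rw [hre]; norm_num)]
  refine tsum_of_norm_bounded (summable_norm_prod_natCast_cpow (by norm_num)).hasSum fun x => ?_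
  rw [norm_mul]
  refine (mul_le_of_le_one_left (norm_nonneg _) (norm_coprimeStdAddChar_le q b _)).trans (le_of_eq ?_)
  rw [Complex.norm_natCast_cpow_of_re_ne_zero _ (by rw [neg_re, hre]; norm_num),
    Complex.norm_natCast_cpow_of_re_ne_zero _ (by norm_num), neg_re, hre]
  norm_num

theorem integrable_twistedIntegral_right {b : ZMod k} (hb : IsUnit b) {g : ℂ → ℂ}
    (hg : Integrable fun t : ℝ => g ((3 / 4 : ℝ) + t * I)) :
    Integrable fun t : ℝ => twistedSquare h b (1 / 2 + (((3 / 4 : ℝ) : ℂ) + t * I)) *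
      (q : ℂ) ^ (((3 / 4 : ℝ) : ℂ) + t * I) * g ((3 / 4 : ℝ) + t * I) := by
  obtain ⟨K, hK⟩ := exists_norm_twistedSquare_le h hb
  have hq0 := NeZero.ne q
  refine hg.bdd_mul (c := K * (q : ℝ) ^ (3 / 4 : ℝ)) (Continuous.aestronglyMeasurable
    ((continuous_twistedSquare_vertical h b (by norm_num)).mul (continuous_natCast_cpow_vertical hq0 _)))
    (Eventually.of_forall fun t => ?_)
  rw [norm_mul, norm_natCast_cpow_vertical hq0]
  gcongr
  exact hK t

/-- Expanding `twistedIntegral` into a Dirichlet series. -/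
theorem twistedIntegral_eq_tsum (hq : 1 < q) {b : ZMod k} (hb : IsUnit b) {g : ℂ → ℂ}
    (hg : Integrable fun t : ℝ => g ((3 / 4 : ℝ) + t * I)) :
    twistedIntegral h b (3 / 4) g = ∑' x : ℕ × ℕ, coprimeStdAddChar q b (x.1 * x.2) *
      ((x.1 * x.2 : ℕ) : ℂ) ^ (-(1 / 2 : ℂ)) *
      ∫ t : ℝ, ((((x.1 * x.2 : ℕ) : ℝ) / q : ℝ) : ℂ) ^ (-(((3 / 4 : ℝ) : ℂ) + t * I)) *
        g ((3 / 4 : ℝ) + t * I) := by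
  have hq0 : q ≠ 0 := by omega
  set J : ℝ := ∫ t : ℝ, ‖g ((3 / 4 : ℝ) + t * I)‖ with hJ
  set F : ℕ × ℕ → ℝ → ℂ := fun x t => coprimeStdAddChar q b (x.1 * x.2) *
    ((x.1 * x.2 : ℕ) : ℂ) ^ (-(1 / 2 + (((3 / 4 : ℝ) : ℂ) + t * I))) *
    (q : ℂ) ^ (((3 / 4 : ℝ) : ℂ) + t * I) * g ((3 / 4 : ℝ) + t * I) with hF
  have hre : ∀ t : ℝ, (1 / 2 + (((3 / 4 : ℝ) : ℂ) + t * I)).re = 5 / 4 := fun t => by simp; norm_num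
  have hnorm : ∀ x t, ‖F x t‖ ≤ ‖((x.1 * x.2 : ℕ) : ℂ) ^ (-(5 / 4 : ℂ))‖ * (q : ℝ) ^ (3 / 4 : ℝ) *
      ‖g ((3 / 4 : ℝ) + t * I)‖ := by
    intro x t
    simp only [hF]
    rw [norm_mul, norm_mul, norm_mul, norm_natCast_cpow_vertical hq0]
    gcongr
    refine (mul_le_of_le_one_left (norm_nonneg _) (norm_coprimeStdAddChar_le q b _)).trans (le_of_eq ?_)
    rw [Complex.norm_natCast_cpow_of_re_ne_zero _ (by rw [neg_re, hre]; norm_num),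
      Complex.norm_natCast_cpow_of_re_ne_zero _ (by norm_num), neg_re, hre]
    norm_num
  have hFint : ∀ x, Integrable (F x) := by
    intro x
    refine (hg.norm.const_mul (‖((x.1 * x.2 : ℕ) : ℂ) ^ (-(5 / 4 : ℂ))‖ * (q : ℝ) ^ (3 / 4 : ℝ))).mono' ?_
      (Eventually.of_forall (hnorm x))
    refine AEStronglyMeasurable.mul (Continuous.aestronglyMeasurable ?_) hg.aestronglyMeasurable
    refine Continuous.mul (continuous_const.mul ?_) (continuous_natCast_cpow_vertical hq0 _)
    rcases Nat.eq_zero_or_pos (x.1 * x.2) with h0 | h0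
    · have : ∀ t : ℝ, ((x.1 * x.2 : ℕ) : ℂ) ^ (-(1 / 2 + (((3 / 4 : ℝ) : ℂ) + t * I))) = 0 := fun t => by
        rw [h0, Nat.cast_zero, zero_cpow]
        intro h1
        have := congrArg Complex.re h1
        rw [neg_re, hre] at this
        norm_num at this
      simp_rw [this]
      exact continuous_const
    · exact Continuous.const_cpow (by fun_prop) (Or.inl (Nat.cast_ne_zero.mpr h0.ne'))
  have hFsum : Summable fun x => ∫ t, ‖F x t‖ := by
    refine Summable.of_nonneg_of_le (fun x => integral_nonneg fun t => norm_nonneg _) (fun x =>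
      integral_mono (hFint x).norm (hg.norm.const_mul _) (hnorm x)) ?_
    simp_rw [integral_const_mul]
    exact ((summable_norm_prod_natCast_cpow (w := 5 / 4) (by norm_num)).mul_right _).mul_right _
  have hmain := integral_tsum_of_summable_integral_norm hFint hFsum
  have hI : twistedIntegral h b (3 / 4) g = ∫ t, ∑' x, F x t := by
    rw [twistedIntegral]
    congr 1
    ext t
    rw [twistedSquare_eq_tsum h hb (by rw [hre]; norm_num), ← tsum_mul_right, ← tsum_mul_right]
  rw [hI, ← hmain]
  congr 1
  ext x
  rw [← integral_const_mul]
  congr 1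
  ext t
  simp only [hF]
  rcases Nat.eq_zero_or_pos (x.1 * x.2) with h0 | h0
  · have : coprimeStdAddChar q b (x.1 * x.2) = 0 := by
      rw [coprimeStdAddChar, if_neg]
      rw [h0, Nat.coprime_zero_left]; omega
    rw [this]; simp
  · have hN : ((x.1 * x.2 : ℕ) : ℂ) ≠ 0 := Nat.cast_ne_zero.mpr h0.ne'
    have e1 : ((((x.1 * x.2 : ℕ) : ℝ) / q : ℝ) : ℂ) ^ (-(((3 / 4 : ℝ) : ℂ) + t * I)) =
        ((x.1 * x.2 : ℕ) : ℂ) ^ (-(((3 / 4 : ℝ) : ℂ) + t * I)) * (q : ℂ) ^ (((3 / 4 : ℝ) : ℂ) + t * I) := by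
      rw [div_eq_mul_inv, ofReal_mul, mul_cpow_ofReal_nonneg (by positivity) (by positivity),
        ofReal_inv, ofReal_natCast, ofReal_natCast, inv_cpow _ _ (by rw [natCast_arg]; exact Real.pi_pos.ne),
        cpow_neg (q : ℂ), inv_inv]
    rw [e1, neg_add, cpow_add _ _ hN]
    ring

/-- The size of `twistedIntegral` on the line `-1/2 - η`. -/
noncomputable def twistedBound (η : ℝ) (q k : ℕ) : ℝ :=
  (k : ℝ) ^ (1 + 2 * η) * (k.divisors.card : ℝ) * ((q : ℝ) ^ (2 * η) * (q.divisors.card : ℝ) ^ 2) *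
    (q : ℝ) ^ (-1 / 2 - η)

theorem twistedBound_nonneg (η : ℝ) (q k : ℕ) : 0 ≤ twistedBound η q k := by
  unfold twistedBound; positivity

end twistedIntegral

/-- On this line `1/2 + s` has real part `-η`, where the averaged bound for `twistedSquare` holds.
Its cubic growth against six powers of decay leaves an absolutely convergent integral. -/
theorem exists_norm_twistedIntegral_le {η : ℝ} (h0 : 0 < η) (h1 : η < 1) :
    ∃ C : ℝ, 0 ≤ C ∧ ∀ (q k : ℕ) [NeZero q] [NeZero k] (h : k ∣ q) (b : ZMod k) (g : ℂ → ℂ) (B : ℝ),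
      Continuous (fun t : ℝ => g ((-1 / 2 - η : ℝ) + t * I)) →
      (∀ t : ℝ, ‖g ((-1 / 2 - η : ℝ) + t * I)‖ ≤ B * ((1 + |t|) ^ 6)⁻¹) →
      Integrable (fun t : ℝ => twistedSquare h b (1 / 2 + (((-1 / 2 - η : ℝ) : ℂ) + t * I)) *
        (q : ℂ) ^ (((-1 / 2 - η : ℝ) : ℂ) + t * I) * g ((-1 / 2 - η : ℝ) + t * I)) ∧
      ‖twistedIntegral h b (-1 / 2 - η) g‖ ≤ C * B * twistedBound η q k := by
  obtain ⟨C, hC0, hC⟩ := norm_twistedSquare_le h0 h1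
  set J : ℝ := ∫ t : ℝ, ((1 + |t|) ^ 2)⁻¹ with hJ
  have hJ0 : 0 ≤ J := integral_nonneg fun t => by positivity
  refine ⟨C * J, by positivity, fun q k _ _ h b g B hgc hg => ?_⟩
  have hq0 := NeZero.ne q
  have hB : 0 ≤ B := by simpa using (norm_nonneg _).trans (hg 0)
  have hbd : ∀ t : ℝ, ‖twistedSquare h b (1 / 2 + (((-1 / 2 - η : ℝ) : ℂ) + t * I)) *
        (q : ℂ) ^ (((-1 / 2 - η : ℝ) : ℂ) + t * I) * g ((-1 / 2 - η : ℝ) + t * I)‖ ≤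
      C * B * twistedBound η q k * ((1 + |t|) ^ 2)⁻¹ := by
    intro t
    rw [norm_mul, norm_mul, norm_natCast_cpow_vertical hq0]
    have e1 : (1 / 2 : ℂ) + (((-1 / 2 - η : ℝ) : ℂ) + t * I) = -η + t * I := by push_cast; ring
    rw [e1]
    calc _ ≤ C * ((k : ℝ) ^ (1 + 2 * η) * (k.divisors.card : ℝ) * ((q : ℝ) ^ (2 * η) *
          (q.divisors.card : ℝ) ^ 2) * (1 + |t|) ^ 3) * (q : ℝ) ^ (-1 / 2 - η) *
          (B * ((1 + |t|) ^ 6)⁻¹) := by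
          gcongr
          · exact hC q k h b t
          · exact hg t
      _ = C * B * twistedBound η q k * ((1 + |t|) ^ 3 * ((1 + |t|) ^ 6)⁻¹) := by
          rw [twistedBound]; ring
      _ ≤ _ := by
          refine mul_le_mul_of_nonneg_left ?_
            (mul_nonneg (mul_nonneg hC0 hB) (twistedBound_nonneg η q k))
          rw [← div_eq_mul_inv, inv_eq_one_div, div_le_div_iff₀ (by positivity) (by positivity),
            one_mul, ← pow_add]
          exact pow_le_pow_right₀ (by linarith [abs_nonneg t]) (by norm_num)
  have hmeas : AEStronglyMeasurable (fun t : ℝ =>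
      twistedSquare h b (1 / 2 + (((-1 / 2 - η : ℝ) : ℂ) + t * I)) *
        (q : ℂ) ^ (((-1 / 2 - η : ℝ) : ℂ) + t * I) * g ((-1 / 2 - η : ℝ) + t * I)) :=
    (((continuous_twistedSquare_vertical h b (by linarith)).mul
      (continuous_natCast_cpow_vertical hq0 _)).mul hgc).aestronglyMeasurable
  refine ⟨integrable_of_norm_le_inv_sq hmeas hbd, ?_⟩
  refine (norm_integral_le_of_norm_le (integrable_inv_one_add_abs_sq.const_mul _)
    (Eventually.of_forall hbd)).trans (le_of_eq ?_)
  rw [integral_const_mul]; ring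

theorem twistedSquareHat_half_add {q k : ℕ} [NeZero q] [NeZero k] (h : k ∣ q) (b : ZMod k) {s : ℂ}
    (hs : s ≠ 1 / 2) : twistedSquareHat h b (s + (1 / 2 : ℝ)) =
      (s - 1 / 2) ^ 2 * twistedSquare h b (1 / 2 + s) := by
  have e : s + ((1 / 2 : ℝ) : ℂ) = 1 / 2 + s := by push_cast; ring
  rw [e, twistedSquareHat_of_ne_one h b fun h1 => hs (by linear_combination h1)]
  ring

theorem vertical_ne_one_half {σ : ℝ} (hσ : σ ≠ 1 / 2) (t : ℝ) : (σ : ℂ) + t * I ≠ 1 / 2 := fun h => by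
  have h2 := congrArg Complex.re h
  simp at h2
  exact hσ (by linarith)

/-- Moving the line of integration with the weight `afeWeight` picks up the central value. -/
theorem exists_norm_twistedIntegral_afeWeight_sub_le {η : ℝ} (h0 : 0 < η) (h1 : η < 1 / 2) :
    ∃ C : ℝ, 0 ≤ C ∧ ∀ (q k : ℕ) [NeZero q] [NeZero k] (h : k ∣ q) (b : ZMod k),
      ‖twistedIntegral h b (3 / 4) afeWeight - 2 * Real.pi * twistedSquare h b (1 / 2)‖ ≤
        C * twistedBound η q k := by
  obtain ⟨C, hC0, hC⟩ := exists_norm_twistedIntegral_le h0 (by linarith)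
  obtain ⟨B, hB0, hB⟩ := (rapidDecay_afeKernel (a := -1 / 2 - η) (b := -1 / 2 - η)
    (by linarith)).exists_norm_le 6
  have hline : ∀ t : ℝ, 1 / 2 ≤ ‖((-1 / 2 - η : ℝ) : ℂ) + t * I‖ := fun t => by
    refine le_trans ?_ (abs_le_norm_vertical _ t)
    rw [abs_of_neg (by linarith)]; linarith
  have hbd : ∀ t : ℝ, ‖afeWeight ((-1 / 2 - η : ℝ) + t * I)‖ ≤ (2 * B) * ((1 + |t|) ^ 6)⁻¹ := by
    intro t
    have h2 := hB ((-1 / 2 - η : ℝ) + t * I) (by simp) (by simp)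
    have h3 : (((-1 / 2 - η : ℝ) : ℂ) + t * I).im = t := by simp
    rw [h3] at h2
    rw [afeWeight, norm_div, div_eq_mul_inv]
    have h4 : ‖((-1 / 2 - η : ℝ) : ℂ) + t * I‖⁻¹ ≤ 2 := by
      simpa using inv_anti₀ (by norm_num) (hline t)
    calc _ ≤ B * ((1 + |t|) ^ 6)⁻¹ * 2 := by gcongr
      _ = _ := by ring
  have hcont : Continuous fun t : ℝ => afeWeight ((-1 / 2 - η : ℝ) + t * I) := by
    unfold afeWeight
    refine Continuous.div (continuous_vertical (a := -1 / 2 - η) (b := -1 / 2 - η) (fun z hz _ =>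
      differentiableAt_afeKernel (by linarith)) le_rfl le_rfl) (by fun_prop)
      (vertical_ne_zero (by linarith))
  refine ⟨C * (2 * B), by positivity, fun q k _ _ h b => ?_⟩
  have hq0 := NeZero.ne q
  -- The factor `(s - 1/2)²` is moved from the kernel to the twisted square. Both become holomorphic
  -- on the strip, so `s = 0` is the only pole crossed.
  set E : ℂ → ℂ := fun s => afeKernelReg s * (twistedSquareHat h b (s + (1 / 2 : ℝ)) * (q : ℂ) ^ s) with hE
  have hEd : ∀ z : ℂ, -1 / 2 - η ≤ z.re → z.re ≤ 3 / 4 → DifferentiableAt ℂ E z := fun z hz _ =>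
    (differentiableAt_afeKernelReg (by linarith)).mul
      (((differentiable_twistedSquareHat h b _).comp z (by fun_prop)).mul
        (differentiableAt_natCast_cpow hq0 z))
  have hEr : RapidDecay E (-1 / 2 - η) (3 / 4) :=
    (rapidDecay_afeKernelReg (by linarith)).mul_expGrowth (ExpGrowth.mul
      (((expGrowth_twistedSquareHat h b (a := -η) (c := 5 / 4) (by norm_num)).comp_add_const
        (1 / 2)).mono (by linarith) (by norm_num)) (ExpGrowth.natCast_cpow hq0 _ _))
  have hval : ∀ s : ℂ, s ≠ 1 / 2 → E s / s =
      twistedSquare h b (1 / 2 + s) * (q : ℂ) ^ s * afeWeight s := by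
    intro s hs
    simp only [hE]
    rw [twistedSquareHat_half_add h b hs, afeWeight, afeKernel]
    ring
  have hint : ∀ σ : ℝ, -1 / 2 - η ≤ σ → σ ≤ 3 / 4 → σ ≠ 0 →
      Integrable fun t : ℝ => E (σ + t * I) / (σ + t * I) := by
    intro σ hσ1 hσ2 hσ0
    have h2 := hEr.integrable hEd hσ1 hσ2
    simp_rw [div_eq_mul_inv]
    refine h2.mul_bdd (c := |σ|⁻¹) (Continuous.aestronglyMeasurable ?_) (Eventually.of_forall fun t => ?_)
    · exact Continuous.inv₀ (by fun_prop) (vertical_ne_zero hσ0)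
    · rw [norm_inv]
      exact inv_anti₀ (abs_pos.mpr hσ0) (abs_le_norm_vertical σ t)
  have main := integral_vertical_simple_pole (E := E) (a := -1 / 2 - η) (b := 3 / 4) (by linarith)
    (by norm_num) hEd hEr.expGrowth (hint _ le_rfl (by linarith) (by linarith))
    (hint _ (by linarith) le_rfl (by norm_num))
  have e1 : ∫ t : ℝ, E ((3 / 4 : ℝ) + t * I) / ((3 / 4 : ℝ) + t * I) =
      twistedIntegral h b (3 / 4) afeWeight := by
    rw [twistedIntegral]
    exact integral_congr_ae (Eventually.of_forall fun t => hval _ (vertical_ne_one_half (by norm_num) t))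
  have e2 : ∫ t : ℝ, E ((-1 / 2 - η : ℝ) + t * I) / ((-1 / 2 - η : ℝ) + t * I) =
      twistedIntegral h b (-1 / 2 - η) afeWeight := by
    rw [twistedIntegral]
    exact integral_congr_ae (Eventually.of_forall fun t => hval _ (vertical_ne_one_half (by linarith) t))
  have e3 : E 0 = twistedSquare h b (1 / 2) := by
    have h2 := afeKernel_zero
    rw [afeKernel] at h2
    simp only [hE]
    rw [twistedSquareHat_half_add h b (by norm_num), cpow_zero, add_zero]
    linear_combination twistedSquare h b (1 / 2) * h2
  rw [e1, e2, e3] at main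
  rw [← main, sub_sub_cancel]
  exact (hC q k h b afeWeight (2 * B) hcont hbd).2

/-- Moving the line of integration with the weight `expWeight` picks up the double pole of the
trivial character. -/
theorem exists_norm_twistedIntegral_expWeight_sub_le {u : ℝ} (hu : u = 1 ∨ u = -1) {η : ℝ} (h0 : 0 < η)
    (h1 : η < 1 / 2) :
    ∃ C : ℝ, 0 ≤ C ∧ ∀ (q k : ℕ) [NeZero q] [NeZero k] (h : k ∣ q) (b : ZMod k), IsUnit b →
      ‖twistedIntegral h b (3 / 4) (expWeight u) - 2 * Real.pi * ((q : ℂ) ^ (1 / 2 : ℂ) *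
        (((ArithmeticFunction.moebius k : ℤ) : ℂ) / k.totient * ((q.totient : ℂ) / q) ^ 2) *
        (expWeight u (1 / 2) * (Real.log q + 2 * (Real.eulerMascheroniConstant +
          ∑ p ∈ q.primeFactors, (Real.log p : ℂ) / ((p : ℂ) - 1))) + deriv (expWeight u) (1 / 2)))‖ ≤
        C * twistedBound η q k := by
  obtain ⟨C, hC0, hC⟩ := exists_norm_twistedIntegral_le h0 (by linarith)
  obtain ⟨B, hB0, hB⟩ := exists_norm_expWeight_le hu (a := -1 / 2 - η) (b := 3 / 4) (by linarith)
  have hbd : ∀ t : ℝ, ‖expWeight u ((-1 / 2 - η : ℝ) + t * I)‖ ≤ B * ((1 + |t|) ^ 6)⁻¹ := by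
    intro t
    have h2 := hB ((-1 / 2 - η : ℝ) + t * I) (by simp) (by simp; linarith)
    have h3 : (((-1 / 2 - η : ℝ) : ℂ) + t * I).im = t := by simp
    rwa [h3] at h2
  have hcont : Continuous fun t : ℝ => expWeight u ((-1 / 2 - η : ℝ) + t * I) :=
    continuous_vertical (a := -1 / 2 - η) (b := -1 / 2 - η) (fun z hz _ =>
      differentiableAt_expWeight hu (by linarith)) le_rfl le_rfl
  refine ⟨C * B, by positivity, fun q k _ _ h b hb => ?_⟩
  have hq0 := NeZero.ne q
  -- `expWeight` has neither a pole at `0` nor a compensating zero at `1/2`; the double pole there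
  -- is the only one crossed and contributes `deriv F (1/2)`.
  set F : ℂ → ℂ := fun s => twistedSquareHat h b (s + (1 / 2 : ℝ)) * (q : ℂ) ^ s * expWeight u s with hF
  have hFd : ∀ z : ℂ, -1 / 2 - η ≤ z.re → z.re ≤ 3 / 4 → DifferentiableAt ℂ F z := fun z hz _ =>
    (((differentiable_twistedSquareHat h b _).comp z (by fun_prop)).mul
        (differentiableAt_natCast_cpow hq0 z)).mul (differentiableAt_expWeight hu (by linarith))
  have hFg : ExpGrowth F (-1 / 2 - η) (3 / 4) :=
    ExpGrowth.mul (ExpGrowth.mul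
      (((expGrowth_twistedSquareHat h b (a := -η) (c := 5 / 4) (by norm_num)).comp_add_const
        (1 / 2)).mono (by linarith) (by norm_num)) (ExpGrowth.natCast_cpow hq0 _ _))
      (ExpGrowth.of_bounded (K := B) fun z hz1 hz2 => (hB z hz1 hz2).trans
        (mul_le_of_le_one_right hB0 (inv_le_one_of_one_le₀ (one_le_pow₀ (by linarith [abs_nonneg z.im])))))
  have hval : ∀ s : ℂ, s ≠ 1 / 2 → F s / (s - ((1 / 2 : ℝ) : ℂ)) ^ 2 =
      twistedSquare h b (1 / 2 + s) * (q : ℂ) ^ s * expWeight u s := by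
    intro s hs
    have h2 : s - 1 / 2 ≠ 0 := sub_ne_zero.mpr hs
    simp only [hF]
    rw [twistedSquareHat_half_add h b hs, show ((1 / 2 : ℝ) : ℂ) = 1 / 2 by push_cast; rfl, mul_assoc,
      mul_assoc, mul_div_cancel_left₀ _ (pow_ne_zero 2 h2), ← mul_assoc]
  have hvr : ∀ t : ℝ, F ((3 / 4 : ℝ) + t * I) / (((3 / 4 : ℝ) : ℂ) + t * I - ((1 / 2 : ℝ) : ℂ)) ^ 2 =
      twistedSquare h b (1 / 2 + (((3 / 4 : ℝ) : ℂ) + t * I)) * (q : ℂ) ^ (((3 / 4 : ℝ) : ℂ) + t * I) *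
        expWeight u ((3 / 4 : ℝ) + t * I) := fun t => hval _ (vertical_ne_one_half (by norm_num) t)
  have hvl : ∀ t : ℝ, F ((-1 / 2 - η : ℝ) + t * I) /
      (((-1 / 2 - η : ℝ) : ℂ) + t * I - ((1 / 2 : ℝ) : ℂ)) ^ 2 =
      twistedSquare h b (1 / 2 + (((-1 / 2 - η : ℝ) : ℂ) + t * I)) *
        (q : ℂ) ^ (((-1 / 2 - η : ℝ) : ℂ) + t * I) * expWeight u ((-1 / 2 - η : ℝ) + t * I) :=
    fun t => hval _ (vertical_ne_one_half (by linarith) t)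
  obtain ⟨hil, hbl⟩ := hC q k h b (expWeight u) B hcont hbd
  have hir := integrable_twistedIntegral_right h hb (integrable_expWeight hu (by norm_num : (-1 : ℝ) < 3 / 4))
  have main := integral_vertical_double_pole (F := F) (a := -1 / 2 - η) (b := 3 / 4) (p := 1 / 2)
    (by linarith) (by norm_num) hFd hFg (by simp_rw [hvl]; exact hil) (by simp_rw [hvr]; exact hir)
  simp_rw [hvr, hvl] at main
  rw [← twistedIntegral, ← twistedIntegral] at main
  have hder : HasDerivAt F ((q : ℂ) ^ (1 / 2 : ℂ) *
        (((ArithmeticFunction.moebius k : ℤ) : ℂ) / k.totient * ((q.totient : ℂ) / q) ^ 2) *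
        (expWeight u (1 / 2) * (Real.log q + 2 * (Real.eulerMascheroniConstant +
          ∑ p ∈ q.primeFactors, (Real.log p : ℂ) / ((p : ℂ) - 1))) + deriv (expWeight u) (1 / 2)))
      ((1 / 2 : ℝ) : ℂ) := by
    have ehalf : ((1 / 2 : ℝ) : ℂ) = 1 / 2 := by push_cast; rfl
    have eone : (1 / 2 : ℂ) + ((1 / 2 : ℝ) : ℂ) = 1 := by push_cast; norm_num
    have d1 := HasDerivAt.comp_add_const (1 / 2 : ℂ) ((1 / 2 : ℝ) : ℂ) (by
      rw [eone]; exact hasDerivAt_twistedSquareHat h hb :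
      HasDerivAt (twistedSquareHat h b) (((ArithmeticFunction.moebius k : ℤ) : ℂ) / k.totient *
        (2 * ((q.totient : ℂ) / q) ^ 2 * (Real.eulerMascheroniConstant +
        ∑ p ∈ q.primeFactors, (Real.log p : ℂ) / ((p : ℂ) - 1)))) (1 / 2 + ((1 / 2 : ℝ) : ℂ)))
    have d2 : HasDerivAt (fun s : ℂ => (q : ℂ) ^ s) ((q : ℂ) ^ (1 / 2 : ℂ) * Real.log q) (1 / 2) := by
      have h2 := (hasDerivAt_id' (1 / 2 : ℂ)).const_cpow (c := (q : ℂ)) (Or.inl (Nat.cast_ne_zero.mpr hq0))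
      refine h2.congr_deriv ?_
      rw [mul_one, ← natCast_log]
    have d3 := (differentiableAt_expWeight hu (z := 1 / 2) (by norm_num)).hasDerivAt
    rw [ehalf]
    refine ((d1.fun_mul d2).fun_mul d3).congr_deriv ?_
    rw [eone, twistedSquareHat_one h hb]
    ring
  rw [hder.deriv] at main
  rw [← main, sub_sub_cancel]
  exact hbl

/-! ### Exchanging the two moduli -/

/-- Reciprocity for `u n`, solved for the character modulo `d`. The price for passing to the modulus
`c` is the slowly oscillating factor `e(u n / q)`. -/
theorem coprimeStdAddChar_reciprocity {c d : ℕ} [NeZero c] [NeZero d] [NeZero (c * d)]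
    (hcd : Nat.Coprime c d) (u : ℤ) (n : ℕ) :
    coprimeStdAddChar (c * d) ((u : ZMod d) * (c : ZMod d)⁻¹) n =
      coprimeStdAddChar (c * d) (-((u : ZMod c) * (d : ZMod c)⁻¹)) n *
        cexp (2 * Real.pi * (u : ℝ) * I * ((n : ℝ) / (c * d : ℕ) : ℝ)) := by
  unfold coprimeStdAddChar
  split_ifs with hn
  · have h1 := stdAddChar_mul_reciprocity hcd (u * n)
    rw [ZMod.stdAddChar_coe] at h1
    have h2 : (2 * Real.pi * (u : ℝ) * I * ((n : ℝ) / (c * d : ℕ) : ℝ) : ℂ) =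
        2 * Real.pi * I * (u * n : ℤ) / (c * d : ℕ) := by push_cast; ring
    rw [h2, h1, ← mul_assoc, ← AddChar.map_add_eq_mul]
    have h3 : -((u : ZMod c) * (d : ZMod c)⁻¹) * (n : ZMod c) + ((u * n : ℤ) : ZMod c) * (d : ZMod c)⁻¹ = 0 := by
      push_cast; ring
    rw [h3, AddChar.map_zero_eq_one, one_mul]
    congr 1
    push_cast; ring
  · simp

/-- Reciprocity exchanges the two moduli at the expense of changing the weight. -/
theorem twistedIntegral_reciprocity {c d : ℕ} [NeZero c] [NeZero d] [NeZero (c * d)]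
    (hcd : Nat.Coprime c d) (hq : 1 < c * d) {u : ℤ} (hu : u = 1 ∨ u = -1) :
    twistedIntegral (Dvd.intro_left c rfl : d ∣ c * d) ((u : ZMod d) * (c : ZMod d)⁻¹) (3 / 4) afeWeight =
      twistedIntegral (Dvd.intro d rfl : c ∣ c * d) (-((u : ZMod c) * (d : ZMod c)⁻¹)) (3 / 4) afeWeight +
      twistedIntegral (Dvd.intro d rfl : c ∣ c * d) (-((u : ZMod c) * (d : ZMod c)⁻¹)) (3 / 4)
        (expWeight (u : ℝ)) := by
  have hu' : (u : ℝ) = 1 ∨ (u : ℝ) = -1 := by rcases hu with rfl | rfl <;> simp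
  have huu : ∀ m : ℕ, IsUnit (u : ZMod m) := fun m => by rcases hu with rfl | rfl <;> simp
  have hinv : ∀ m n : ℕ, Nat.Coprime m n → IsUnit (m : ZMod n)⁻¹ := fun m n hmn => by
    obtain ⟨v, hv⟩ := (ZMod.isUnit_iff_coprime m n).mpr hmn
    rw [← hv, ZMod.inv_coe_unit]; exact v⁻¹.isUnit
  have hb1 : IsUnit ((u : ZMod d) * (c : ZMod d)⁻¹) := (huu d).mul (hinv c d hcd)
  have hb2 : IsUnit (-((u : ZMod c) * (d : ZMod c)⁻¹)) := ((huu c).mul (hinv d c hcd.symm)).neg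
  have i1 : Integrable fun t : ℝ => afeWeight ((3 / 4 : ℝ) + t * I) :=
    (rapidDecay_afeWeight (a := 3 / 4) (b := 3 / 4) (by norm_num)).integrable
      (fun z hz _ => differentiableAt_afeWeight (by linarith)) le_rfl le_rfl
  have i2 : Integrable fun t : ℝ => expWeight (u : ℝ) ((3 / 4 : ℝ) + t * I) :=
    integrable_expWeight hu' (by norm_num)
  have hadd : twistedIntegral (Dvd.intro d rfl : c ∣ c * d) (-((u : ZMod c) * (d : ZMod c)⁻¹)) (3 / 4)
      (fun s => afeWeight s + expWeight (u : ℝ) s) =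
      twistedIntegral (Dvd.intro d rfl : c ∣ c * d) (-((u : ZMod c) * (d : ZMod c)⁻¹)) (3 / 4) afeWeight +
      twistedIntegral (Dvd.intro d rfl : c ∣ c * d) (-((u : ZMod c) * (d : ZMod c)⁻¹)) (3 / 4)
        (expWeight (u : ℝ)) := by
    unfold twistedIntegral
    simp_rw [mul_add]
    exact integral_add (integrable_twistedIntegral_right _ hb2 i1) (integrable_twistedIntegral_right _ hb2 i2)
  rw [← hadd, twistedIntegral_eq_tsum _ hq hb1 i1, twistedIntegral_eq_tsum _ hq hb2 (i1.add i2)]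
  congr 1
  ext x
  rcases Nat.eq_zero_or_pos (x.1 * x.2) with h0 | h0
  · have hn : ¬ Nat.Coprime (x.1 * x.2) (c * d) := by
      rw [h0, Nat.coprime_zero_left]; omega
    simp [coprimeStdAddChar, hn]
  · set y : ℝ := ((x.1 * x.2 : ℕ) : ℝ) / (c * d : ℕ) with hy
    have hy0 : 0 < y := div_pos (by exact_mod_cast h0) (by exact_mod_cast (by omega : 0 < c * d))
    have hi1 : Integrable fun t : ℝ => (y : ℂ) ^ (-(((3 / 4 : ℝ) : ℂ) + t * I)) * afeWeight ((3 / 4 : ℝ) + t * I) :=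
      integrable_cpow_neg_mul_afeWeight hy0 (by norm_num)
    have hi2 : Integrable fun t : ℝ => (y : ℂ) ^ (-(((3 / 4 : ℝ) : ℂ) + t * I)) *
        expWeight (u : ℝ) ((3 / 4 : ℝ) + t * I) := by
      refine i2.bdd_mul (c := y ^ (-(3 / 4 : ℝ))) (Continuous.aestronglyMeasurable
        (Continuous.const_cpow (by fun_prop) (Or.inl (ofReal_ne_zero.mpr hy0.ne'))))
        (Eventually.of_forall fun t => ?_)
      rw [norm_cpow_eq_rpow_re_of_pos hy0]; simp
    -- With `y = n₁ n₂ / q`, the factor `e(u y)` is split as `1 + (e(u y) - 1)`; the two parts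
    -- correspond to `afeWeight` and `expWeight`.
    simp_rw [mul_add]
    rw [integral_add hi1 hi2, integral_cpow_neg_mul_expWeight hu' hy0,
      coprimeStdAddChar_reciprocity hcd, ← hy]
    ring

/-! ### Main and secondary terms, factorisation by factorisation -/

theorem norm_moebius_le_one (n : ℕ) : ‖((ArithmeticFunction.moebius n : ℤ) : ℂ)‖ ≤ 1 := by
  rw [Complex.norm_intCast]
  exact_mod_cast ArithmeticFunction.abs_moebius_le_one

theorem isUnit_inv_natCast {m n : ℕ} (h : Nat.Coprime m n) : IsUnit (m : ZMod n)⁻¹ := by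
  obtain ⟨v, hv⟩ := (ZMod.isUnit_iff_coprime m n).mpr h
  rw [← hv, ZMod.inv_coe_unit]
  exact v⁻¹.isUnit

theorem integrable_afeWeight_vertical : Integrable fun t : ℝ => afeWeight ((3 / 4 : ℝ) + t * I) :=
  (rapidDecay_afeWeight (a := 3 / 4) (b := 3 / 4) (by norm_num)).integrable
    (fun z hz _ => differentiableAt_afeWeight (by linarith)) le_rfl le_rfl

/-- The bracket in the main term. -/
noncomputable def mainBracket (q : ℕ) : ℝ :=
  Real.log q + 2 * (Real.eulerMascheroniConstant + ∑ p ∈ q.primeFactors, Real.log p / ((p : ℝ) - 1)) +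
    (logDeriv Real.Gamma (1 / 2) - Real.log (2 * Real.pi) - Real.pi / 2)

/-- Since `p - 1 ≥ 1`, the sum over primes is at most the logarithm of the radical of `q`. The
bracket is thus `O(log q)`, which makes the superfluous main parts negligible. -/
theorem exists_abs_mainBracket_le : ∃ C : ℝ, 0 ≤ C ∧ ∀ q : ℕ, q ≠ 0 →
    |mainBracket q| ≤ C + 3 * Real.log q := by
  refine ⟨|2 * Real.eulerMascheroniConstant + (logDeriv Real.Gamma (1 / 2) - Real.log (2 * Real.pi) - Real.pi / 2)|,
    abs_nonneg _, fun q hq => ?_⟩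
  have h1 : 0 ≤ ∑ p ∈ q.primeFactors, Real.log p / ((p : ℝ) - 1) := Finset.sum_nonneg fun p hp => by
    have : (1 : ℝ) < p := by exact_mod_cast (Nat.prime_of_mem_primeFactors hp).one_lt
    exact div_nonneg (Real.log_nonneg this.le) (by linarith)
  have h2 : ∑ p ∈ q.primeFactors, Real.log p / ((p : ℝ) - 1) ≤ Real.log q := by
    calc _ ≤ ∑ p ∈ q.primeFactors, Real.log p := Finset.sum_le_sum fun p hp => by
          have : (2 : ℝ) ≤ p := by exact_mod_cast (Nat.prime_of_mem_primeFactors hp).two_le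
          exact div_le_self (Real.log_nonneg (by linarith)) (by linarith)
      _ = Real.log (∏ p ∈ q.primeFactors, (p : ℝ)) := by
          rw [Real.log_prod fun p hp => Nat.cast_ne_zero.mpr (Nat.prime_of_mem_primeFactors hp).ne_zero]
      _ ≤ Real.log q := by
          rw [← Nat.cast_prod]
          have h3 : 0 < ∏ p ∈ q.primeFactors, p := Finset.prod_pos fun p hp =>
            (Nat.prime_of_mem_primeFactors hp).pos
          refine Real.log_le_log (by exact_mod_cast h3) ?_
          exact_mod_cast Nat.le_of_dvd (Nat.pos_of_ne_zero hq) (Nat.prod_primeFactors_dvd q)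
  have h3 : 0 ≤ Real.log q := Real.log_natCast_nonneg q
  have h4 : mainBracket q = (2 * Real.eulerMascheroniConstant +
      (logDeriv Real.Gamma (1 / 2) - Real.log (2 * Real.pi) - Real.pi / 2)) +
      (Real.log q + 2 * ∑ p ∈ q.primeFactors, Real.log p / ((p : ℝ) - 1)) := by
    rw [mainBracket]; ring
  rw [h4]
  refine (abs_add_le _ _).trans ?_
  rw [abs_of_nonneg (show 0 ≤ Real.log q + 2 * ∑ p ∈ q.primeFactors, Real.log p / ((p : ℝ) - 1) by positivity)]
  linarith

/-- The contribution of a factorisation `q = c d` to the main term. -/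
noncomputable def mainPart (q : ℕ) (x : ℕ × ℕ) : ℂ :=
  1 / 2 * mainBracket q * ((q.totient : ℂ) / q) ^ 2 *
    (((ArithmeticFunction.moebius x.1 : ℤ) : ℂ) * x.2.totient / x.1.totient)

/-- The contribution of a factorisation `q = c d` to the secondary term. -/
noncomputable def secondaryPart (q : ℕ) (x : ℕ × ℕ) : ℂ :=
  2 * (Nat.totient q : ℂ) / (Real.sqrt q : ℂ) *
    (((ArithmeticFunction.moebius x.1 : ℤ) : ℂ) ^ 2 / (Nat.totient x.1 : ℂ) *
        (1 / (Nat.totient (min x.1 x.2) : ℂ)) *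
        evenTwistedSum q (min x.1 x.2) (max x.1 x.2))

theorem secondaryTerm_eq_sum (q : ℕ) : secondaryTerm q =
    ∑ x ∈ q.divisorsAntidiagonal with Nat.Coprime x.1 x.2, secondaryPart q x := by
  rw [secondaryTerm, Finset.mul_sum]
  rfl

theorem totient_natCast_ne_zero {n : ℕ} (hn : n ≠ 0) : (n.totient : ℂ) ≠ 0 :=
  Nat.cast_ne_zero.mpr (Nat.totient_pos.mpr (Nat.pos_of_ne_zero hn)).ne'

/-- As `φ(q) = φ(c) φ(d)`, each part is a fixed multiple of `μ(c) φ(d)²`, and these add up to `q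
φ*(q)` over all coprime factorisations. -/
theorem mainTerm_eq_sum (q : ℕ) [NeZero q] : (mainTerm q : ℂ) =
    ∑ x ∈ q.divisorsAntidiagonal with Nat.Coprime x.1 x.2, mainPart q x := by
  have hq0 : (q : ℂ) ≠ 0 := Nat.cast_ne_zero.mpr (NeZero.ne q)
  have h1 : ∀ x ∈ q.divisorsAntidiagonal.filter (fun x => Nat.Coprime x.1 x.2), mainPart q x =
      1 / 2 * mainBracket q * (q.totient : ℂ) / (q : ℂ) ^ 2 *
        (((ArithmeticFunction.moebius x.1 : ℤ) : ℂ) * (x.2.totient : ℂ) ^ 2) := by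
    intro x hx
    rw [Finset.mem_filter, Nat.mem_divisorsAntidiagonal] at hx
    have hx1 : x.1 ≠ 0 := fun h => hx.1.2 (by rw [← hx.1.1, h, zero_mul])
    have h2 : (q.totient : ℂ) = x.1.totient * x.2.totient := by
      rw [← hx.1.1, Nat.totient_mul hx.2, Nat.cast_mul]
    have h3 := totient_natCast_ne_zero hx1
    rw [mainPart, h2]
    field_simp
  rw [Finset.sum_congr rfl h1, ← Finset.mul_sum, ← DirichletCharacter.mul_numPrimitive]
  have h4 : mainTerm q = (numPrimitive q : ℝ) / 2 * ((Nat.totient q : ℝ) / q) * mainBracket q := by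
    rw [mainTerm, mainBracket, Real.log_div (Nat.cast_ne_zero.mpr (NeZero.ne q)) (by positivity)]
    ring
  rw [h4]
  push_cast
  field_simp

theorem integrable_factorTwist {c d : ℕ} [NeZero c] [NeZero d] [NeZero (c * d)] (hcd : Nat.Coprime c d) :
    (Integrable fun t : ℝ => factorTwist (c * d) (c, d) (1 / 2 + (((3 / 4 : ℝ) : ℂ) + t * I)) *
      ((c * d : ℕ) : ℂ) ^ (((3 / 4 : ℝ) : ℂ) + t * I) * afeWeight ((3 / 4 : ℝ) + t * I)) ∧
    ∫ t : ℝ, factorTwist (c * d) (c, d) (1 / 2 + (((3 / 4 : ℝ) : ℂ) + t * I)) *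
      ((c * d : ℕ) : ℂ) ^ (((3 / 4 : ℝ) : ℂ) + t * I) * afeWeight ((3 / 4 : ℝ) + t * I) =
      ((ArithmeticFunction.moebius c : ℤ) : ℂ) ^ 2 * d.totient / 2 *
        (twistedIntegral (Dvd.intro_left c rfl : d ∣ c * d) (c : ZMod d)⁻¹ (3 / 4) afeWeight +
          twistedIntegral (Dvd.intro_left c rfl : d ∣ c * d) (-(c : ZMod d)⁻¹) (3 / 4) afeWeight) := by
  have i1 := integrable_twistedIntegral_right (Dvd.intro_left c rfl : d ∣ c * d) (isUnit_inv_natCast hcd)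
    integrable_afeWeight_vertical
  have i2 := integrable_twistedIntegral_right (Dvd.intro_left c rfl : d ∣ c * d) (isUnit_inv_natCast hcd).neg
    integrable_afeWeight_vertical
  have e : ∀ t : ℝ, factorTwist (c * d) (c, d) (1 / 2 + (((3 / 4 : ℝ) : ℂ) + t * I)) *
      ((c * d : ℕ) : ℂ) ^ (((3 / 4 : ℝ) : ℂ) + t * I) * afeWeight ((3 / 4 : ℝ) + t * I) =
      ((ArithmeticFunction.moebius c : ℤ) : ℂ) ^ 2 * d.totient / 2 *
      (twistedSquare (Dvd.intro_left c rfl : d ∣ c * d) (c : ZMod d)⁻¹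
        (1 / 2 + (((3 / 4 : ℝ) : ℂ) + t * I)) *
      ((c * d : ℕ) : ℂ) ^ (((3 / 4 : ℝ) : ℂ) + t * I) * afeWeight ((3 / 4 : ℝ) + t * I) +
      twistedSquare (Dvd.intro_left c rfl : d ∣ c * d) (-(c : ZMod d)⁻¹)
        (1 / 2 + (((3 / 4 : ℝ) : ℂ) + t * I)) *
      ((c * d : ℕ) : ℂ) ^ (((3 / 4 : ℝ) : ℂ) + t * I) * afeWeight ((3 / 4 : ℝ) + t * I)) := fun t => by
    rw [factorTwist_eq hcd]; ring
  simp_rw [e]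
  refine ⟨(i1.add i2).const_mul _, ?_⟩
  rw [integral_const_mul, integral_add i1 i2]
  rfl

theorem sqrt_mul_secondaryPart {c d : ℕ} [NeZero c] [NeZero (c * d)] (hcd : Nat.Coprime c d) {k M : ℕ} [NeZero k] (hk : min c d = k)
    (hM : max c d = M) (h : k ∣ c * d) (hMk : Nat.Coprime M k) :
    (Real.sqrt (c * d : ℕ) : ℂ) * secondaryPart (c * d) (c, d) =
      ((ArithmeticFunction.moebius c : ℤ) : ℂ) ^ 2 * d.totient *
        (twistedSquare h (M : ZMod k)⁻¹ (1 / 2) + twistedSquare h (-(M : ZMod k)⁻¹) (1 / 2)) := by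
  have h1 : (Real.sqrt (c * d : ℕ) : ℂ) ≠ 0 := by
    rw [ofReal_ne_zero]
    exact (Real.sqrt_pos.mpr (Nat.cast_pos.mpr (NeZero.pos (c * d)))).ne'
  have h2 := totient_natCast_ne_zero (NeZero.ne k)
  have h3 := totient_natCast_ne_zero (NeZero.ne c)
  have h4 : ((c * d).totient : ℂ) = c.totient * d.totient := by rw [Nat.totient_mul hcd, Nat.cast_mul]
  rw [secondaryPart, hk, hM, evenTwistedSum_eq h hMk, h4]
  generalize (Real.sqrt (c * d : ℕ) : ℂ) = r at h1 ⊢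
  field_simp

/-- The contribution of a factorisation `q = c d` to `evenPrimitiveTwist q (1 / 2)`. -/
theorem exists_norm_integral_factorTwist_sub_le {η : ℝ} (h0 : 0 < η) (h1 : η < 1 / 2) :
    ∃ C : ℝ, 0 ≤ C ∧ ∀ (c d : ℕ) [NeZero c] [NeZero d] [NeZero (c * d)], Nat.Coprime c d → 1 < c * d →
      ‖1 / (Real.pi : ℂ) * (∫ t : ℝ, factorTwist (c * d) (c, d) (1 / 2 + (((3 / 4 : ℝ) : ℂ) + t * I)) *
      ((c * d : ℕ) : ℂ) ^ (((3 / 4 : ℝ) : ℂ) + t * I) * afeWeight ((3 / 4 : ℝ) + t * I)) -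
      (Real.sqrt (c * d : ℕ) : ℂ) * (secondaryPart (c * d) (c, d) +
        if c < d then mainPart (c * d) (c, d) else 0)‖ ≤
        C * (d.totient * twistedBound η (c * d) (min c d)) := by
  obtain ⟨C₀, hC₀, hA⟩ := exists_norm_twistedIntegral_afeWeight_sub_le h0 h1
  obtain ⟨C₁, hC₁, hW⟩ := exists_norm_twistedIntegral_expWeight_sub_le (Or.inl rfl : (1 : ℝ) = 1 ∨ (1 : ℝ) = -1) h0 h1
  obtain ⟨C₂, hC₂, hW'⟩ := exists_norm_twistedIntegral_expWeight_sub_le (Or.inr rfl : (-1 : ℝ) = 1 ∨ (-1 : ℝ) = -1) h0 h1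
  refine ⟨2 * C₀ + C₁ + C₂, by positivity, fun c d _ _ _ hcd hq => ?_⟩
  have hpi : (Real.pi : ℂ) ≠ 0 := ofReal_ne_zero.mpr Real.pi_ne_zero
  rw [(integrable_factorTwist hcd).2]
  set m : ℂ := ((ArithmeticFunction.moebius c : ℤ) : ℂ) with hm
  set a : ℂ := 1 / (Real.pi : ℂ) * (m ^ 2 * d.totient / 2) with ha
  have hna : ‖a‖ ≤ d.totient := by
    rw [ha, norm_mul, norm_div, norm_div, norm_mul, norm_pow, norm_one, Complex.norm_natCast,
      Complex.norm_real, Real.norm_of_nonneg Real.pi_pos.le, Complex.norm_two]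
    have e1 : ‖m‖ ^ 2 ≤ 1 := pow_le_one₀ (norm_nonneg _) (norm_moebius_le_one c)
    have e2 : 1 / Real.pi ≤ 1 := by
      rw [div_le_one Real.pi_pos]; linarith [Real.pi_gt_three]
    calc _ ≤ 1 * (1 * (d.totient : ℝ) / 2) := by gcongr
      _ ≤ _ := by linarith [(d.totient.cast_nonneg : (0 : ℝ) ≤ d.totient)]
  rcases lt_trichotomy c d with hlt | heq | hgt
  -- The modulus `d` is the larger one, and reciprocity replaces it by `c`. The `afeWeight`
  -- integrals produce the secondary part, the `expWeight` integrals the main part.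
  · have hmin : min c d = c := min_eq_left hlt.le
    have hmax : max c d = d := max_eq_right hlt.le
    have hdvd : c ∣ c * d := Dvd.intro d rfl
    have hb : IsUnit (d : ZMod c)⁻¹ := isUnit_inv_natCast hcd.symm
    rw [if_pos hlt, mul_add (Real.sqrt (c * d : ℕ) : ℂ), sqrt_mul_secondaryPart hcd hmin hmax hdvd hcd.symm, hmin]
    have r1 := twistedIntegral_reciprocity hcd hq (u := 1) (Or.inl rfl)
    have r2 := twistedIntegral_reciprocity hcd hq (u := -1) (Or.inr rfl)
    simp only [Int.cast_one, Int.cast_neg, one_mul, neg_mul, neg_neg] at r1 r2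
    have b1 := hA (c * d) c hdvd (-(d : ZMod c)⁻¹)
    have b2 := hA (c * d) c hdvd (d : ZMod c)⁻¹
    have b3 := hW (c * d) c hdvd (-(d : ZMod c)⁻¹) hb.neg
    have b4 := hW' (c * d) c hdvd (d : ZMod c)⁻¹ hb
    set P : ℂ := ((c * d : ℕ) : ℂ) ^ (1 / 2 : ℂ) * (m / c.totient * (((c * d).totient : ℂ) / (c * d : ℕ)) ^ 2)
      with hP
    set Λ : ℂ := Real.log (c * d : ℕ) + 2 * (Real.eulerMascheroniConstant +
      ∑ p ∈ (c * d).primeFactors, (Real.log p : ℂ) / ((p : ℂ) - 1)) with hΛ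
    have hbr : (mainBracket (c * d) : ℂ) = Λ + deriv gammaFactor (1 / 2) := by
      rw [deriv_gammaFactor_one_half, mainBracket, hΛ]
      push_cast
      ring
    have hsqrt : (Real.sqrt (c * d : ℕ) : ℂ) = ((c * d : ℕ) : ℂ) ^ (1 / 2 : ℂ) := by
      rw [Real.sqrt_eq_rpow, ofReal_cpow (by positivity), ofReal_natCast]
      push_cast; rfl
    -- The factor `μ(c)²` comes from the decomposition, and a further `μ(c)` is the Gauss sum of the
    -- trivial character modulo `c`.
    have hm3 : m ^ 2 * m = m := by
      have h3 : ArithmeticFunction.moebius c ^ 2 * ArithmeticFunction.moebius c =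
          ArithmeticFunction.moebius c := by
        by_cases h4 : ArithmeticFunction.moebius c = 0
        · rw [h4]; norm_num
        · rcases ArithmeticFunction.moebius_ne_zero_iff_eq_or.mp h4 with h5 | h5 <;> rw [h5] <;> norm_num
      rw [hm]
      exact_mod_cast h3
    have hmain : (Real.sqrt (c * d : ℕ) : ℂ) * mainPart (c * d) (c, d) =
        a * (2 * Real.pi * (P * (expWeight 1 (1 / 2) * Λ + deriv (expWeight 1) (1 / 2))) +
          2 * Real.pi * (P * (expWeight (-1) (1 / 2) * Λ + deriv (expWeight (-1)) (1 / 2)))) := by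
      have w1 := expWeight_one_half_add
      have w2 := deriv_expWeight_one_half_add
      have e1 : (2 * Real.pi * (P * (expWeight 1 (1 / 2) * Λ + deriv (expWeight 1) (1 / 2))) +
          2 * Real.pi * (P * (expWeight (-1) (1 / 2) * Λ + deriv (expWeight (-1)) (1 / 2)))) =
          Real.pi * P * mainBracket (c * d) := by
        rw [hbr]
        linear_combination 2 * Real.pi * P * Λ * w1 + 2 * Real.pi * P * w2
      rw [e1, hP, ha, hsqrt, mainPart, ← hm]
      have h3 : (1 / Real.pi : ℂ) * Real.pi = 1 := one_div_mul_cancel hpi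
      linear_combination (-((c * d : ℕ) : ℂ) ^ (1 / 2 : ℂ) * mainBracket (c * d) *
        (((c * d).totient : ℂ) / (c * d : ℕ)) ^ 2 * d.totient / c.totient / 2) * (m * (m ^ 2) * h3 + hm3)
    rw [hmain]
    have hdecomp : 1 / (Real.pi : ℂ) * (m ^ 2 * d.totient / 2 *
        (twistedIntegral (Dvd.intro_left c rfl : d ∣ c * d) (c : ZMod d)⁻¹ (3 / 4) afeWeight +
          twistedIntegral (Dvd.intro_left c rfl : d ∣ c * d) (-(c : ZMod d)⁻¹) (3 / 4) afeWeight)) -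
        (m ^ 2 * d.totient * (twistedSquare hdvd (d : ZMod c)⁻¹ (1 / 2) +
          twistedSquare hdvd (-(d : ZMod c)⁻¹) (1 / 2)) +
        a * (2 * Real.pi * (P * (expWeight 1 (1 / 2) * Λ + deriv (expWeight 1) (1 / 2))) +
          2 * Real.pi * (P * (expWeight (-1) (1 / 2) * Λ + deriv (expWeight (-1)) (1 / 2))))) =
        a * ((twistedIntegral hdvd (-(d : ZMod c)⁻¹) (3 / 4) afeWeight -
            2 * Real.pi * twistedSquare hdvd (-(d : ZMod c)⁻¹) (1 / 2)) +
          (twistedIntegral hdvd (d : ZMod c)⁻¹ (3 / 4) afeWeight -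
            2 * Real.pi * twistedSquare hdvd (d : ZMod c)⁻¹ (1 / 2)) +
          (twistedIntegral hdvd (-(d : ZMod c)⁻¹) (3 / 4) (expWeight 1) -
            2 * Real.pi * (P * (expWeight 1 (1 / 2) * Λ + deriv (expWeight 1) (1 / 2)))) +
          (twistedIntegral hdvd (d : ZMod c)⁻¹ (3 / 4) (expWeight (-1)) -
            2 * Real.pi * (P * (expWeight (-1) (1 / 2) * Λ + deriv (expWeight (-1)) (1 / 2))))) := by
      rw [r1, r2, ha]
      field_simp
      ring
    rw [hdecomp, norm_mul]
    calc _ ≤ (d.totient : ℝ) * (C₀ * twistedBound η (c * d) c + C₀ * twistedBound η (c * d) c +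
          C₁ * twistedBound η (c * d) c + C₂ * twistedBound η (c * d) c) := by
          refine mul_le_mul hna ?_ (norm_nonneg _) (Nat.cast_nonneg _)
          refine (norm_add_le _ _).trans (add_le_add ((norm_add_le _ _).trans (add_le_add
            ((norm_add_le _ _).trans (add_le_add b1 b2)) b3)) b4)
      _ = _ := by ring
  -- Equal coprime factors would force `q = 1`.
  · rw [heq, Nat.coprime_self] at hcd
    rw [heq, hcd] at hq
    omega
  -- The modulus `d` is already the smaller one: only the central value is picked up and no main
  -- part arises.
  · have hmin : min c d = d := min_eq_right hgt.le
    have hmax : max c d = c := max_eq_left hgt.le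
    have hdvd : d ∣ c * d := Dvd.intro_left c rfl
    rw [if_neg hgt.le.not_gt, add_zero, sqrt_mul_secondaryPart hcd hmin hmax hdvd hcd, hmin]
    have b1 := hA (c * d) d hdvd (c : ZMod d)⁻¹
    have b2 := hA (c * d) d hdvd (-(c : ZMod d)⁻¹)
    have hdecomp : 1 / (Real.pi : ℂ) * (m ^ 2 * d.totient / 2 *
        (twistedIntegral hdvd (c : ZMod d)⁻¹ (3 / 4) afeWeight +
          twistedIntegral hdvd (-(c : ZMod d)⁻¹) (3 / 4) afeWeight)) -
        m ^ 2 * d.totient * (twistedSquare hdvd (c : ZMod d)⁻¹ (1 / 2) +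
          twistedSquare hdvd (-(c : ZMod d)⁻¹) (1 / 2)) =
        a * ((twistedIntegral hdvd (c : ZMod d)⁻¹ (3 / 4) afeWeight -
            2 * Real.pi * twistedSquare hdvd (c : ZMod d)⁻¹ (1 / 2)) +
          (twistedIntegral hdvd (-(c : ZMod d)⁻¹) (3 / 4) afeWeight -
            2 * Real.pi * twistedSquare hdvd (-(c : ZMod d)⁻¹) (1 / 2))) := by
      rw [ha]
      field_simp
      ring
    rw [hdecomp, norm_mul]
    have hT := twistedBound_nonneg η (c * d) d
    calc _ ≤ (d.totient : ℝ) * (C₀ * twistedBound η (c * d) d + C₀ * twistedBound η (c * d) d) := by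
          refine mul_le_mul hna ?_ (norm_nonneg _) (Nat.cast_nonneg _)
          exact (norm_add_le _ _).trans (add_le_add b1 b2)
      _ = 2 * C₀ * (d.totient * twistedBound η (c * d) d) := by ring
      _ ≤ _ := by
          refine mul_le_mul_of_nonneg_right (by linarith) (by positivity)

/-- The decisive inequality is `φ(d) min(c, d) ≤ q`. It turns the bound for the smaller modulus into
`q^(1/2)` up to small powers, whatever the sizes of `c` and `d`. -/
theorem totient_mul_twistedBound_le {η : ℝ} (h0 : 0 < η) {c d : ℕ} (hc : c ≠ 0) (hd : d ≠ 0) :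
    (d.totient : ℝ) * twistedBound η (c * d) (min c d) ≤
      ((c * d : ℕ) : ℝ) ^ (1 / 2 + 3 * η) * ((c * d).divisors.card : ℝ) ^ 3 := by
  set q := c * d with hq
  set m := min c d with hm
  have hq0 : q ≠ 0 := mul_ne_zero hc hd
  have hqpos : (0 : ℝ) < q := by positivity
  have hm0 : 0 < m := lt_min (Nat.pos_of_ne_zero hc) (Nat.pos_of_ne_zero hd)
  have hmdvd : m ∣ q := by
    rcases min_choice c d with h | h
    · rw [hm, h]; exact Dvd.intro d rfl
    · rw [hm, h]; exact Dvd.intro_left c rfl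
  have h1 : (d.totient : ℝ) * m ≤ q := by
    have h2 : d.totient * m ≤ c * d := by
      rw [mul_comm c d]
      exact Nat.mul_le_mul (Nat.totient_le d) (min_le_left _ _)
    exact_mod_cast h2
  have h2 : (m : ℝ) ^ (2 * η) ≤ (q : ℝ) ^ (2 * η) := by
    gcongr
    exact Nat.le_of_dvd (Nat.pos_of_ne_zero hq0) hmdvd
  have h3 : (m.divisors.card : ℝ) ≤ q.divisors.card := by
    exact_mod_cast Finset.card_le_card (Nat.divisors_subset_of_dvd hq0 hmdvd)
  have h4 : (m : ℝ) ^ (1 + 2 * η) = m * (m : ℝ) ^ (2 * η) := by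
    rw [Real.rpow_add (by exact_mod_cast hm0), Real.rpow_one]
  have h5 : (q : ℝ) ^ (1 / 2 + 3 * η) = q * (q : ℝ) ^ (2 * η) * (q : ℝ) ^ (2 * η) * (q : ℝ) ^ (-1 / 2 - η) := by
    nth_rewrite 2 [← Real.rpow_one (q : ℝ)]
    rw [← Real.rpow_add hqpos, ← Real.rpow_add hqpos, ← Real.rpow_add hqpos]
    congr 1; ring
  rw [twistedBound, h4, h5]
  calc _ = ((d.totient : ℝ) * m) * (m : ℝ) ^ (2 * η) * (m.divisors.card : ℝ) * ((q : ℝ) ^ (2 * η) *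
        (q.divisors.card : ℝ) ^ 2) * (q : ℝ) ^ (-1 / 2 - η) := by ring
    _ ≤ q * (q : ℝ) ^ (2 * η) * (q.divisors.card : ℝ) * ((q : ℝ) ^ (2 * η) *
        (q.divisors.card : ℝ) ^ 2) * (q : ℝ) ^ (-1 / 2 - η) := by gcongr
    _ = _ := by ring

/-- Allows the sum of main parts to be completed to all factorisations: for `d ≤ c` the quotient
`φ(d) / φ(c)` is controlled by the factor `(φ(q) / q)²`, since `φ(c)² φ(d)³ ≤ φ(c) c² d²`. -/
theorem norm_mainPart_le {c d : ℕ} (hc : c ≠ 0) (hcd : Nat.Coprime c d) (h : d ≤ c) :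
    ‖mainPart (c * d) (c, d)‖ ≤ |mainBracket (c * d)| := by
  rcases Nat.eq_zero_or_pos d with rfl | hd
  · simp [mainPart]
  have hφc : (0 : ℝ) < c.totient := by exact_mod_cast Nat.totient_pos.mpr (Nat.pos_of_ne_zero hc)
  have hcR : (0 : ℝ) < c := by positivity
  have hdR : (0 : ℝ) < d := by positivity
  rw [mainPart, norm_mul, norm_mul, norm_mul, norm_div, norm_div, norm_mul, norm_pow, norm_div]
  simp only [Complex.norm_natCast, Complex.norm_real, Real.norm_eq_abs, norm_one, Complex.norm_two]
  have h1 : (c.totient : ℝ) ≤ c := by exact_mod_cast Nat.totient_le c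
  have h2 : (d.totient : ℝ) ≤ d := by exact_mod_cast Nat.totient_le d
  have h3 : (d : ℝ) ≤ c := by exact_mod_cast h
  have h4 : (((c * d).totient : ℝ) / (c * d : ℕ)) ^ 2 * (d.totient / c.totient) ≤ 1 := by
    rw [Nat.totient_mul hcd, div_pow, div_mul_div_comm, div_le_one (by positivity)]
    push_cast
    calc ((c.totient : ℝ) * d.totient) ^ 2 * d.totient
        = (c.totient : ℝ) * c.totient * (d.totient : ℝ) ^ 2 * d.totient := by ring
      _ ≤ (c.totient : ℝ) * c * (d : ℝ) ^ 2 * c := by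
          gcongr
          exact (Nat.totient_le d).trans h
      _ = _ := by ring
  have h5 := norm_moebius_le_one c
  calc _ ≤ 1 / 2 * |mainBracket (c * d)| * (((c * d).totient : ℝ) / (c * d : ℕ)) ^ 2 *
        (1 * d.totient / c.totient) := by gcongr
    _ = 1 / 2 * |mainBracket (c * d)| * ((((c * d).totient : ℝ) / (c * d : ℕ)) ^ 2 *
        (d.totient / c.totient)) := by ring
    _ ≤ 1 / 2 * |mainBracket (c * d)| * 1 := by gcongr
    _ ≤ _ := by linarith [abs_nonneg (mainBracket (c * d))]

theorem evenPrimitiveTwist_one_half_eq_sum {q : ℕ} [NeZero q] (hq : 1 < q) :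
    evenPrimitiveTwist q (1 / 2) = ∑ x ∈ q.divisorsAntidiagonal with Nat.Coprime x.1 x.2,
      1 / (Real.pi : ℂ) * ∫ t : ℝ, factorTwist q x (1 / 2 + (((3 / 4 : ℝ) : ℂ) + t * I)) *
      (q : ℂ) ^ (((3 / 4 : ℝ) : ℂ) + t * I) * afeWeight ((3 / 4 : ℝ) + t * I) := by
  have hpi : (Real.pi : ℂ) ≠ 0 := ofReal_ne_zero.mpr Real.pi_ne_zero
  have h1 := integral_evenPrimitiveTwist hq
  rw [← Finset.mul_sum, ← integral_finsetSum]
  · rw [eq_comm, one_div, inv_mul_eq_iff_eq_mul₀ hpi, ← h1]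
    congr 1
    ext t
    rw [evenPrimitiveTwist_eq_sum, Finset.sum_mul, Finset.sum_mul]
    rfl
  · rintro ⟨c, d⟩ hx
    rw [Finset.mem_filter, Nat.mem_divisorsAntidiagonal] at hx
    obtain ⟨⟨rfl, h0⟩, hcd⟩ := hx
    have : NeZero c := ⟨fun h => h0 (by simp [h])⟩
    have : NeZero d := ⟨fun h => h0 (by simp [h])⟩
    exact (integrable_factorTwist hcd).1

/-! ### The final estimate -/

/-- The second moment formula with an error term `O(q^ε)`. -/
theorem exists_norm_evenPrimitiveMeanSquare_sub_le {ε : ℝ} (hε : 0 < ε) :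
    ∃ C : ℝ, 0 ≤ C ∧ ∀ (q : ℕ) [NeZero q], 1 < q →
      ‖(evenPrimitiveMeanSquare q : ℂ) - ((mainTerm q : ℂ) + secondaryTerm q)‖ ≤ C * (q : ℝ) ^ ε := by
  -- Seven powers `q ^ η` are spent: three in the bound per factorisation, three on the cube of
  -- `d(q)`, one on the number of factorisations. The cap `1/4` keeps the shifted line admissible.
  set η : ℝ := min (ε / 7) (1 / 4) with hη
  have h0 : 0 < η := lt_min (by positivity) (by norm_num)
  have h1 : η < 1 / 2 := (min_le_right _ _).trans_lt (by norm_num)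
  have h7 : 7 * η ≤ ε := by linarith [min_le_left (ε / 7) (1 / 4)]
  obtain ⟨C, hC0, hC⟩ := exists_norm_integral_factorTwist_sub_le h0 h1
  obtain ⟨K, hK1, hK⟩ := exists_card_divisors_le h0
  obtain ⟨B, hB0, hB⟩ := exists_abs_mainBracket_le
  refine ⟨K * (C * K ^ 3 + (B + 3 / η)), by positivity, fun q _ hq => ?_⟩
  have hq0 : q ≠ 0 := by omega
  have hqpos : (0 : ℝ) < q := by positivity
  have hq1 : (1 : ℝ) ≤ q := by exact_mod_cast hq.le
  have hsq : (0 : ℝ) < Real.sqrt q := Real.sqrt_pos.mpr hqpos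
  have hsqc : (Real.sqrt q : ℂ) ≠ 0 := ofReal_ne_zero.mpr hsq.ne'
  set s := q.divisorsAntidiagonal.filter (fun x => Nat.Coprime x.1 x.2) with hs
  set X : ℕ × ℕ → ℂ := fun x => 1 / (Real.pi : ℂ) * ∫ t : ℝ,
    factorTwist q x (1 / 2 + (((3 / 4 : ℝ) : ℂ) + t * I)) *
      (q : ℂ) ^ (((3 / 4 : ℝ) : ℂ) + t * I) * afeWeight ((3 / 4 : ℝ) + t * I) with hX
  have hmean : (evenPrimitiveMeanSquare q : ℂ) - ((mainTerm q : ℂ) + secondaryTerm q) =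
      ∑ x ∈ s, ((Real.sqrt q : ℂ)⁻¹ * X x - (mainPart q x + secondaryPart q x)) := by
    rw [Finset.sum_sub_distrib, Finset.sum_add_distrib, ← Finset.mul_sum, ← evenPrimitiveTwist_one_half_eq_sum hq,
      ← mainTerm_eq_sum, ← secondaryTerm_eq_sum, ← sqrt_mul_evenPrimitiveMeanSquare hq,
      inv_mul_cancel_left₀ hsqc]
  have hbr : |mainBracket q| ≤ (B + 3 / η) * (q : ℝ) ^ η := by
    refine (hB q hq0).trans ?_
    have e1 : (1 : ℝ) ≤ (q : ℝ) ^ η := Real.one_le_rpow hq1 h0.le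
    have e2 := Real.log_le_rpow_div hqpos.le h0
    calc B + 3 * Real.log q ≤ B * (q : ℝ) ^ η + 3 * ((q : ℝ) ^ η / η) := by
          gcongr
          exact le_mul_of_one_le_right hB0 e1
      _ = _ := by ring
  have hterm : ∀ x ∈ s, ‖(Real.sqrt q : ℂ)⁻¹ * X x - (mainPart q x + secondaryPart q x)‖ ≤
      C * ((q : ℝ) ^ (3 * η) * (q.divisors.card : ℝ) ^ 3) + |mainBracket q| := by
    rintro ⟨c, d⟩ hx
    rw [hs, Finset.mem_filter, Nat.mem_divisorsAntidiagonal] at hx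
    obtain ⟨⟨hxq, -⟩, hcd⟩ := hx
    dsimp only at hxq hcd
    subst hxq
    have hc0 : c ≠ 0 := fun h => hq0 (by simp [h])
    have hd0 : d ≠ 0 := fun h => hq0 (by simp [h])
    have : NeZero c := ⟨hc0⟩
    have : NeZero d := ⟨hd0⟩
    have e1 := (hC c d hcd hq).trans (mul_le_mul_of_nonneg_left (totient_mul_twistedBound_le h0 hc0 hd0) hC0)
    -- Replacing `T` by the full main part completes the main term; the change is nonzero only for
    -- `d ≤ c`, where it is `O(log q)`.
    set T : ℂ := if c < d then mainPart (c * d) (c, d) else 0 with hT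
    have e2 : ‖T - mainPart (c * d) (c, d)‖ ≤ |mainBracket (c * d)| := by
      rw [hT]
      split_ifs with hlt
      · simp
      · rw [zero_sub, norm_neg]
        exact norm_mainPart_le hc0 hcd (not_lt.mp hlt)
    have e3 : (Real.sqrt (c * d : ℕ) : ℂ)⁻¹ * X (c, d) - (mainPart (c * d) (c, d) + secondaryPart (c * d) (c, d)) =
        (Real.sqrt (c * d : ℕ) : ℂ)⁻¹ * (X (c, d) - (Real.sqrt (c * d : ℕ) : ℂ) *
          (secondaryPart (c * d) (c, d) + T)) + (T - mainPart (c * d) (c, d)) := by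
      rw [mul_sub, inv_mul_cancel_left₀ hsqc]; ring
    rw [e3]
    refine (norm_add_le _ _).trans (add_le_add ?_ e2)
    rw [norm_mul, norm_inv, Complex.norm_real, Real.norm_of_nonneg hsq.le, inv_mul_le_iff₀ hsq]
    refine e1.trans (le_of_eq ?_)
    rw [Real.rpow_add hqpos, ← Real.sqrt_eq_rpow]; ring
  have hcard : (s.card : ℝ) ≤ q.divisors.card := by
    have e1 := Finset.card_filter_le q.divisorsAntidiagonal (fun x => Nat.Coprime x.1 x.2)
    have e2 : q.divisorsAntidiagonal.card = q.divisors.card := by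
      rw [← Nat.map_div_right_divisors, Finset.card_map]
    rw [e2] at e1
    exact_mod_cast e1
  have hd := hK q hq0
  rw [hmean]
  calc _ ≤ ∑ x ∈ s, (C * ((q : ℝ) ^ (3 * η) * (q.divisors.card : ℝ) ^ 3) + |mainBracket q|) :=
        norm_sum_le_of_le s hterm
    _ = s.card * (C * ((q : ℝ) ^ (3 * η) * (q.divisors.card : ℝ) ^ 3) + |mainBracket q|) := by
        rw [Finset.sum_const, nsmul_eq_mul]
    _ ≤ (K * (q : ℝ) ^ η) * (C * ((q : ℝ) ^ (3 * η) * (K * (q : ℝ) ^ η) ^ 3) +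
          (B + 3 / η) * (q : ℝ) ^ η) := by
        gcongr
        exact hcard.trans hd
    _ = K * (C * K ^ 3 * ((q : ℝ) ^ η * ((q : ℝ) ^ (3 * η) * ((q : ℝ) ^ η) ^ 3)) +
          (B + 3 / η) * ((q : ℝ) ^ η * (q : ℝ) ^ η)) := by ring
    _ ≤ K * (C * K ^ 3 * (q : ℝ) ^ ε + (B + 3 / η) * (q : ℝ) ^ ε) := by
        have e1 : (q : ℝ) ^ η * ((q : ℝ) ^ (3 * η) * ((q : ℝ) ^ η) ^ 3) ≤ (q : ℝ) ^ ε := by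
          rw [← Real.rpow_natCast, ← Real.rpow_mul hqpos.le, ← Real.rpow_add hqpos, ← Real.rpow_add hqpos]
          refine Real.rpow_le_rpow_of_exponent_le hq1 (le_trans (le_of_eq ?_) h7)
          push_cast; ring
        have e2 : (q : ℝ) ^ η * (q : ℝ) ^ η ≤ (q : ℝ) ^ ε := by
          rw [← Real.rpow_add hqpos]
          exact Real.rpow_le_rpow_of_exponent_le hq1 (by linarith)
        gcongr
    _ = _ := by ring

/-- `q ^ ε` is one of the summands, and the others are nonnegative for every real `D`. -/
theorem rpow_le_errorBound (ε : ℝ) (q : ℕ) (D : ℝ) : (q : ℝ) ^ ε ≤ errorBound ε q D := by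
  classical
  unfold errorBound
  have h1 : 0 ≤ 1 / (q : ℝ) * ∑ d ∈ q.divisors with ((d : ℕ) : ℝ) ≤ D,
      (Nat.totient d : ℝ) * (d : ℝ) ^ (3 / 2 : ℝ) :=
    mul_nonneg (by positivity) (Finset.sum_nonneg fun d _ => by positivity)
  have h2 : 0 ≤ Real.sqrt q * ∑ d ∈ q.divisors with D < ((d : ℕ) : ℝ),
      (Nat.totient d : ℝ) / (d : ℝ) ^ (3 / 2 : ℝ) :=
    mul_nonneg (by positivity) (Finset.sum_nonneg fun d _ => by positivity)
  have h3 : 0 ≤ (q : ℝ) ^ (ε - 1) * D ^ 2 := by positivity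
  refine le_trans ?_ (le_add_of_nonneg_right h3)
  refine le_add_of_nonneg_left (add_nonneg ?_ ?_)
  · convert h1
  · convert h2

/-- Both assertions are weakenings of the error `O(q^ε)`. The parameter `D` plays no role beyond
nonnegativity of the other terms, and the second bound is the case `ε = 1/4` together with `d(q) ≥
1`. -/
theorem corollary6 :
    (∀ ε : ℝ, 0 < ε → ∃ C : ℝ, ∀ (q : ℕ) [NeZero q], 1 < q → ∀ D : ℝ,
      ‖(evenPrimitiveMeanSquare q : ℂ) - ((mainTerm q : ℂ) + secondaryTerm q)‖
        ≤ C * errorBound ε q D) ∧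
    (∃ C : ℝ, ∀ (q : ℕ) [NeZero q], 1 < q →
      ‖(evenPrimitiveMeanSquare q : ℂ) - ((mainTerm q : ℂ) + secondaryTerm q)‖
        ≤ C * ((q : ℝ) ^ (1 / 4 : ℝ) * (q.divisors.card : ℝ))) := by
  constructor
  · intro ε hε
    obtain ⟨C, hC0, hC⟩ := exists_norm_evenPrimitiveMeanSquare_sub_le hε
    exact ⟨C, fun q _ hq D => (hC q hq).trans
      (mul_le_mul_of_nonneg_left (rpow_le_errorBound ε q D) hC0)⟩
  · obtain ⟨C, hC0, hC⟩ := exists_norm_evenPrimitiveMeanSquare_sub_le (ε := 1 / 4) (by norm_num)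
    refine ⟨C, fun q _ hq => (hC q hq).trans (mul_le_mul_of_nonneg_left ?_ hC0)⟩
    have h1 : 1 ≤ q.divisors.card := Finset.card_pos.mpr ⟨1, Nat.one_mem_divisors.mpr (by omega)⟩
    exact le_mul_of_one_le_right (by positivity) (by exact_mod_cast h1)
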